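/- **Setting.** Let $(Z_t)$ be a piecewise-deterministic Markov process (PDMP) on a measurable space $E$, with measurable reversible flow $(\Phi_t)_{t\in\mathbb R}$, measurable jump rate $\lambda\ge 0$ such that for each $z$ there is $\varepsilon>0$ with $\int_0^\varepsilon\lambda(\Phi_s z)\,ds<\infty$, and Markov jump kernel $Q$. From a state $z$ the time $S$ to the next event satisfies $\mathbb P(S>t)=\exp(-\int_0^t\lambda(\Phi_s z)\,ds)$, and the state after the event has law $Q(\Phi_S z,\cdot)$. Let $\pi$ be an invariant probability distribution. Suppose that the time reversal of the process started from $\pi$ is a PDMP of the same kind with flow $\Phi_{-t}$: for each $H\ge0$, reversing the path on $[0,H]$ of the first process started from $\pi$ (event times $t\mapsto H-t$, states before and after each event exchanged) gives the law of the path on $[0,H]$ of the second process started from $\pi$. Both processes, started from $\pi$, almost surely have finitely many events in bounded time. A stopping criterion is a measurable set of "valid" finite-length paths, where a path on $[a,b]$ is regarded as a path on $[0,b-a]$ and comprises its length, its states and its events (time, state before, state after). It is assumed that, along full paths on $\mathbb R$ with locally finite, pairwise distinct event times, none of them $0$: 1. (consistency) if the path is valid on $[a,b]$, it is valid on each $[c,d]\subseteq[a,b]$;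 2. (dependence on events only) if the events of two paths on $[a,b]$ and on $[a',b']$ (times and states before and after) coincide up to a time translation, and $a$ (resp. $b$) is an event time of the first path if and only if $a'$ (resp. $b'$) is one of the second, then either both paths are valid or both are not. **Algorithm at stationarity.** Draw $Z_0\sim\pi$; conditionally on $Z_0$, build independently $(Z_t)_{t\ge0}$ by running the PDMP forward in time and $(Z_t)_{t\le0}$ by running its time reversal backward in time. Let $\alpha\sim\mathrm{Unif}(0,1)$ be independent of $(Z_t)_{t\in\mathbb R}$. Put $$T=\sup\{t\ge0:\ (Z_s)_{s\in[-\alpha t,(1-\alpha)t]}\text{ is valid}\},\qquad l=\alpha T,$$ and let $X=(Z_{t-\alpha T})_{t\in[0,T]}$ be the stopped path (with its length and its events, including those at the endpoints). The path is constructible if $0<T<\infty$. With $a=-\alpha T$ and $b=(1-\alpha)T$, the criterion is hit going forward if for some $a'\in(a,0]$ the path is not valid on $[a',b']$ for any $b'>b$; it is hit going backward if for some $b'\in[0,b)$ the path is not valid on $[a',b']$ for any $a'<a$. **Statement.** Almost surely, if the stopped path $X$ is constructible, then the criterion was hit either going forward or going backward, but not both, and the conditional law of the starting offset $l$ given $X$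 is * the probability measure on $[0,T]$ with density $l\mapsto \dfrac{2(T-l)}{T^2}$ (proportional to $T-l$), if the criterion was hit going forward; * the probability measure on $[0,T]$ with density $l\mapsto \dfrac{2l}{T^2}$ (proportional to $l$), if the criterion was hit going backward. -/

import Mathlib

open MeasureTheory ProbabilityTheory Set Filter Topology
open scoped ENNReal NNReal

noncomputable section

/-- The characteristics of a piecewise-deterministic Markov process on `E`: the (reversible)
deterministic flow `Φ`, the jump rate `λ` and the jump kernel `Q`. The last field is the usual
condition that the rate is integrable along the flow for a short time, so that
events do not happen instantaneously. -/
structure PDMP (E : Type*) [MeasurableSpace E] where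
  flow : ℝ → E → E
  measurable_flow : Measurable (fun p : E × ℝ => flow p.2 p.1)
  flow_zero : ∀ z, flow 0 z = z
  flow_add : ∀ s t z, flow (s + t) z = flow s (flow t z)
  rate : E → ℝ≥0
  measurable_rate : Measurable rate
  jump : Kernel E E
  isMarkovKernel_jump : IsMarkovKernel jump
  rate_integrable : ∀ z, ∃ ε : ℝ, 0 < ε ∧ ∫⁻ s in Ioc 0 ε, (rate (flow s z) : ℝ≥0∞) < ∞

/-- The skeleton of a one-sided path. Its `n`-th entry is `(Sₙ, zₙ)`, where `z₀` is the initial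
state, `Sₙ` (for `n ≥ 1`) is the time between the `(n-1)`-th and the `n`-th event, and `zₙ` is the
state immediately after the `n`-th event. The value `Sₙ = ∞` means that there is no `n`-th
event; the later entries then carry no information. The entry `S₀` is not used. -/
abbrev Skeleton (E : Type*) := ℕ → ℝ≥0∞ × E

/-- The time of the `n`-th event (`0` for `n = 0`). -/
def Skeleton.eventTime {E : Type*} (y : Skeleton E) (n : ℕ) : ℝ≥0∞ :=
  ∑ i ∈ Finset.range n, (y (i + 1)).1

/-- Event times are positive, strictly increasing, and do not accumulate. -/
def Skeleton.Regular {E : Type*} (y : Skeleton E) : Prop :=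
  (∀ n, 0 < (y (n + 1)).1) ∧ Tendsto y.eventTime atTop (𝓝 ∞)

/-- A path on a compact time interval, with the interval translated to `[0, T]`: its length `T`, its
state at the left endpoint, and its events. An event is a triple (time, state just
before the event, state just after the event), and the collection of the events is encoded as the
sum of the Dirac masses at these triples. -/
abbrev PathSegment (E : Type*) [MeasurableSpace E] := ℝ × E × Measure (ℝ × E × E)

/-- A full path `(Z_t)_{t ∈ ℝ}`: the skeleton of the part after time `0`, and the skeleton of the
part before time `0`, the latter described in reversed time. -/
abbrev FullPath (E : Type*) := Skeleton E × Skeleton E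

namespace PDMP

variable {E : Type*} [MeasurableSpace E]

/-- The integrated rate `∫₀ᵗ λ(Φ_s z) ds`. -/
def cumRate (D : PDMP E) (z : E) (t : ℝ) : ℝ≥0∞ :=
  ∫⁻ s in Ioc 0 t, (D.rate (D.flow s z) : ℝ≥0∞)

/-- The first time at which the integrated rate, started from `z`, reaches the level `e`. If `e` is
exponentially distributed, it is the first event time of an inhomogeneous Poisson process with
rate `λ(Φ_t z)`. -/
def holdTime (D : PDMP E) (z : E) (e : ℝ) : ℝ≥0∞ :=
  ⨅ (t : ℝ≥0) (_ : ENNReal.ofReal e ≤ D.cumRate z t), (t : ℝ≥0∞)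

theorem cumRate_mono (D : PDMP E) (z : E) {s t : ℝ} (h : s ≤ t) :
    D.cumRate z s ≤ D.cumRate z t :=
  lintegral_mono_set (Ioc_subset_Ioc_right h)

theorem measurable_cumRate (D : PDMP E) (t : ℝ) : Measurable (fun z => D.cumRate z t) := by
  unfold cumRate
  have h : Measurable (fun p : E × ℝ => (D.rate (D.flow p.2 p.1) : ℝ≥0∞)) :=
    (D.measurable_rate.comp D.measurable_flow).coe_nnreal_ennreal
  exact h.lintegral_prod_right'

theorem measurable_holdTime (D : PDMP E) :
    Measurable (fun p : E × ℝ => D.holdTime p.1 p.2) := by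
  refine measurable_of_Iio fun c => ?_
  have h : (fun p : E × ℝ => D.holdTime p.1 p.2) ⁻¹' Iio c
      = ⋃ q : ℚ, ⋃ _ : ENNReal.ofReal (q : ℝ) < c ∧ (0 : ℝ) ≤ q,
        {p : E × ℝ | ENNReal.ofReal p.2 ≤ D.cumRate p.1 q} := by
    ext ⟨z, e⟩
    simp only [holdTime, mem_preimage, mem_Iio, iInf_lt_iff, mem_iUnion, mem_ofPred_eq,
      exists_prop]
    constructor
    · rintro ⟨t, ht, htc⟩
      obtain ⟨q, hq0, htq, hqc⟩ := ENNReal.lt_iff_exists_rat_btwn.1 htc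
      refine ⟨q, ⟨hqc, by exact_mod_cast hq0⟩, ht.trans (D.cumRate_mono z ?_)⟩
      have h1 : t < Real.toNNReal q := by exact_mod_cast htq
      have h2 : (t : ℝ) < (Real.toNNReal q : ℝ) := by exact_mod_cast h1
      rw [Real.coe_toNNReal _ (by exact_mod_cast hq0)] at h2
      exact h2.le
    · rintro ⟨q, ⟨hqc, hq0⟩, hq⟩
      refine ⟨Real.toNNReal q, ?_, hqc⟩
      rwa [Real.coe_toNNReal _ hq0]
  rw [h]
  refine MeasurableSet.iUnion fun q => MeasurableSet.iUnion fun _ => ?_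
  exact measurableSet_le (ENNReal.measurable_ofReal.comp measurable_snd)
    ((D.measurable_cumRate q).comp measurable_fst)

theorem measurable_preJump (D : PDMP E) :
    Measurable (fun p : E × ℝ≥0∞ => D.flow p.2.toReal p.1) :=
  D.measurable_flow.comp (measurable_fst.prodMk measurable_snd.ennreal_toReal)

instance isProbabilityMeasure_exp : IsProbabilityMeasure (expMeasure 1) :=
  isProbabilityMeasure_expMeasure one_pos

/-- The law of the time to the next event, starting from a given state. -/
def hold (D : PDMP E) : Kernel E ℝ≥0∞ :=
  (Kernel.id ×ₖ Kernel.const E (expMeasure 1)).map (fun p => D.holdTime p.1 p.2)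

instance (D : PDMP E) : IsMarkovKernel D.hold :=
  Kernel.IsMarkovKernel.map _ D.measurable_holdTime

instance (D : PDMP E) : IsMarkovKernel D.jump := D.isMarkovKernel_jump

/-- The joint law of the time `S` to the next event and of the state after this event, starting from
`z`: the latter has law `Q(Φ_S z, ·)`. -/
def next (D : PDMP E) : Kernel E (ℝ≥0∞ × E) :=
  D.hold ⊗ₖ D.jump.comap (fun p : E × ℝ≥0∞ => D.flow p.2.toReal p.1) D.measurable_preJump

instance (D : PDMP E) : IsMarkovKernel D.next := by
  unfold next; infer_instance

/-- The law of the skeleton of the process started from a given state: the Markov chain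
`(Sₙ, zₙ)` with `(Sₙ₊₁, zₙ₊₁) ∼ next zₙ`. -/
def pathKernel (D : PDMP E) : Kernel E (Skeleton E) :=
  (Kernel.traj (X := fun _ => ℝ≥0∞ × E)
    (fun n => D.next.comap
      (fun h : (Π _ : Finset.Iic n, ℝ≥0∞ × E) => (h ⟨n, Finset.mem_Iic.2 le_rfl⟩).2)
      (by fun_prop)) 0).comap
    (fun z => fun _ => ((0 : ℝ≥0∞), z)) (by fun_prop)

/-- The law of the skeleton of the process with initial law `π`. -/
def pathLaw (D : PDMP E) (π : Measure E) : Measure (Skeleton E) :=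
  π.bind D.pathKernel

/-- The state `Z_t` at time `t ≥ 0`. -/
def stateAt (D : PDMP E) (y : Skeleton E) (t : ℝ) : E :=
  let n := sSup {n : ℕ | y.eventTime n ≤ ENNReal.ofReal t}
  D.flow (t - (y.eventTime n).toReal) (y n).2

/-- The left limit `Z_{t-}` at time `t > 0` (that is, the state before the event if there is an
event at time `t`), and the initial state for `t = 0`. -/
def stateBefore (D : PDMP E) (y : Skeleton E) (t : ℝ) : E :=
  let n := sSup {n : ℕ | y.eventTime n < ENNReal.ofReal t}
  D.flow (t - (y.eventTime n).toReal) (y n).2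

open Classical in
/-- The events (time, state before, state after) of a one-sided path. -/
def events (D : PDMP E) (y : Skeleton E) : Measure (ℝ × E × E) :=
  Measure.sum fun n : ℕ =>
    if y.eventTime (n + 1) = ∞ then 0
    else Measure.dirac ((y.eventTime (n + 1)).toReal,
      D.flow (y (n + 1)).1.toReal (y n).2, (y (n + 1)).2)

/-- Started from `π`, the process has finitely many events in bounded time, almost surely. -/
def NonExplosive (D : PDMP E) (π : Measure E) : Prop :=
  ∀ᵐ y ∂(D.pathLaw π), Tendsto y.eventTime atTop (𝓝 ∞)

/-- `π` is an invariant distribution of the process. -/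
def Invariant (D : PDMP E) (π : Measure E) : Prop :=
  ∀ t : ℝ, 0 ≤ t → (D.pathLaw π).map (fun y => D.stateAt y t) = π

/-- `Dr` is the time reversal of the stationary process `D` with invariant distribution `π`: it
follows the reversed flow, and for every `T ≥ 0`, the reversal of the path of `D` on
`[0, T]`, with initial law `π`, has the law of the path of `Dr` on `[0, T]` with initial law `π`.
Here a path is given by its initial state and its events, and reversing it
exchanges the states before and after each event. -/
def IsTimeReversal (D Dr : PDMP E) (π : Measure E) : Prop :=
  (∀ t z, Dr.flow t z = D.flow (-t) z) ∧
  ∀ T : ℝ, 0 ≤ T →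
    (D.pathLaw π).map (fun y => (D.stateAt y T,
        ((D.events y).restrict (Icc 0 T ×ˢ univ)).map
          (fun p : ℝ × E × E => (T - p.1, p.2.2, p.2.1))))
      = (Dr.pathLaw π).map (fun y => ((y 0).2, (Dr.events y).restrict (Icc 0 T ×ˢ univ)))

end PDMP

namespace FullPath

variable {E : Type*} [MeasurableSpace E]

/-- The law of the full path `(Z_t)_{t ∈ ℝ}` built by the algorithm: draw `Z_0 ∼ π`, then,
independently given `Z_0`, run `D` forward in time and the time reversal `Dr` backward in time. -/
def law (D Dr : PDMP E) (π : Measure E) : Measure (FullPath E) :=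
  π.bind (D.pathKernel ×ₖ Dr.pathKernel)

/-- Both parts start from the same state, and the event times are locally finite and do not
coincide. -/
def Regular (w : FullPath E) : Prop :=
  w.1.Regular ∧ w.2.Regular ∧ (w.1 0).2 = (w.2 0).2

/-- The state `Z_t` at time `t ∈ ℝ` (right-continuous in `t`). -/
def state (D Dr : PDMP E) (w : FullPath E) (t : ℝ) : E :=
  if 0 ≤ t then D.stateAt w.1 t else Dr.stateBefore w.2 (-t)

/-- The events (time, state before, state after) of a full path. -/
def events (D Dr : PDMP E) (w : FullPath E) : Measure (ℝ × E × E) :=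
  D.events w.1 + (Dr.events w.2).map (fun p : ℝ × E × E => (-p.1, p.2.2, p.2.1))

/-- There is an event at time `t`. -/
def HasEventAt (D Dr : PDMP E) (w : FullPath E) (t : ℝ) : Prop :=
  events D Dr w ({t} ×ˢ univ) ≠ 0

/-- The path `(Z_s)_{s ∈ [a, b]}`, as a path on `[0, b - a]`. -/
def segment (D Dr : PDMP E) (w : FullPath E) (a b : ℝ) : PathSegment E :=
  (b - a, state D Dr w a,
    ((events D Dr w).restrict (Icc a b ×ˢ univ)).map (fun p : ℝ × E × E => (p.1 - a, p.2)))

end FullPath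

namespace StoppingCriterion

variable {E : Type*} [MeasurableSpace E]

/-- A stopping criterion is given by the set of valid paths. The criterion is consistent if, for
every full path, validity on an interval `[a, b]` implies validity on every
interval `[c, d] ⊆ [a, b]`; equivalently, non-validity passes to larger intervals. -/
def Consistent (D Dr : PDMP E) (valid : Set (PathSegment E)) : Prop :=
  ∀ w : FullPath E, w.Regular → ∀ a b c d : ℝ, a ≤ c → c ≤ d → d ≤ b →
    FullPath.segment D Dr w a b ∈ valid → FullPath.segment D Dr w c d ∈ valid

/-- Validity depends only on the points where events occur: if the events of two paths on
`[a, b]` and on `[a', b']` (times, states before and after) agree up to a translation of time, and if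
the same endpoints of the two intervals are event times, then both paths are valid or both
are not. (A criterion may treat an event at an endpoint differently from an event inside.) -/
def DependsOnlyOnEvents (D Dr : PDMP E) (valid : Set (PathSegment E)) : Prop :=
  ∀ w w' : FullPath E, w.Regular → w'.Regular → ∀ a b a' b' c : ℝ, a ≤ b → a' ≤ b' →
    ((FullPath.events D Dr w).restrict (Icc a b ×ˢ univ)).map
        (fun p : ℝ × E × E => (p.1 + c, p.2))
      = (FullPath.events D Dr w').restrict (Icc a' b' ×ˢ univ) →
    (FullPath.HasEventAt D Dr w a ↔ FullPath.HasEventAt D Dr w' a') →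
    (FullPath.HasEventAt D Dr w b ↔ FullPath.HasEventAt D Dr w' b') →
    (FullPath.segment D Dr w a b ∈ valid ↔ FullPath.segment D Dr w' a' b' ∈ valid)

end StoppingCriterion

namespace NoUTurn

variable {E : Type*} [MeasurableSpace E]

/-- The lengths `t ≥ 0` for which `(Z_s)_{s ∈ [-αt, (1-α)t]}` is valid. -/
def validLengths (D Dr : PDMP E) (valid : Set (PathSegment E)) (w : FullPath E) (α : ℝ) : Set ℝ :=
  {t | 0 ≤ t ∧ FullPath.segment D Dr w (-(α * t)) ((1 - α) * t) ∈ valid}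

/-- The length `T` of the stopped path: the supremum of the valid lengths. -/
def length (D Dr : PDMP E) (valid : Set (PathSegment E)) (w : FullPath E) (α : ℝ) : ℝ :=
  sSup (validLengths D Dr valid w α)

/-- The algorithm builds a path from `w` and `α`: the extension stops, at a positive length. -/
def Constructs (D Dr : PDMP E) (valid : Set (PathSegment E)) (w : FullPath E) (α : ℝ) : Prop :=
  BddAbove (validLengths D Dr valid w α) ∧ 0 < length D Dr valid w α

/-- The left endpoint `-αT` of the stopped path, in the time of the full path. -/
def left (D Dr : PDMP E) (valid : Set (PathSegment E)) (w : FullPath E) (α : ℝ) : ℝ :=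
  -(α * length D Dr valid w α)

/-- The right endpoint `(1-α)T` of the stopped path, in the time of the full path. -/
def right (D Dr : PDMP E) (valid : Set (PathSegment E)) (w : FullPath E) (α : ℝ) : ℝ :=
  (1 - α) * length D Dr valid w α

/-- The stopped path `X`: the path `Z` on `[-αT, (1-α)T]`, translated to `[0, T]`. -/
def path (D Dr : PDMP E) (valid : Set (PathSegment E)) (w : FullPath E) (α : ℝ) : PathSegment E :=
  FullPath.segment D Dr w (left D Dr valid w α) (right D Dr valid w α)

/-- The starting offset `l = αT`: the initial state of the algorithm is the state of `X` at `l`. -/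
def offset (D Dr : PDMP E) (valid : Set (PathSegment E)) (w : FullPath E) (α : ℝ) : ℝ :=
  α * length D Dr valid w α

/-- The criterion was hit going forward: extending the path beyond its right endpoint makes it
invalid, even if its left endpoint is not reached. -/
def HitForward (D Dr : PDMP E) (valid : Set (PathSegment E)) (w : FullPath E) (α : ℝ) : Prop :=
  ∃ a', left D Dr valid w α < a' ∧ a' ≤ 0 ∧
    ∀ b', right D Dr valid w α < b' → FullPath.segment D Dr w a' b' ∉ valid

/-- The criterion was hit going backward: extending the path beyond its left endpoint makes it
invalid, even if its right endpoint is not reached. -/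
def HitBackward (D Dr : PDMP E) (valid : Set (PathSegment E)) (w : FullPath E) (α : ℝ) : Prop :=
  ∃ b', 0 ≤ b' ∧ b' < right D Dr valid w α ∧
    ∀ a', a' < left D Dr valid w α → FullPath.segment D Dr w a' b' ∉ valid

/-- The probability measure on `[0, T]` with density proportional to `T - l`. -/
def forwardLaw (T : ℝ) : Measure ℝ :=
  (volume.restrict (Icc 0 T)).withDensity (fun l => ENNReal.ofReal (2 * (T - l) / T ^ 2))

/-- The probability measure on `[0, T]` with density proportional to `l`. -/
def backwardLaw (T : ℝ) : Measure ℝ :=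
  (volume.restrict (Icc 0 T)).withDensity (fun l => ENNReal.ofReal (2 * l / T ^ 2))

end NoUTurn

end

/-! Validity of `[a, b]` can change only when an endpoint meets an event. Almost surely exactly one
endpoint of a constructible stopped path is an event time. It is not both: events at `e > 0` and `-s
< 0` would force `α e = (1 - α) s`, which pins `α` to a countable set. It is not neither: the
criterion would then be hit forward and backward, which exclude each other
(`ValidFamily.mem_or_mem`). Suppose the right endpoint `e` is an event and the left endpoint `-u` is
not. Validity is then locally constant in the left endpoint, so the stopped path is `[-u, e]`
exactly when `[-u, b]` is valid for `b < e` and invalid for `b > e` (`stopLength_eq_iff_forward`).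
This condition on the path seen from `-u` no longer involves the position of time `0`.

For a fixed realisation and a fixed event `e > 0`, substitute `α = u / (u + e)`, so that `dα = e /
(u + e)² du` (`lintegral_stopLength_forward`). The expectation of `f (X, l)` over forward hits
becomes the expectation of the sum over `e` of the integral of `e / (u + e)² f (Z on [-u, e], u)`
over those `u` for which the hit condition holds. Now look at `Z` through the window `[-u, M + 1 -
u]`, translated to `[0, M + 1]`. By stationarity its law does not depend on `u`
(`lintegral_window`). In the window the event sits at `t = u + e`, the weight is `(t - u) / t²`, and
neither the stopped path nor the hit condition depends on `u`. Hence, given a stopped path of length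
`t`, the offset `u` has density proportional to `t - u`, and averaging `f` over that law changes
nothing (`lintegral_weight_resample`). For backward hits the window is anchored at its right end:
the distance `v` from the start to the right endpoint has density proportional to `T - v`, and `l =
T - v`. Taking `f` to vanish on paths longer than `M` makes bounded windows sufficient.

Stationarity of the two-sided path comes from two facts. Time reversal turns the backward half on
`[-r, 0]` into a forward path on `[0, r]` that ends at `Z_0` (`lintegral_reversal`), and the Markov
property at time `r` attaches the forward half to it (`lintegral_markov`). The state at `-r` is not
part of the data in the reversal hypothesis; it is recovered from `Z_0` and the events. The Markov
property itself follows from the lack of memory of holding times by induction on the number of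
events.

Finally, the direction of the hit is a function of `X`: it is forward if and only if `X` ends at an
event. The two identities therefore combine into one disintegration of the law of `(X, l)`
(`NoUTurn.map_eq_compProd`), and uniqueness of conditional distributions concludes. -/

noncomputable section

/-! ### Holding times and their lack of memory. -/

namespace PDMP

variable {E : Type*} [MeasurableSpace E]

theorem measurable_rate_flow (D : PDMP E) (z : E) :
    Measurable (fun s : ℝ => (D.rate (D.flow s z) : ℝ≥0∞)) :=
  (D.measurable_rate.comp
    (D.measurable_flow.comp (measurable_const.prodMk measurable_id))).coe_nnreal_ennreal

/-- The flow property and translation invariance of Lebesgue measure make the integrated rate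
additive along the flow. -/
theorem cumRate_add (D : PDMP E) (z : E) {r t : ℝ} (hr : 0 ≤ r) (ht : 0 ≤ t) :
    D.cumRate z (r + t) = D.cumRate z r + D.cumRate (D.flow r z) t := by
  unfold cumRate
  rw [← Ioc_union_Ioc_eq_Ioc hr (by linarith : r ≤ r + t),
    lintegral_union measurableSet_Ioc (Ioc_disjoint_Ioc_of_le le_rfl)]
  congr 1
  simp_rw [← D.flow_add]
  have := (measurePreserving_add_right volume r).setLIntegral_comp_preimage
    (s := Ioc r (r + t)) measurableSet_Ioc (D.measurable_rate_flow z)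
  rw [← this]
  congr 2
  ext x
  simp [add_comm r t]

/-- By `rate_integrable`, the integrated rate is absolutely continuous near `0`, so it stays below
`e` for a positive time. -/
theorem holdTime_pos (D : PDMP E) (z : E) {e : ℝ} (he : 0 < e) : 0 < D.holdTime z e := by
  obtain ⟨ε, hε, hfin⟩ := D.rate_integrable z
  obtain ⟨δ, hδ, h⟩ := exists_pos_setLIntegral_lt_of_measure_lt
    (μ := volume.restrict (Ioc 0 ε)) hfin.ne (ENNReal.ofReal_pos.2 he).ne'
  obtain ⟨r, hr0, hr⟩ := ENNReal.lt_iff_exists_nnreal_btwn.1 hδ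
  have hr0' : (0 : ℝ) < r := by exact_mod_cast hr0
  set d : ℝ := min (r : ℝ) ε with hd
  have hd0 : 0 < d := lt_min hr0' hε
  have hlt : D.cumRate z d < ENNReal.ofReal e := by
    have h1 := h (Ioc 0 d) ?_
    · rwa [Measure.restrict_restrict measurableSet_Ioc, inter_eq_self_of_subset_left
        (Ioc_subset_Ioc_right (min_le_right _ _))] at h1
    · refine lt_of_le_of_lt (Measure.restrict_apply_le _ _) ?_
      rw [Real.volume_Ioc, sub_zero]
      refine lt_of_le_of_lt (ENNReal.ofReal_le_ofReal (min_le_left _ _)) ?_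
      simpa using hr
  refine lt_of_lt_of_le (ENNReal.ofReal_pos.2 hd0) (le_iInf₂ fun t ht => ?_)
  by_contra! hcon
  have : (t : ℝ) < d := by
    have := (ENNReal.lt_ofReal_iff_toReal_lt ENNReal.coe_ne_top).1 hcon
    simpa using this
  exact absurd (ht.trans (D.cumRate_mono z this.le)) (not_le.2 hlt)

theorem holdTime_le (D : PDMP E) (z : E) {e r : ℝ} (hr : 0 ≤ r)
    (h : ENNReal.ofReal e ≤ D.cumRate z r) : D.holdTime z e ≤ ENNReal.ofReal r := by
  unfold holdTime
  refine (iInf₂_le (Real.toNNReal r) ?_).trans le_rfl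
  rwa [Real.coe_toNNReal _ hr]

/-- The pathwise form of the lack of memory: if level `e` is not reached by time `r`, the flow
restarts from `Φ_r z` with the level that remains. -/
theorem holdTime_eq_add (D : PDMP E) (z : E) {e r : ℝ} (hr : 0 ≤ r)
    (h : D.cumRate z r < ENNReal.ofReal e) :
    D.holdTime z e = ENNReal.ofReal r + D.holdTime (D.flow r z) (e - (D.cumRate z r).toReal) := by
  have hc : D.cumRate z r ≠ ∞ := h.ne_top
  have hsub : ENNReal.ofReal (e - (D.cumRate z r).toReal) = ENNReal.ofReal e - D.cumRate z r := by
    rw [ENNReal.ofReal_sub _ ENNReal.toReal_nonneg, ENNReal.ofReal_toReal hc]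
  apply le_antisymm
  · unfold holdTime
    rw [ENNReal.add_iInf₂]
    refine le_iInf₂ fun t ht => (iInf₂_le (Real.toNNReal r + t) ?_).trans ?_
    · rw [NNReal.coe_add, Real.coe_toNNReal _ hr]
      have := D.cumRate_add z hr t.coe_nonneg
      rw [hsub] at ht
      exact (tsub_le_iff_left.1 ht).trans this.ge
    · rw [ENNReal.coe_add]; rfl
  · refine le_iInf₂ fun t ht => ?_
    have hrt : r ≤ t := by
      by_contra! hcon
      exact absurd (ht.trans (D.cumRate_mono z hcon.le)) (not_le.2 h)
    have h1 : D.holdTime (D.flow r z) (e - (D.cumRate z r).toReal) ≤ ENNReal.ofReal (t - r) := by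
      refine D.holdTime_le _ (by linarith) ?_
      rw [hsub, tsub_le_iff_left, ← D.cumRate_add z hr (by linarith)]
      simpa using ht
    refine (add_le_add le_rfl h1).trans ?_
    rw [← ENNReal.ofReal_add hr (by linarith)]
    simp

theorem lintegral_expMeasure (f : ℝ → ℝ≥0∞) (hf : Measurable f) :
    ∫⁻ e, f e ∂(expMeasure 1) = ∫⁻ e in Ici 0, ENNReal.ofReal (Real.exp (-e)) * f e := by
  have : expMeasure 1 = volume.withDensity (exponentialPDF 1) := rfl
  rw [this, lintegral_withDensity_eq_lintegral_mul _ (f := exponentialPDF 1)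
    (ENNReal.measurable_ofReal.comp (measurable_exponentialPDFReal 1)) hf,
    ← lintegral_indicator measurableSet_Ici]
  congr 1
  ext e
  by_cases he : 0 ≤ e
  · simp [indicator, he, exponentialPDF_eq]
  · simp [indicator, he, exponentialPDF_eq]

/-- The lack of memory of the exponential law: a translation by `c` multiplies the density by `exp
(-c)`. -/
theorem lintegral_expMeasure_shift {c : ℝ} (hc : 0 ≤ c) (f : ℝ → ℝ≥0∞) (hf : Measurable f) :
    ∫⁻ e, (Ioi c).indicator (fun e => f (e - c)) e ∂(expMeasure 1)
      = ENNReal.ofReal (Real.exp (-c)) * ∫⁻ e, f e ∂(expMeasure 1) := by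
  have hm : Measurable (fun e => f (e - c)) := by fun_prop
  rw [lintegral_expMeasure _ (hm.indicator measurableSet_Ioi),
    lintegral_expMeasure _ hf, ← lintegral_const_mul _ (by fun_prop)]
  -- Removing the null point `0` makes the integrands agree everywhere after the translation by `c`.
  rw [setLIntegral_congr (Ioi_ae_eq_Ici (a := (0:ℝ))).symm, ← lintegral_indicator measurableSet_Ioi,
    ← lintegral_indicator measurableSet_Ici, ← lintegral_add_right_eq_self _ c,
    lintegral_indicator measurableSet_Ici, setLIntegral_congr (Ioi_ae_eq_Ici (a := (0:ℝ))).symm,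
    ← lintegral_indicator measurableSet_Ioi]
  congr 1
  ext e
  by_cases he : 0 < e
  · have : 0 < e + c := by linarith
    simp only [indicator, mem_Ioi, this, he, if_true, lt_add_iff_pos_left, add_sub_cancel_right]
    rw [← mul_assoc, ← ENNReal.ofReal_mul (Real.exp_pos _).le, ← Real.exp_add]
    congr 3; ring
  · simp [indicator, he]

theorem expMeasure_ae_pos : ∀ᵐ e ∂(expMeasure 1), 0 < e := by
  have h := lintegral_expMeasure ((Iic (0:ℝ)).indicator 1) (measurable_one.indicator measurableSet_Iic)
  rw [lintegral_indicator_one measurableSet_Iic, setLIntegral_congr (Ioi_ae_eq_Ici (a := (0:ℝ))).symm,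
    setLIntegral_congr_fun (g := 0) measurableSet_Ioi] at h
  · rw [ae_iff]
    simpa [not_lt, Iic] using h
  · intro e he
    simp [indicator, not_le.2 (show (0 : ℝ) < e from he)]

theorem measurable_holdTime_right (D : PDMP E) (z : E) : Measurable (D.holdTime z) := by
  have h := D.measurable_holdTime.comp (measurable_prodMk_left (x := z))
  simpa only [Function.comp_def] using h

theorem lintegral_hold (D : PDMP E) (z : E) (f : ℝ≥0∞ → ℝ≥0∞) (hf : Measurable f) :
    ∫⁻ s, f s ∂(D.hold z) = ∫⁻ e, f (D.holdTime z e) ∂(expMeasure 1) := by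
  have hm : Measurable (fun p : E × ℝ => f (D.holdTime p.1 p.2)) := hf.comp D.measurable_holdTime
  unfold hold
  rw [Kernel.lintegral_map _ D.measurable_holdTime _ hf, Kernel.lintegral_id_prod hm]
  simp

theorem lintegral_next (D : PDMP E) (z : E) (F : ℝ≥0∞ × E → ℝ≥0∞) (hF : Measurable F) :
    ∫⁻ x, F x ∂(D.next z)
      = ∫⁻ s, ∫⁻ z', F (s, z') ∂(D.jump (D.flow s.toReal z)) ∂(D.hold z) := by
  unfold next
  rw [Kernel.lintegral_compProd _ _ _ hF]
  simp [Kernel.comap_apply]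

theorem ae_next_pos (D : PDMP E) (z : E) : D.next z {x | ¬ 0 < x.1} = 0 := by
  have hS : MeasurableSet {x : ℝ≥0∞ × E | ¬ 0 < x.1} :=
    (measurableSet_lt measurable_const measurable_fst).compl
  rw [← lintegral_indicator_one hS, D.lintegral_next z _ (measurable_one.indicator hS)]
  have : ∀ s, ∫⁻ z', ({x : ℝ≥0∞ × E | ¬ 0 < x.1}).indicator 1 (s, z') ∂(D.jump (D.flow s.toReal z))
      = ({0} : Set ℝ≥0∞).indicator 1 s := by
    intro s
    by_cases hs : s = 0 <;> simp [indicator, hs]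
  simp_rw [this]
  rw [D.lintegral_hold z _ (measurable_one.indicator (measurableSet_singleton 0))]
  refine (lintegral_congr_ae ?_).trans lintegral_zero
  filter_upwards [expMeasure_ae_pos] with e he
  simp [(D.holdTime_pos z he).ne']

/-- The probability of no event in `[0, r]`. -/
def survival (D : PDMP E) (z : E) (r : ℝ) : ℝ≥0∞ :=
  if D.cumRate z r = ∞ then 0 else ENNReal.ofReal (Real.exp (-(D.cumRate z r).toReal))

/-- Combines the exponential lack of memory at level `cumRate z r` with `holdTime_eq_add`. If the
integrated rate up to `r` is infinite, survival is impossible and both sides vanish. -/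
theorem lintegral_hold_shift (D : PDMP E) (z : E) {r : ℝ} (hr : 0 ≤ r) (f : ℝ≥0∞ → ℝ≥0∞)
    (hf : Measurable f) :
    ∫⁻ s, (Ioi (ENNReal.ofReal r)).indicator (fun s => f (s - ENNReal.ofReal r)) s ∂(D.hold z)
      = D.survival z r * ∫⁻ s, f s ∂(D.hold (D.flow r z)) := by
  have hm : Measurable (fun e => f (D.holdTime (D.flow r z) e)) :=
    hf.comp (D.measurable_holdTime_right _)
  have hm' : Measurable (fun s : ℝ≥0∞ => f (s - ENNReal.ofReal r)) :=
    hf.comp (measurable_id.sub_const _)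
  rw [D.lintegral_hold z _ (hm'.indicator measurableSet_Ioi), D.lintegral_hold _ _ hf, survival]
  split_ifs with hc
  · rw [zero_mul]
    refine (lintegral_congr fun e => ?_).trans lintegral_zero
    have : D.holdTime z e ≤ ENNReal.ofReal r := D.holdTime_le z hr (by simp [hc])
    simp [indicator, this]
  · rw [← lintegral_expMeasure_shift ENNReal.toReal_nonneg _ hm]
    refine lintegral_congr fun e => ?_
    by_cases he : D.cumRate z r < ENNReal.ofReal e
    · have he' : (D.cumRate z r).toReal < e := (ENNReal.lt_ofReal_iff_toReal_lt hc).1 he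
      have h1 := D.holdTime_eq_add z hr he
      have h2 := D.holdTime_pos (D.flow r z) (sub_pos.2 he')
      have h3 : ENNReal.ofReal r < D.holdTime z e := by
        rw [h1]
        exact ENNReal.lt_add_right ENNReal.ofReal_ne_top h2.ne'
      rw [indicator_of_mem (mem_Ioi.2 h3), indicator_of_mem (mem_Ioi.2 he'), h1,
        ENNReal.add_sub_cancel_left ENNReal.ofReal_ne_top]
    · have he' : ¬ (D.cumRate z r).toReal < e := fun h =>
        he ((ENNReal.lt_ofReal_iff_toReal_lt hc).2 h)
      rw [indicator_of_notMem, indicator_of_notMem (by simpa using he')]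
      simpa using D.holdTime_le z hr (not_lt.1 he)

/-- The lack of memory of the time to the next event. What happens after the last event, at time
`∞`, is immaterial. -/
theorem lintegral_next_shift (D : PDMP E) (z : E) {r : ℝ} (hr : 0 ≤ r) (F : ℝ≥0∞ × E → ℝ≥0∞)
    (hF : Measurable F) (C : ℝ≥0∞) (hC : ∀ z', F (∞, z') = C) :
    ∫⁻ x, {x : ℝ≥0∞ × E | ENNReal.ofReal r < x.1}.indicator
        (fun x => F (x.1 - ENNReal.ofReal r, x.2)) x ∂(D.next z)
      = D.survival z r * ∫⁻ x, F x ∂(D.next (D.flow r z)) := by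
  have hJ : Measurable (fun p : ℝ≥0∞ × E => ∫⁻ z', F (p.1, z') ∂(D.jump p.2)) := by
    have : Measurable (fun p : (ℝ≥0∞ × E) × E => F (p.1.1, p.2)) := by fun_prop
    exact Measurable.lintegral_kernel_prod_right'
      (κ := D.jump.comap (fun p : ℝ≥0∞ × E => p.2) measurable_snd) this
  have hJ' : Measurable (fun s => ∫⁻ z', F (s, z') ∂(D.jump (D.flow s.toReal (D.flow r z)))) :=
    hJ.comp (measurable_id.prodMk (D.measurable_preJump.comp (measurable_const.prodMk measurable_id)))
  rw [D.lintegral_next _ _ hF, ← D.lintegral_hold_shift z hr _ hJ', D.lintegral_next]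
  · refine lintegral_congr fun s => ?_
    by_cases hs : ENNReal.ofReal r < s
    · rw [indicator_of_mem (mem_Ioi.2 hs)]
      -- Since `(∞).toReal = 0`, at `s = ∞` the two sides jump from the unrelated states `z` and
      -- `Φ_r z`; only `hC` makes them agree.
      by_cases hs' : s = ∞
      · subst hs'
        simp [indicator, hC]
      · rw [← D.flow_add, ENNReal.toReal_sub_of_le hs.le hs', ENNReal.toReal_ofReal hr]
        simp [indicator, hs]
    · rw [indicator_of_notMem (by simpa using hs)]
      simp [indicator, hs]
  · exact Measurable.indicator (by fun_prop) (measurableSet_lt measurable_const measurable_fst)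

end PDMP

/-! ### The Markov chain of events and its decomposition at the first event. -/

namespace Skeleton

section

variable {E : Type*}

/-- The skeleton which starts from `z`, has its first event at time `s`, and goes on as `y`. -/
def glue (z : E) (s : ℝ≥0∞) (y : Skeleton E) : Skeleton E
  | 0 => (0, z)
  | 1 => (s, (y 0).2)
  | n + 2 => y (n + 1)

theorem glue_succ_snd (z : E) (s : ℝ≥0∞) (y : Skeleton E) (n : ℕ) :
    (glue z s y (n + 1)).2 = (y n).2 := by
  cases n <;> rfl

end

variable {E : Type*} [MeasurableSpace E]

/-- Two laws of skeletons with the same initial law and the same one-step transitions coincide. -/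
theorem law_unique (κ : Kernel E (ℝ≥0∞ × E)) [IsMarkovKernel κ] (ρ₁ ρ₂ : Measure (Skeleton E))
    [IsProbabilityMeasure ρ₁] [IsProbabilityMeasure ρ₂]
    (h0 : ∀ F : ℝ≥0∞ × E → ℝ≥0∞, Measurable F → ∫⁻ y, F (y 0) ∂ρ₁ = ∫⁻ y, F (y 0) ∂ρ₂)
    (h₁ : ∀ n, ∀ F : (Π _ : Finset.Iic n, ℝ≥0∞ × E) × (ℝ≥0∞ × E) → ℝ≥0∞, Measurable F →
      ∫⁻ y, F (Preorder.frestrictLe n y, y (n + 1)) ∂ρ₁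
        = ∫⁻ y, ∫⁻ x, F (Preorder.frestrictLe n y, x) ∂(κ (y n).2) ∂ρ₁)
    (h₂ : ∀ n, ∀ F : (Π _ : Finset.Iic n, ℝ≥0∞ × E) × (ℝ≥0∞ × E) → ℝ≥0∞, Measurable F →
      ∫⁻ y, F (Preorder.frestrictLe n y, y (n + 1)) ∂ρ₂
        = ∫⁻ y, ∫⁻ x, F (Preorder.frestrictLe n y, x) ∂(κ (y n).2) ∂ρ₂) :
    ρ₁ = ρ₂ := by
  have key : ∀ n, ∀ G : (Π _ : Finset.Iic n, ℝ≥0∞ × E) → ℝ≥0∞, Measurable G →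
      ∫⁻ y, G (Preorder.frestrictLe n y) ∂ρ₁ = ∫⁻ y, G (Preorder.frestrictLe n y) ∂ρ₂ := by
    intro n
    induction n with
    | zero =>
      intro G hG
      have hm : Measurable (fun (x : ℝ≥0∞ × E) (_ : Finset.Iic 0) => x) := by fun_prop
      have e : ∀ y : Skeleton E, Preorder.frestrictLe (π := fun _ => ℝ≥0∞ × E) 0 y
          = (fun (_ : Finset.Iic 0) => y 0) := by
        intro y
        ext1 ⟨i, hi⟩
        obtain rfl : i = 0 := by simpa using hi
        rfl
      simp_rw [e]
      exact h0 _ (hG.comp hm)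
    | succ n ih =>
      intro G hG
      set ext : (Π _ : Finset.Iic n, ℝ≥0∞ × E) × (ℝ≥0∞ × E) → (Π _ : Finset.Iic (n + 1), ℝ≥0∞ × E) :=
        fun p i => if h : (i : ℕ) ≤ n then p.1 ⟨i, Finset.mem_Iic.2 h⟩ else p.2 with hext
      have hm : Measurable ext := by
        refine measurable_pi_lambda _ fun i => ?_
        simp only [hext]
        split_ifs <;> fun_prop
      have e : ∀ y : Skeleton E, Preorder.frestrictLe (π := fun _ => ℝ≥0∞ × E) (n + 1) y
          = ext (Preorder.frestrictLe n y, y (n + 1)) := by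
        intro y
        ext1 ⟨i, hi⟩
        simp only [hext]
        split_ifs with h
        · rfl
        · obtain rfl : i = n + 1 := by
            have := Finset.mem_Iic.1 hi; omega
          rfl
      simp_rw [e]
      have hG' : Measurable (fun p => G (ext p)) := hG.comp hm
      have hI : Measurable (fun h : (Π _ : Finset.Iic n, ℝ≥0∞ × E) =>
          ∫⁻ x, G (ext (h, x)) ∂(κ (h ⟨n, Finset.mem_Iic.2 le_rfl⟩).2)) :=
        Measurable.lintegral_kernel_prod_right' (κ := κ.comap
          (fun h : (Π _ : Finset.Iic n, ℝ≥0∞ × E) => (h ⟨n, Finset.mem_Iic.2 le_rfl⟩).2)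
          (by fun_prop)) hG'
      rw [h₁ n _ hG', h₂ n _ hG']
      exact ih _ hI
  have hrestr : ∀ n, ρ₁.map (Preorder.frestrictLe n) = ρ₂.map (Preorder.frestrictLe n) := by
    intro n
    refine Measure.ext_of_lintegral _ fun G hG => ?_
    rw [lintegral_map hG (by fun_prop), lintegral_map hG (by fun_prop)]
    exact key n G hG
  -- Finite-dimensional marginals determine the law, and every finite set of indices lies in an
  -- initial segment.
  refine IsProjectiveLimit.unique (P := fun I : Finset ℕ => ρ₂.map I.restrict) ?_ (fun I => rfl)
  intro I
  obtain ⟨n, hn⟩ : ∃ n, I ⊆ Finset.Iic n :=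
    ⟨I.sup id, fun i hi => Finset.mem_Iic.2 (Finset.le_sup (f := id) hi)⟩
  have : (I.restrict : Skeleton E → _) = (Finset.restrict₂ hn) ∘ (Preorder.frestrictLe n) := rfl
  have hm := Finset.measurable_restrict₂ (X := fun _ : ℕ => ℝ≥0∞ × E) hn
  rw [this, ← Measure.map_map hm (by fun_prop), hrestr, Measure.map_map hm (by fun_prop)]
  rfl

theorem measurable_glue (z : E) :
    Measurable (fun p : ℝ≥0∞ × Skeleton E => glue z p.1 p.2) := by
  refine measurable_pi_lambda _ fun n => ?_
  match n with
  | 0 => exact measurable_const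
  | 1 => simp only [glue]; fun_prop
  | n + 2 => simp only [glue]; fun_prop

/-- The past of the glued skeleton is a measurable function of `s` and of the past of `y` one step
earlier. This transfers the transition property of `y` to the glued skeleton. -/
theorem frestrictLe_glue_measurable (z : E) (n : ℕ) :
    ∃ g : ℝ≥0∞ × (Π _ : Finset.Iic n, ℝ≥0∞ × E) → (Π _ : Finset.Iic (n + 1), ℝ≥0∞ × E),
      Measurable g ∧ ∀ s y, Preorder.frestrictLe (n + 1) (glue z s y)
        = g (s, Preorder.frestrictLe n y) := by
  refine ⟨fun p i => if h0 : (i : ℕ) = 0 then (0, z) else if h1 : (i : ℕ) = 1 then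
    (p.1, (p.2 ⟨0, by simp⟩).2) else p.2 ⟨(i : ℕ) - 1, ?_⟩, ?_, ?_⟩
  · have := Finset.mem_Iic.1 i.2
    exact Finset.mem_Iic.2 (by omega)
  · refine measurable_pi_lambda _ fun i => ?_
    split_ifs <;> fun_prop
  · intro s y
    ext1 ⟨i, hi⟩
    match i with
    | 0 => simp [glue]
    | 1 => simp [glue]
    | i + 2 => simp [glue]

end Skeleton

namespace PDMP

variable {E : Type*} [MeasurableSpace E]

/-- The transition kernels of the chain `(Sₙ, zₙ)`, as functions of the whole past. -/
abbrev step (D : PDMP E) (n : ℕ) : Kernel (Π _ : Finset.Iic n, ℝ≥0∞ × E) (ℝ≥0∞ × E) :=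
  D.next.comap (fun h : (Π _ : Finset.Iic n, ℝ≥0∞ × E) => (h ⟨n, Finset.mem_Iic.2 le_rfl⟩).2)
    (by fun_prop)

theorem pathKernel_apply (D : PDMP E) (z : E) :
    D.pathKernel z = Kernel.traj (X := fun _ => ℝ≥0∞ × E) D.step 0 (fun _ => ((0 : ℝ≥0∞), z)) := rfl

instance (D : PDMP E) : IsMarkovKernel D.pathKernel := by
  unfold pathKernel; infer_instance

/-- The initial entry is deterministic. This is phrased with integrals because singletons of `E`
need not be measurable, so that "`y 0 = (0, z)` almost surely" is not available. -/
theorem lintegral_pathKernel_update (D : PDMP E) (z : E) (F : Skeleton E → ℝ≥0∞)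
    (hF : Measurable F) :
    ∫⁻ y, F y ∂(D.pathKernel z) = ∫⁻ y, F (Function.update y 0 (0, z)) ∂(D.pathKernel z) := by
  rw [pathKernel_apply, Kernel.lintegral_traj _ hF]
  refine lintegral_congr fun y => ?_
  congr 1
  ext1 i
  by_cases hi : i = 0
  · subst hi; simp [Function.updateFinset]
  · simp [Function.updateFinset, hi]

theorem lintegral_pathKernel_zero (D : PDMP E) (z : E) (F : ℝ≥0∞ × E → ℝ≥0∞)
    (hF : Measurable F) : ∫⁻ y, F (y 0) ∂(D.pathKernel z) = F (0, z) := by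
  have hm : Measurable (fun y : Skeleton E => F (y 0)) := by fun_prop
  rw [D.lintegral_pathKernel_update z _ hm]
  simp

theorem lintegral_pathKernel_step (D : PDMP E) (z : E) (n : ℕ)
    (F : (Π _ : Finset.Iic n, ℝ≥0∞ × E) × (ℝ≥0∞ × E) → ℝ≥0∞) (hF : Measurable F) :
    ∫⁻ y, F (Preorder.frestrictLe n y, y (n + 1)) ∂(D.pathKernel z)
      = ∫⁻ y, ∫⁻ x, F (Preorder.frestrictLe n y, x) ∂(D.next (y n).2) ∂(D.pathKernel z) := by
  have h := Kernel.partialTraj_compProd_eq_map_traj (X := fun _ => ℝ≥0∞ × E) (κ := D.step)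
    (Nat.zero_le n)
    (x₀ := fun _ => ((0 : ℝ≥0∞), z))
  rw [← Kernel.traj_map_frestrictLe_apply] at h
  have h2 := congrArg (fun μ => ∫⁻ p, F p ∂μ) h
  rw [lintegral_map hF (by fun_prop), Measure.lintegral_compProd hF,
    lintegral_map _ (by fun_prop)] at h2
  · exact h2.symm
  · exact hF.lintegral_kernel_prod_right' 

/-- The decomposition of the process at its first event. -/
theorem lintegral_pathKernel_glue (D : PDMP E) (z : E) (F : Skeleton E → ℝ≥0∞)
    (hF : Measurable F) :
    ∫⁻ y, F y ∂(D.pathKernel z)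
      = ∫⁻ x, ∫⁻ y, F (Skeleton.glue z x.1 y) ∂(D.pathKernel x.2) ∂(D.next z) := by
  set η : Measure ((ℝ≥0∞ × E) × Skeleton E) :=
    (D.next z) ⊗ₘ (D.pathKernel.comap (fun x : ℝ≥0∞ × E => x.2) measurable_snd) with hη
  have hg : Measurable (fun p : (ℝ≥0∞ × E) × Skeleton E => Skeleton.glue z p.1.1 p.2) :=
    (Skeleton.measurable_glue z).comp (by fun_prop : Measurable
      (fun p : (ℝ≥0∞ × E) × Skeleton E => (p.1.1, p.2)))
  have hint : ∀ F : Skeleton E → ℝ≥0∞, Measurable F →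
      ∫⁻ y, F y ∂(η.map (fun p => Skeleton.glue z p.1.1 p.2))
        = ∫⁻ x, ∫⁻ y, F (Skeleton.glue z x.1 y) ∂(D.pathKernel x.2) ∂(D.next z) := by
    intro F hF
    have hF' : Measurable (fun p : (ℝ≥0∞ × E) × Skeleton E => F (Skeleton.glue z p.1.1 p.2)) :=
      hF.comp hg
    rw [lintegral_map hF hg, hη, Measure.lintegral_compProd hF']
    rfl
  rw [← hint F hF]
  have : IsProbabilityMeasure (η.map (fun p => Skeleton.glue z p.1.1 p.2)) :=
    Measure.isProbabilityMeasure_map hg.aemeasurable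
  congr 1
  -- Both laws start at `(0, z)` and have the one-step transition `D.next`: at the first step of the
  -- glued law this is its construction, later it is inherited from the law of `y`.
  refine Skeleton.law_unique D.next _ _ ?_ (D.lintegral_pathKernel_step z) ?_
  · intro F hF
    have hm : Measurable (fun y : Skeleton E => F (y 0)) := by fun_prop
    rw [D.lintegral_pathKernel_zero z F hF, hint _ hm]
    simp [Skeleton.glue]
  · intro n F hF
    have hm : Measurable (fun y : Skeleton E => F (Preorder.frestrictLe n y, y (n + 1))) := by
      fun_prop
    have hm' : Measurable (fun y : Skeleton E =>
        ∫⁻ x, F (Preorder.frestrictLe n y, x) ∂(D.next (y n).2)) := by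
      have hF' : Measurable (fun p : Skeleton E × (ℝ≥0∞ × E) =>
        F (Preorder.frestrictLe n p.1, p.2)) := by fun_prop
      exact Measurable.lintegral_kernel_prod_right'
        (κ := D.next.comap (fun y : Skeleton E => (y n).2) (by fun_prop)) hF'
    rw [hint _ hm, hint _ hm']
    cases n with
    | zero =>
      have hc : ∀ s (y : Skeleton E), Preorder.frestrictLe (π := fun _ => ℝ≥0∞ × E) 0
          (Skeleton.glue z s y) = fun _ => (0, z) := by
        intro s y
        ext1 ⟨i, hi⟩
        obtain rfl : i = 0 := by simpa using hi
        rfl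
      simp_rw [hc]
      simp only [Skeleton.glue, lintegral_const, measure_univ, mul_one]
      refine lintegral_congr fun x => ?_
      exact D.lintegral_pathKernel_zero x.2 (fun p => F (fun _ => (0, z), (x.1, p.2))) (by fun_prop)
    | succ n =>
      obtain ⟨g, hgm, hgeq⟩ := Skeleton.frestrictLe_glue_measurable z n
      refine lintegral_congr fun x => ?_
      simp_rw [hgeq, Skeleton.glue_succ_snd]
      exact D.lintegral_pathKernel_step x.2 n (fun p => F (g (x.1, p.1), p.2)) (by fun_prop)

theorem ae_pathKernel_pos (D : PDMP E) (z : E) : ∀ᵐ y ∂(D.pathKernel z), ∀ n, 0 < (y (n + 1)).1 := by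
  rw [ae_all_iff]
  intro n
  have hS : MeasurableSet {x : ℝ≥0∞ × E | ¬ 0 < x.1} :=
    (measurableSet_lt measurable_const measurable_fst).compl
  have h := D.lintegral_pathKernel_step z n
    (fun p => {x : ℝ≥0∞ × E | ¬ 0 < x.1}.indicator 1 p.2)
    ((measurable_one.indicator hS).comp measurable_snd)
  simp only [lintegral_indicator_one hS, D.ae_next_pos, lintegral_zero] at h
  have hS' : MeasurableSet {y : Skeleton E | ¬ 0 < (y (n + 1)).1} :=
    hS.preimage (by fun_prop : Measurable (fun y : Skeleton E => y (n + 1)))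
  rw [ae_iff, ← lintegral_indicator_one hS']
  exact h

end PDMP

/-! ### Event times, states and events as measurable functions of the skeleton. -/

namespace Skeleton

section

variable {E : Type*}

@[simp] theorem eventTime_zero (y : Skeleton E) : y.eventTime 0 = 0 := by simp [eventTime]

theorem eventTime_succ (y : Skeleton E) (n : ℕ) :
    y.eventTime (n + 1) = y.eventTime n + (y (n + 1)).1 := by
  simp [eventTime, Finset.sum_range_succ]

theorem eventTime_mono (y : Skeleton E) : Monotone y.eventTime :=
  monotone_nat_of_le_succ fun n => by rw [eventTime_succ]; exact le_self_add

theorem eventTime_glue_succ (z : E) (s : ℝ≥0∞) (y : Skeleton E) (n : ℕ) :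
    (glue z s y).eventTime (n + 1) = s + y.eventTime n := by
  induction n with
  | zero => simp [eventTime, glue]
  | succ n ih => rw [eventTime_succ, ih, eventTime_succ, add_assoc]; rfl

theorem eventTime_update (y : Skeleton E) (x : ℝ≥0∞ × E) (n : ℕ) :
    Skeleton.eventTime (Function.update y 0 x) n = y.eventTime n := by
  simp [eventTime]

/-- Exactly `n` events occur up to time `t`. -/
def Count (y : Skeleton E) (t : ℝ) (n : ℕ) : Prop :=
  y.eventTime n ≤ ENNReal.ofReal t ∧ ENNReal.ofReal t < y.eventTime (n + 1)

theorem Count.unique {y : Skeleton E} {t : ℝ} {m n : ℕ} (hm : y.Count t m) (hn : y.Count t n) :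
    m = n := by
  by_contra h
  rcases Nat.lt_or_gt_of_ne h with h | h
  · exact absurd (hm.2.trans_le ((y.eventTime_mono h).trans hn.1)) (lt_irrefl _)
  · exact absurd (hn.2.trans_le ((y.eventTime_mono h).trans hm.1)) (lt_irrefl _)

theorem exists_count {y : Skeleton E} (h : Tendsto y.eventTime atTop (𝓝 ∞)) (t : ℝ) :
    ∃ n, y.Count t n := by
  classical
  have hex : ∃ n, ENNReal.ofReal t < y.eventTime n :=
    (h.eventually (lt_mem_nhds (ENNReal.ofReal_lt_top (r := t)))).exists
  obtain ⟨n, hn⟩ : ∃ n, Nat.find hex = n + 1 := by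
    refine Nat.exists_eq_succ_of_ne_zero fun h0 => ?_
    have := Nat.find_spec hex
    rw [h0] at this
    simp at this
  refine ⟨n, not_lt.1 (Nat.find_min hex (by omega)), ?_⟩
  have := Nat.find_spec hex
  rwa [hn] at this

theorem count_glue_succ (z : E) {r : ℝ} {s : ℝ≥0∞} (h : s ≤ ENNReal.ofReal r)
    (y : Skeleton E) (n : ℕ) :
    (glue z s y).Count r (n + 1) ↔ y.Count (r - s.toReal) n := by
  have hs : s ≠ ∞ := ne_top_of_le_ne_top ENNReal.ofReal_ne_top h
  unfold Count
  rw [eventTime_glue_succ, eventTime_glue_succ,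
    ENNReal.ofReal_sub _ ENNReal.toReal_nonneg, ENNReal.ofReal_toReal hs]
  rw [ENNReal.le_sub_iff_add_le_left hs h, ENNReal.sub_lt_iff_lt_left hs h]

end

variable {E : Type*} [MeasurableSpace E]

theorem measurable_eventTime (n : ℕ) : Measurable (fun y : Skeleton E => y.eventTime n) := by
  unfold eventTime
  fun_prop

theorem measurableSet_count (t : ℝ) (n : ℕ) : MeasurableSet {y : Skeleton E | y.Count t n} :=
  (measurableSet_le (measurable_eventTime n) measurable_const).inter
    (measurableSet_lt measurable_const (measurable_eventTime (n + 1)))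

end Skeleton

theorem measurable_sSup_nat {X : Type*} [MeasurableSpace X] (p : ℕ → X → Prop)
    (hp : ∀ n, MeasurableSet {x | p n x}) : Measurable (fun x => sSup {n : ℕ | p n x}) := by
  refine measurable_of_Iic fun k => ?_
  -- An unbounded set of natural numbers has supremum `0` by convention, which is at most `k`; hence
  -- the second set in the union.
  have : (fun x => sSup {n : ℕ | p n x}) ⁻¹' Iic k
      = {x | ∀ n, p n x → n ≤ k} ∪ {x | ∀ m, ∃ n, m < n ∧ p n x} := by
    ext x
    simp only [mem_preimage, mem_Iic, mem_union, mem_ofPred_eq]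
    by_cases hb : BddAbove {n : ℕ | p n x}
    · rw [or_iff_left]
      · refine ⟨fun h n hn => (le_csSup hb hn).trans h, fun h => ?_⟩
        rcases eq_empty_or_nonempty {n : ℕ | p n x} with he | hne
        · simp [he]
        · exact csSup_le hne h
      · intro h
        obtain ⟨b, hb⟩ := hb
        obtain ⟨n, hn, hpn⟩ := h b
        exact absurd (hb hpn) (by omega)
    · rw [Nat.sSup_of_not_bddAbove hb]
      refine iff_of_true (Nat.zero_le _) (Or.inr fun m => ?_)
      by_contra! h
      exact hb ⟨m, fun n hn => not_lt.1 fun hmn => h n hmn hn⟩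
  rw [this]
  refine MeasurableSet.union ?_ ?_
  · have : {x | ∀ n, p n x → n ≤ k} = ⋂ n, ({x | p n x}ᶜ ∪ {_x | n ≤ k}) := by
      ext x; simp [imp_iff_not_or]
    rw [this]
    exact MeasurableSet.iInter fun n => (hp n).compl.union (MeasurableSet.const _)
  · have : {x | ∀ m, ∃ n, m < n ∧ p n x} = ⋂ m, ⋃ n, ({_x | m < n} ∩ {x | p n x}) := by
      ext x; simp
    rw [this]
    exact MeasurableSet.iInter fun m => MeasurableSet.iUnion fun n =>
      (MeasurableSet.const _).inter (hp n)

theorem Nat.sSup_eq_of_monotone {p : ℕ → Prop} {n : ℕ} (hn : p n) (h : ∀ m, n < m → ¬ p m) :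
    sSup {m | p m} = n := by
  refine IsGreatest.csSup_eq ⟨hn, fun m hm => ?_⟩
  by_contra! hlt
  exact h m hlt hm

namespace PDMP

variable {E : Type*} [MeasurableSpace E]

theorem stateAt_eq (D : PDMP E) {y : Skeleton E} {t : ℝ} {n : ℕ} (h : y.Count t n) :
    D.stateAt y t = D.flow (t - (y.eventTime n).toReal) (y n).2 := by
  unfold stateAt
  rw [Nat.sSup_eq_of_monotone (p := fun n => y.eventTime n ≤ ENNReal.ofReal t) h.1]
  exact fun m hm => not_le.2 (h.2.trans_le (y.eventTime_mono hm))

theorem stateBefore_eq (D : PDMP E) {y : Skeleton E} {t : ℝ} {n : ℕ}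
    (h1 : y.eventTime n < ENNReal.ofReal t) (h2 : ENNReal.ofReal t ≤ y.eventTime (n + 1)) :
    D.stateBefore y t = D.flow (t - (y.eventTime n).toReal) (y n).2 := by
  unfold stateBefore
  rw [Nat.sSup_eq_of_monotone (p := fun n => y.eventTime n < ENNReal.ofReal t) h1]
  exact fun m hm => not_lt.2 (h2.trans (y.eventTime_mono hm))

theorem measurable_flow_comp (D : PDMP E) {X : Type*} [MeasurableSpace X] {f : X → ℝ} {g : X → E}
    (hf : Measurable f) (hg : Measurable g) : Measurable (fun x => D.flow (f x) (g x)) :=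
  D.measurable_flow.comp (hg.prodMk hf)

/-- A random index with countably many values causes no measurability problem: joint measurability
in `(n, y, t)` reduces to fixed `n`. -/
theorem measurable_flow_index (D : PDMP E) {N : Skeleton E × ℝ → ℕ} (hN : Measurable N) :
    Measurable (fun p : Skeleton E × ℝ =>
      D.flow (p.2 - (p.1.eventTime (N p)).toReal) (p.1 (N p)).2) := by
  have : Measurable (fun q : ℕ × (Skeleton E × ℝ) =>
      D.flow (q.2.2 - (q.2.1.eventTime q.1).toReal) (q.2.1 q.1).2) := by
    refine measurable_from_prod_countable_right fun n => ?_
    refine D.measurable_flow_comp (f := fun p : Skeleton E × ℝ => p.2 - (p.1.eventTime n).toReal)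
      (g := fun p : Skeleton E × ℝ => (p.1 n).2) ?_ (by fun_prop)
    exact measurable_snd.sub (((Skeleton.measurable_eventTime n).comp measurable_fst).ennreal_toReal)
  exact this.comp (hN.prodMk measurable_id)

theorem measurable_stateAt (D : PDMP E) :
    Measurable (fun p : Skeleton E × ℝ => D.stateAt p.1 p.2) := by
  refine D.measurable_flow_index (measurable_sSup_nat _ fun n => ?_)
  exact measurableSet_le ((Skeleton.measurable_eventTime n).comp measurable_fst)
    (ENNReal.measurable_ofReal.comp measurable_snd)

theorem measurable_stateBefore (D : PDMP E) :
    Measurable (fun p : Skeleton E × ℝ => D.stateBefore p.1 p.2) := by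
  refine D.measurable_flow_index (measurable_sSup_nat _ fun n => ?_)
  exact measurableSet_lt ((Skeleton.measurable_eventTime n).comp measurable_fst)
    (ENNReal.measurable_ofReal.comp measurable_snd)

/-- The `n`-th event (counting from `0`) of a one-sided path. -/
def event (D : PDMP E) (y : Skeleton E) (n : ℕ) : ℝ × E × E :=
  ((y.eventTime (n + 1)).toReal, D.flow (y (n + 1)).1.toReal (y n).2, (y (n + 1)).2)

theorem measurable_event (D : PDMP E) (n : ℕ) : Measurable (fun y => D.event y n) := by
  unfold event
  refine Measurable.prodMk (Skeleton.measurable_eventTime _).ennreal_toReal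
    (Measurable.prodMk (D.measurable_flow_comp ?_ ?_) ?_) <;> fun_prop

theorem lintegral_events (D : PDMP E) (y : Skeleton E) {g : ℝ × E × E → ℝ≥0∞} (hg : Measurable g) :
    ∫⁻ p, g p ∂(D.events y)
      = ∑' n, {y : Skeleton E | y.eventTime (n + 1) ≠ ∞}.indicator (fun y => g (D.event y n)) y := by
  unfold events
  rw [lintegral_sum_measure]
  congr 1
  ext n
  by_cases h : y.eventTime (n + 1) = ∞
  · simp [h]
  · simp only [h, if_false, lintegral_dirac' _ hg, indicator, mem_ofPred_eq, ne_eq, not_false_eq_true,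
      if_true]
    rfl

theorem measurable_lintegral_events (D : PDMP E) {X : Type*} [MeasurableSpace X]
    {g : X × (ℝ × E × E) → ℝ≥0∞} (hg : Measurable g) :
    Measurable (fun p : X × Skeleton E => ∫⁻ q, g (p.1, q) ∂(D.events p.2)) := by
  have : ∀ p : X × Skeleton E, ∫⁻ q, g (p.1, q) ∂(D.events p.2) = ∑' n,
      {p : X × Skeleton E | p.2.eventTime (n + 1) ≠ ∞}.indicator
        (fun p => g (p.1, D.event p.2 n)) p := fun p =>
    D.lintegral_events p.2 (hg.comp measurable_prodMk_left)
  simp_rw [this]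
  refine Measurable.tsum fun n => Measurable.indicator ?_ ?_
  · exact hg.comp (measurable_fst.prodMk ((D.measurable_event n).comp measurable_snd))
  · exact (((Skeleton.measurable_eventTime (n + 1)).comp measurable_snd)
      (measurableSet_singleton ∞)).compl

theorem measurable_events (D : PDMP E) : Measurable D.events := by
  refine Measure.measurable_of_measurable_coe _ fun S hS => ?_
  simp_rw [← lintegral_indicator_one hS]
  have h : Measurable (fun p : Unit × (ℝ × E × E) => S.indicator (1 : ℝ × E × E → ℝ≥0∞) p.2) :=
    (measurable_one.indicator hS).comp measurable_snd
  have h2 := (D.measurable_lintegral_events h).comp (measurable_prodMk_left (x := ()))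
  simpa only [Function.comp_def] using h2

theorem ae_events_nonneg (D : PDMP E) (y : Skeleton E) : ∀ᵐ p ∂(D.events y), 0 ≤ p.1 := by
  have hS : MeasurableSet {p : ℝ × E × E | ¬ 0 ≤ p.1} :=
    (measurableSet_le measurable_const measurable_fst).compl
  rw [ae_iff, ← lintegral_indicator_one hS, D.lintegral_events _ (measurable_one.indicator hS),
    ENNReal.tsum_eq_zero]
  intro n
  simp [indicator, event]

/-- Measures of events are compared through their integrals, which are sums over the events; gluing
splits off the term of the first event and shifts the others in time. -/
theorem lintegral_events_glue (D : PDMP E) (z : E) {s : ℝ≥0∞} (hs : s ≠ ∞) (y : Skeleton E)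
    {g : ℝ × E × E → ℝ≥0∞} (hg : Measurable g) :
    ∫⁻ p, g p ∂(D.events (Skeleton.glue z s y))
      = g (s.toReal, D.flow s.toReal z, (y 0).2) + ∫⁻ p, g (p.1 + s.toReal, p.2) ∂(D.events y) := by
  rw [D.lintegral_events _ hg, D.lintegral_events _ (by fun_prop),
    tsum_eq_zero_add' ENNReal.summable]
  congr 1
  · simp [indicator, Skeleton.eventTime_glue_succ, hs, event, Skeleton.glue]
  · congr 1
    ext n
    simp only [indicator, mem_ofPred_eq, Skeleton.eventTime_glue_succ, event]
    by_cases h : y.eventTime (n + 1) = ∞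
    · simp [h]
    · have h2 : s + y.eventTime (n + 1) ≠ ∞ := ENNReal.add_ne_top.2 ⟨hs, h⟩
      rw [if_pos h, if_pos h2, ENNReal.toReal_add hs h, add_comm s.toReal,
        Skeleton.glue_succ_snd, Skeleton.glue_succ_snd]
      rfl

theorem events_glue_top (D : PDMP E) (z : E) (y : Skeleton E) :
    D.events (Skeleton.glue z ∞ y) = 0 := by
  refine Measure.ext_of_lintegral _ fun g hg => ?_
  rw [D.lintegral_events _ hg]
  simp [indicator, Skeleton.eventTime_glue_succ]

end PDMP

/-! ### The Markov property at a deterministic time. -/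

/-- The events up to time `r`. -/
def eventsUpTo {E : Type*} [MeasurableSpace E] (r : ℝ) (ξ : Measure (ℝ × E × E)) :
    Measure (ℝ × E × E) :=
  ξ.restrict (Iic r ×ˢ univ)

/-- The events after time `r`, seen from time `r`. -/
def eventsAfter {E : Type*} [MeasurableSpace E] (r : ℝ) (ξ : Measure (ℝ × E × E)) :
    Measure (ℝ × E × E) :=
  (ξ.restrict (Ioi r ×ˢ univ)).map (fun p => (p.1 - r, p.2))

section

variable {E : Type*} [MeasurableSpace E]

theorem measurable_restrict_measure {X : Type*} [MeasurableSpace X] {S : Set X}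
    (hS : MeasurableSet S) : Measurable (fun ξ : Measure X => ξ.restrict S) := by
  refine Measure.measurable_of_measurable_coe _ fun A hA => ?_
  simp_rw [Measure.restrict_apply hA]
  exact Measure.measurable_coe (hA.inter hS)

theorem measurable_eventsUpTo (r : ℝ) : Measurable (eventsUpTo (E := E) r) :=
  measurable_restrict_measure (measurableSet_Iic.prod MeasurableSet.univ)

theorem measurable_eventsAfter (r : ℝ) : Measurable (eventsAfter (E := E) r) :=
  (Measure.measurable_map _ (by fun_prop)).comp
    (measurable_restrict_measure (measurableSet_Ioi.prod MeasurableSet.univ))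

theorem lintegral_eventsUpTo (r : ℝ) (ξ : Measure (ℝ × E × E)) (g : ℝ × E × E → ℝ≥0∞) :
    ∫⁻ p, g p ∂(eventsUpTo r ξ) = ∫⁻ p, (Iic r ×ˢ univ).indicator g p ∂ξ := by
  rw [eventsUpTo, lintegral_indicator (measurableSet_Iic.prod MeasurableSet.univ)]

theorem lintegral_eventsAfter (r : ℝ) (ξ : Measure (ℝ × E × E)) {g : ℝ × E × E → ℝ≥0∞}
    (hg : Measurable g) :
    ∫⁻ p, g p ∂(eventsAfter r ξ)
      = ∫⁻ p, (Ioi r ×ˢ univ).indicator (fun p => g (p.1 - r, p.2)) p ∂ξ := by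
  rw [eventsAfter, lintegral_map hg (by fun_prop),
    lintegral_indicator (measurableSet_Ioi.prod MeasurableSet.univ)]

end

namespace PDMP

variable {E : Type*} [MeasurableSpace E]

theorem eventsUpTo_glue_of_lt (D : PDMP E) (z : E) {r : ℝ} (hr : 0 ≤ r) {s : ℝ≥0∞}
    (h : ENNReal.ofReal r < s) (y : Skeleton E) :
    eventsUpTo r (D.events (Skeleton.glue z s y)) = 0 := by
  by_cases hs : s = ∞
  · subst hs; simp [events_glue_top, eventsUpTo]
  have h' : r < s.toReal := (ENNReal.ofReal_lt_iff_lt_toReal hr hs).1 h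
  refine Measure.ext_of_lintegral _ fun g hg => ?_
  rw [lintegral_eventsUpTo, D.lintegral_events_glue z hs _
    (hg.indicator (measurableSet_Iic.prod MeasurableSet.univ)), lintegral_zero_measure, add_eq_zero]
  refine ⟨by simp [indicator, h'], (lintegral_congr_ae ?_).trans lintegral_zero⟩
  filter_upwards [D.ae_events_nonneg y] with p hp
  have : r < p.1 + s.toReal := by linarith
  simp [indicator, this]

theorem eventsAfter_glue_of_lt (D : PDMP E) (z : E) {r : ℝ} (hr : 0 ≤ r) {s : ℝ≥0∞}
    (h : ENNReal.ofReal r < s) (y : Skeleton E) :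
    eventsAfter r (D.events (Skeleton.glue z s y))
      = D.events (Skeleton.glue (D.flow r z) (s - ENNReal.ofReal r) y) := by
  by_cases hs : s = ∞
  · subst hs; simp [events_glue_top, eventsAfter]
  have h' : r < s.toReal := (ENNReal.ofReal_lt_iff_lt_toReal hr hs).1 h
  have hs' : s - ENNReal.ofReal r ≠ ∞ := ne_top_of_le_ne_top hs tsub_le_self
  have hm : ∀ g : ℝ × E × E → ℝ≥0∞, Measurable g → Measurable
      ((Ioi r ×ˢ univ).indicator (fun p : ℝ × E × E => g (p.1 - r, p.2))) := fun g hg =>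
    Measurable.indicator (by fun_prop) (measurableSet_Ioi.prod MeasurableSet.univ)
  refine Measure.ext_of_lintegral _ fun g hg => ?_
  rw [lintegral_eventsAfter _ _ hg, D.lintegral_events_glue z hs _ (hm g hg),
    D.lintegral_events_glue _ hs' _ hg, ENNReal.toReal_sub_of_le h.le hs, ENNReal.toReal_ofReal hr,
    ← D.flow_add]
  congr 1
  · simp [indicator, h']
  · refine lintegral_congr_ae ?_
    filter_upwards [D.ae_events_nonneg y] with p hp
    have : r < p.1 + s.toReal := by linarith
    simp [indicator, this, add_sub_assoc]

theorem eventsUpTo_glue_of_le (D : PDMP E) (z : E) {r : ℝ} (hr : 0 ≤ r) {s : ℝ≥0∞}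
    (h : s ≤ ENNReal.ofReal r) (y : Skeleton E) :
    eventsUpTo r (D.events (Skeleton.glue z s y))
      = Measure.dirac (s.toReal, D.flow s.toReal z, (y 0).2)
        + (eventsUpTo (r - s.toReal) (D.events y)).map (fun p => (p.1 + s.toReal, p.2)) := by
  have hs : s ≠ ∞ := ne_top_of_le_ne_top ENNReal.ofReal_ne_top h
  have h' : s.toReal ≤ r := ENNReal.toReal_le_of_le_ofReal hr h
  refine Measure.ext_of_lintegral _ fun g hg => ?_
  rw [lintegral_eventsUpTo, D.lintegral_events_glue z hs _
    (hg.indicator (measurableSet_Iic.prod MeasurableSet.univ)), lintegral_add_measure,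
    lintegral_dirac' _ hg, lintegral_map hg (by fun_prop), lintegral_eventsUpTo]
  congr 1
  · simp [indicator, h']
  · refine lintegral_congr fun p => ?_
    simp [indicator, le_sub_iff_add_le]

theorem eventsAfter_glue_of_le (D : PDMP E) (z : E) {r : ℝ} (hr : 0 ≤ r) {s : ℝ≥0∞}
    (h : s ≤ ENNReal.ofReal r) (y : Skeleton E) :
    eventsAfter r (D.events (Skeleton.glue z s y))
      = eventsAfter (r - s.toReal) (D.events y) := by
  have hs : s ≠ ∞ := ne_top_of_le_ne_top ENNReal.ofReal_ne_top h
  have h' : s.toReal ≤ r := ENNReal.toReal_le_of_le_ofReal hr h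
  refine Measure.ext_of_lintegral _ fun g hg => ?_
  have hm : Measurable ((Ioi r ×ˢ univ).indicator (fun p : ℝ × E × E => g (p.1 - r, p.2))) :=
    Measurable.indicator (by fun_prop) (measurableSet_Ioi.prod MeasurableSet.univ)
  rw [lintegral_eventsAfter _ _ hg, D.lintegral_events_glue z hs _ hm, lintegral_eventsAfter _ _ hg]
  have : (Ioi r ×ˢ univ).indicator (fun p : ℝ × E × E => g (p.1 - r, p.2))
    (s.toReal, D.flow s.toReal z, (y 0).2) = 0 := by simp [indicator, h']
  rw [this, zero_add]
  refine lintegral_congr fun p => ?_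
  simp only [indicator, mem_prod, mem_Ioi, mem_univ, and_true, sub_lt_iff_lt_add]
  congr 3
  ring

theorem stateAt_glue (D : PDMP E) (z : E) {r : ℝ} {s : ℝ≥0∞}
    (h : s ≤ ENNReal.ofReal r) {y : Skeleton E} {n : ℕ} (hc : y.Count (r - s.toReal) n) :
    D.stateAt (Skeleton.glue z s y) r = D.stateAt y (r - s.toReal) := by
  have hs : s ≠ ∞ := ne_top_of_le_ne_top ENNReal.ofReal_ne_top h
  rw [D.stateAt_eq ((Skeleton.count_glue_succ z h y n).2 hc), D.stateAt_eq hc,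
    Skeleton.eventTime_glue_succ, Skeleton.glue_succ_snd, ENNReal.toReal_add hs
    (ne_top_of_le_ne_top ENNReal.ofReal_ne_top hc.1), sub_sub]

end PDMP

/-- The indicator of the event that exactly `n` events occur up to time `r`. -/
def Skeleton.countIndicator {E : Type*} (r : ℝ) (n : ℕ) : Skeleton E → ℝ≥0∞ :=
  {y : Skeleton E | y.Count r n}.indicator 1

theorem Skeleton.countIndicator_of {E : Type*} {r : ℝ} {n : ℕ} {y : Skeleton E}
    (h : y.Count r n) : countIndicator r n y = 1 := by
  simp [countIndicator, h]

theorem Skeleton.countIndicator_of_not {E : Type*} {r : ℝ} {n : ℕ} {y : Skeleton E}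
    (h : ¬ y.Count r n) : countIndicator r n y = 0 := by
  simp [countIndicator, h]

theorem Skeleton.measurable_countIndicator {E : Type*} [MeasurableSpace E] (r : ℝ) (n : ℕ) :
    Measurable (countIndicator (E := E) r n) :=
  measurable_one.indicator (measurableSet_count r n)

theorem Skeleton.tsum_countIndicator {E : Type*} {y : Skeleton E}
    (h : Tendsto y.eventTime atTop (𝓝 ∞)) (r : ℝ) : ∑' n, countIndicator r n y = 1 := by
  obtain ⟨n, hn⟩ := exists_count h r
  rw [tsum_eq_single n, countIndicator_of hn]
  intro m hm
  exact countIndicator_of_not fun h => hm (h.unique hn)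

/-- The path up to the first event, followed by a path with events `ξ`. -/
def prependEvent {E : Type*} [MeasurableSpace E] (s : ℝ) (z z' : E) (ξ : Measure (ℝ × E × E)) :
    Measure (ℝ × E × E) :=
  Measure.dirac (s, z, z') + ξ.map (fun p => (p.1 + s, p.2))

theorem measurable_prependEvent {E X : Type*} [MeasurableSpace E] [MeasurableSpace X] (s : ℝ)
    (z : E) {f : X → E} {g : X → Measure (ℝ × E × E)} (hf : Measurable f) (hg : Measurable g) :
    Measurable (fun x => prependEvent s z (f x) (g x)) := by
  refine Measure.measurable_of_measurable_coe _ fun A hA => ?_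
  simp only [prependEvent, Measure.add_apply]
  refine Measurable.add ?_ ?_
  · exact (Measure.measurable_coe hA).comp (Measure.measurable_dirac.comp (by fun_prop))
  · exact (Measure.measurable_coe hA).comp
      ((Measure.measurable_map _ (by fun_prop)).comp hg)

namespace PDMP

variable {E : Type*} [MeasurableSpace E]

/-- Replaces the initial state by the starting point inside an integral, without any assumption on
the σ-algebra of `E`. -/
theorem lintegral_pathKernel_init (D : PDMP E) (z : E) (H : E × Skeleton E → ℝ≥0∞)
    (hH : Measurable H) :
    ∫⁻ y, H ((y 0).2, y) ∂(D.pathKernel z) = ∫⁻ y, H (z, y) ∂(D.pathKernel z) := by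
  have h1 : Measurable (fun y : Skeleton E => H ((y 0).2, y)) := by fun_prop
  have h2 : Measurable (fun y : Skeleton E => H (z, y)) := by fun_prop
  rw [D.lintegral_pathKernel_update z _ h1, D.lintegral_pathKernel_update z _ h2]
  simp

theorem measurable_stateAt_left (D : PDMP E) (r : ℝ) : Measurable (fun y => D.stateAt y r) := by
  have h := D.measurable_stateAt.comp (measurable_prodMk_right (y := r))
  simpa only [Function.comp_def] using h

theorem measurable_eventsUpTo_events (D : PDMP E) (r : ℝ) :
    Measurable (fun y => eventsUpTo r (D.events y)) :=
  (measurable_eventsUpTo r).comp D.measurable_events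

theorem measurable_eventsAfter_events (D : PDMP E) (r : ℝ) :
    Measurable (fun y => eventsAfter r (D.events y)) :=
  (measurable_eventsAfter r).comp D.measurable_events

theorem measurable_restart (D : PDMP E) {X : Type*} [MeasurableSpace X] (r : ℝ)
    {F : X × E × Measure (ℝ × E × E) × Measure (ℝ × E × E) → ℝ≥0∞} (hF : Measurable F) :
    Measurable (fun p : X × Skeleton E => ∫⁻ y', F (p.1, D.stateAt p.2 r,
      eventsUpTo r (D.events p.2), D.events y') ∂(D.pathKernel (D.stateAt p.2 r))) := by
  have h1 := D.measurable_stateAt_left r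
  have h2 := D.measurable_eventsUpTo_events r
  have h3 := D.measurable_events
  have : Measurable (fun q : (X × Skeleton E) × Skeleton E => F (q.1.1, D.stateAt q.1.2 r,
      eventsUpTo r (D.events q.1.2), D.events q.2)) :=
    hF.comp ((measurable_fst.comp measurable_fst).prodMk
      ((h1.comp (measurable_snd.comp measurable_fst)).prodMk
        ((h2.comp (measurable_snd.comp measurable_fst)).prodMk (h3.comp measurable_snd))))
  exact Measurable.lintegral_kernel_prod_right'
    (κ := D.pathKernel.comap (fun p : X × Skeleton E => D.stateAt p.2 r)
      (h1.comp measurable_snd)) this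

/-- Induction on the number of events up to `r`. With no event, this is the lack of memory of the
first holding time. Otherwise the first event, at time `s`, is removed and the induction hypothesis
is applied at the remaining time `r - s`; this is why `z`, `r` and `F` are quantified inside. -/
theorem lintegral_markov_count (D : PDMP E) (n : ℕ) : ∀ (z : E) (r : ℝ), 0 ≤ r →
    ∀ F : E × Measure (ℝ × E × E) × Measure (ℝ × E × E) → ℝ≥0∞, Measurable F →
    ∫⁻ y, Skeleton.countIndicator r n y *
        F (D.stateAt y r, eventsUpTo r (D.events y), eventsAfter r (D.events y)) ∂(D.pathKernel z)
      = ∫⁻ y, Skeleton.countIndicator r n y *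
        ∫⁻ y', F (D.stateAt y r, eventsUpTo r (D.events y), D.events y')
          ∂(D.pathKernel (D.stateAt y r)) ∂(D.pathKernel z) := by
  have hmL : ∀ (n : ℕ) (r : ℝ) (F : E × E × Measure (ℝ × E × E) × Measure (ℝ × E × E) → ℝ≥0∞),
      Measurable F → Measurable (fun p : E × Skeleton E => Skeleton.countIndicator r n p.2 *
        F (p.1, D.stateAt p.2 r, eventsUpTo r (D.events p.2), eventsAfter r (D.events p.2))) :=
    fun n r F hF => ((Skeleton.measurable_countIndicator r n).comp measurable_snd).mul
      (hF.comp (measurable_fst.prodMk (((D.measurable_stateAt_left r).comp measurable_snd).prodMk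
        (((D.measurable_eventsUpTo_events r).comp measurable_snd).prodMk
          ((D.measurable_eventsAfter_events r).comp measurable_snd)))))
  have hmR : ∀ (n : ℕ) (r : ℝ) (F : E × E × Measure (ℝ × E × E) × Measure (ℝ × E × E) → ℝ≥0∞),
      Measurable F → Measurable (fun p : E × Skeleton E => Skeleton.countIndicator r n p.2 *
        ∫⁻ y', F (p.1, D.stateAt p.2 r, eventsUpTo r (D.events p.2), D.events y')
          ∂(D.pathKernel (D.stateAt p.2 r))) :=
    fun n r F hF => ((Skeleton.measurable_countIndicator r n).comp measurable_snd).mul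
      (D.measurable_restart r hF)
  have hmL' : ∀ (n : ℕ) (r : ℝ) (F : E × Measure (ℝ × E × E) × Measure (ℝ × E × E) → ℝ≥0∞),
      Measurable F → Measurable (fun y : Skeleton E => Skeleton.countIndicator r n y *
        F (D.stateAt y r, eventsUpTo r (D.events y), eventsAfter r (D.events y))) :=
    fun n r F hF => (Skeleton.measurable_countIndicator r n).mul
      (hF.comp ((D.measurable_stateAt_left r).prodMk
        ((D.measurable_eventsUpTo_events r).prodMk (D.measurable_eventsAfter_events r))))
  have hmR' : ∀ (n : ℕ) (r : ℝ) (F : E × Measure (ℝ × E × E) × Measure (ℝ × E × E) → ℝ≥0∞),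
      Measurable F → Measurable (fun y : Skeleton E => Skeleton.countIndicator r n y *
        ∫⁻ y', F (D.stateAt y r, eventsUpTo r (D.events y), D.events y')
          ∂(D.pathKernel (D.stateAt y r))) :=
    fun n r F hF => (Skeleton.measurable_countIndicator r n).mul
      (by
        have h := (D.measurable_restart (X := Unit) r (hF.comp measurable_snd)).comp
          (measurable_prodMk_left (x := ()))
        simpa only [Function.comp_def] using h)
  induction n with
  | zero =>
    intro z r hr F hF
    have hcount : ∀ (s : ℝ≥0∞) (y : Skeleton E), (Skeleton.glue z s y).Count r 0 ↔
        ENNReal.ofReal r < s := by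
      intro s y
      simp [Skeleton.Count, Skeleton.eventTime_glue_succ]
    have hstate : ∀ (s : ℝ≥0∞) (y : Skeleton E), ENNReal.ofReal r < s →
        D.stateAt (Skeleton.glue z s y) r = D.flow r z := by
      intro s y hs
      rw [D.stateAt_eq ((hcount s y).2 hs)]
      simp [Skeleton.glue]
    set K : ℝ≥0∞ := ∫⁻ y', F (D.flow r z, 0, D.events y') ∂(D.pathKernel (D.flow r z)) with hK
    have hm0 : Measurable (fun y => F (D.flow r z, 0, D.events y)) :=
      hF.comp (measurable_const.prodMk (measurable_const.prodMk D.measurable_events))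
    -- `G` is the integrand in the first-event decomposition of the process restarted at `Φ_r z`. At
    -- time `∞` there are no events, so `G` is constant there, as `lintegral_next_shift` requires.
    set G : ℝ≥0∞ × E → ℝ≥0∞ := fun x => ∫⁻ y, F (D.flow r z, 0,
      D.events (Skeleton.glue (D.flow r z) x.1 y)) ∂(D.pathKernel x.2) with hG
    have hGm : Measurable G := by
      have : Measurable (fun q : (ℝ≥0∞ × E) × Skeleton E => F (D.flow r z, 0,
          D.events (Skeleton.glue (D.flow r z) q.1.1 q.2))) :=
        hm0.comp ((Skeleton.measurable_glue (D.flow r z)).comp (by fun_prop : Measurable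
          (fun q : (ℝ≥0∞ × E) × Skeleton E => (q.1.1, q.2))))
      exact Measurable.lintegral_kernel_prod_right'
        (κ := D.pathKernel.comap (fun x : ℝ≥0∞ × E => x.2) measurable_snd) this
    have h1 := D.lintegral_next_shift z hr G hGm (F (D.flow r z, 0, 0))
      (fun z' => by simp [hG, events_glue_top])
    have h2 := D.lintegral_next_shift z hr (fun _ => K) measurable_const K (fun _ => rfl)
    have h3 : ∫⁻ x, G x ∂(D.next (D.flow r z)) = K := by
      rw [hK, D.lintegral_pathKernel_glue _ _ hm0]
    rw [D.lintegral_pathKernel_glue z _ (hmL' 0 r F hF),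
      D.lintegral_pathKernel_glue z _ (hmR' 0 r F hF)]
    trans D.survival z r * K
    · rw [← h3, ← h1]
      refine lintegral_congr fun x => ?_
      by_cases hx : ENNReal.ofReal r < x.1
      · simp_rw [Skeleton.countIndicator_of ((hcount x.1 _).2 hx), hstate x.1 _ hx,
          D.eventsUpTo_glue_of_lt z hr hx, D.eventsAfter_glue_of_lt z hr hx, one_mul]
        simp [indicator, hx, hG]
      · simp_rw [Skeleton.countIndicator_of_not (mt (hcount x.1 _).1 hx)]
        simp [indicator, hx]
    · have : D.survival z r * K = ∫⁻ x, {x : ℝ≥0∞ × E | ENNReal.ofReal r < x.1}.indicator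
        (fun x => K) x ∂(D.next z) := by rw [h2]; simp
      rw [this]
      refine lintegral_congr fun x => ?_
      by_cases hx : ENNReal.ofReal r < x.1
      · simp_rw [Skeleton.countIndicator_of ((hcount x.1 _).2 hx), hstate x.1 _ hx,
          D.eventsUpTo_glue_of_lt z hr hx, one_mul]
        simp [indicator, hx, hK]
      · simp_rw [Skeleton.countIndicator_of_not (mt (hcount x.1 _).1 hx)]
        simp [indicator, hx]
  | succ n ih =>
    intro z r hr F hF
    rw [D.lintegral_pathKernel_glue z _ (hmL' (n + 1) r F hF),
      D.lintegral_pathKernel_glue z _ (hmR' (n + 1) r F hF)]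
    refine lintegral_congr fun x => ?_
    obtain ⟨s, z₁⟩ := x
    simp only
    by_cases hs : s ≤ ENNReal.ofReal r
    · have hr' : 0 ≤ r - s.toReal := sub_nonneg.2 (ENNReal.toReal_le_of_le_ofReal hr hs)
      -- `F'` puts the removed event back in front of the past. Its first argument is the state
      -- after that event, later frozen at `z₁`.
      set F' : E × E × Measure (ℝ × E × E) × Measure (ℝ × E × E) → ℝ≥0∞ := fun q =>
        F (q.2.1, prependEvent s.toReal (D.flow s.toReal z) q.1 q.2.2.1, q.2.2.2) with hF'
      have hFm : Measurable F' := by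
        have h3 : Measurable (fun q : E × E × Measure (ℝ × E × E) × Measure (ℝ × E × E) =>
            prependEvent s.toReal (D.flow s.toReal z) q.1 q.2.2.1) :=
          measurable_prependEvent _ _ (by fun_prop) (by fun_prop)
        have h4 : Measurable (fun q : E × E × Measure (ℝ × E × E) × Measure (ℝ × E × E) =>
            (q.2.1, prependEvent s.toReal (D.flow s.toReal z) q.1 q.2.2.1, q.2.2.2)) := by
          refine Measurable.prodMk (by fun_prop) (Measurable.prodMk h3 (by fun_prop))
        exact hF.comp h4
      have eL : ∀ y, Skeleton.countIndicator r (n + 1) (Skeleton.glue z s y) *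
          F (D.stateAt (Skeleton.glue z s y) r, eventsUpTo r (D.events (Skeleton.glue z s y)),
            eventsAfter r (D.events (Skeleton.glue z s y)))
          = Skeleton.countIndicator (r - s.toReal) n y * F' ((y 0).2, D.stateAt y (r - s.toReal),
            eventsUpTo (r - s.toReal) (D.events y), eventsAfter (r - s.toReal) (D.events y)) := by
        intro y
        by_cases hc : y.Count (r - s.toReal) n
        · rw [Skeleton.countIndicator_of ((Skeleton.count_glue_succ z hs y n).2 hc),
            Skeleton.countIndicator_of hc, D.stateAt_glue z hs hc, D.eventsUpTo_glue_of_le z hr hs,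
            D.eventsAfter_glue_of_le z hr hs]
          rfl
        · rw [Skeleton.countIndicator_of_not (mt (Skeleton.count_glue_succ z hs y n).1 hc),
            Skeleton.countIndicator_of_not hc, zero_mul, zero_mul]
      have eR : ∀ y, Skeleton.countIndicator r (n + 1) (Skeleton.glue z s y) *
          ∫⁻ y', F (D.stateAt (Skeleton.glue z s y) r, eventsUpTo r (D.events (Skeleton.glue z s y)),
            D.events y') ∂(D.pathKernel (D.stateAt (Skeleton.glue z s y) r))
          = Skeleton.countIndicator (r - s.toReal) n y *
          ∫⁻ y', F' ((y 0).2, D.stateAt y (r - s.toReal), eventsUpTo (r - s.toReal) (D.events y),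
            D.events y') ∂(D.pathKernel (D.stateAt y (r - s.toReal))) := by
        intro y
        by_cases hc : y.Count (r - s.toReal) n
        · rw [Skeleton.countIndicator_of ((Skeleton.count_glue_succ z hs y n).2 hc),
            Skeleton.countIndicator_of hc, D.stateAt_glue z hs hc, D.eventsUpTo_glue_of_le z hr hs]
          rfl
        · rw [Skeleton.countIndicator_of_not (mt (Skeleton.count_glue_succ z hs y n).1 hc),
            Skeleton.countIndicator_of_not hc, zero_mul, zero_mul]
      simp_rw [eL, eR]
      rw [D.lintegral_pathKernel_init z₁ _ (hmL n (r - s.toReal) F' hFm),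
        D.lintegral_pathKernel_init z₁ _ (hmR n (r - s.toReal) F' hFm)]
      exact ih z₁ _ hr' (fun q => F' (z₁, q)) (hFm.comp measurable_prodMk_left)
    · have hc : ∀ y : Skeleton E, ¬ (Skeleton.glue z s y).Count r (n + 1) := by
        intro y hc
        have := hc.1
        rw [Skeleton.eventTime_glue_succ] at this
        exact hs (le_self_add.trans this)
      simp_rw [Skeleton.countIndicator_of_not (hc _), zero_mul]

theorem pathLaw_eq (D : PDMP E) (π : Measure E) (F : Skeleton E → ℝ≥0∞) (hF : Measurable F) :
    ∫⁻ y, F y ∂(D.pathLaw π) = ∫⁻ z, ∫⁻ y, F y ∂(D.pathKernel z) ∂π := by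
  unfold pathLaw
  rw [Measure.lintegral_bind D.pathKernel.measurable.aemeasurable hF.aemeasurable]

instance (D : PDMP E) (π : Measure E) [IsProbabilityMeasure π] :
    IsProbabilityMeasure (D.pathLaw π) := by
  refine ⟨?_⟩
  rw [← lintegral_one, D.pathLaw_eq π _ measurable_const]
  simp

/-- The Markov property at time `r`, for the stationary process. -/
theorem lintegral_markov (D : PDMP E) (π : Measure E) (hD : D.NonExplosive π) {r : ℝ}
    (hr : 0 ≤ r) (F : E × E × Measure (ℝ × E × E) × Measure (ℝ × E × E) → ℝ≥0∞)
    (hF : Measurable F) :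
    ∫⁻ y, F ((y 0).2, D.stateAt y r, eventsUpTo r (D.events y), eventsAfter r (D.events y))
        ∂(D.pathLaw π)
      = ∫⁻ y, ∫⁻ y', F ((y 0).2, D.stateAt y r, eventsUpTo r (D.events y), D.events y')
          ∂(D.pathKernel (D.stateAt y r)) ∂(D.pathLaw π) := by
  have hmL : Measurable (fun p : E × Skeleton E =>
      F (p.1, D.stateAt p.2 r, eventsUpTo r (D.events p.2), eventsAfter r (D.events p.2))) :=
    hF.comp (measurable_fst.prodMk (((D.measurable_stateAt_left r).comp measurable_snd).prodMk
        (((D.measurable_eventsUpTo_events r).comp measurable_snd).prodMk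
          ((D.measurable_eventsAfter_events r).comp measurable_snd))))
  have hmR := D.measurable_restart r hF
  have hy : Measurable (fun y : Skeleton E => ((y 0).2, y)) := by fun_prop
  -- By non-explosion, exactly one of the counts up to `r` occurs almost surely, so the integral
  -- splits over the number of events.
  have key : ∀ G : E × Skeleton E → ℝ≥0∞, Measurable G →
      ∫⁻ y, G ((y 0).2, y) ∂(D.pathLaw π)
        = ∑' n, ∫⁻ z, ∫⁻ y, Skeleton.countIndicator r n y * G (z, y) ∂(D.pathKernel z) ∂π := by
    intro G hG
    have h1 : ∫⁻ y, G ((y 0).2, y) ∂(D.pathLaw π)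
        = ∫⁻ y, ∑' n, Skeleton.countIndicator r n y * G ((y 0).2, y) ∂(D.pathLaw π) := by
      refine lintegral_congr_ae ?_
      filter_upwards [hD] with y hy
      rw [ENNReal.tsum_mul_right, Skeleton.tsum_countIndicator hy, one_mul]
    have hm : ∀ n, Measurable (fun y => Skeleton.countIndicator r n y * G ((y 0).2, y)) := fun n =>
      (Skeleton.measurable_countIndicator r n).mul (hG.comp hy)
    rw [h1, lintegral_tsum fun n => (hm n).aemeasurable]
    congr 1
    ext1 n
    rw [D.pathLaw_eq π _ (hm n)]
    refine lintegral_congr fun z => ?_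
    exact D.lintegral_pathKernel_init z
      (fun p => Skeleton.countIndicator r n p.2 * G (p.1, p.2))
      (((Skeleton.measurable_countIndicator r n).comp measurable_snd).mul hG)
  refine (key _ hmL).trans (Eq.trans ?_ (key _ hmR).symm)
  congr 1
  ext1 n
  refine lintegral_congr fun z => ?_
  exact D.lintegral_markov_count n z r hr (fun q => F (z, q)) (hF.comp measurable_prodMk_left)

end PDMP

/-! ### Time reversal, with the state at the far end of the path. -/

theorem Skeleton.exists_lt_le {E : Type*} {y : Skeleton E}
    (h : Tendsto y.eventTime atTop (𝓝 ∞)) {t : ℝ} (ht : 0 < t) :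
    ∃ n, y.eventTime n < ENNReal.ofReal t ∧ ENNReal.ofReal t ≤ y.eventTime (n + 1) := by
  classical
  have hex : ∃ n, ENNReal.ofReal t ≤ y.eventTime n :=
    ((h.eventually (lt_mem_nhds (ENNReal.ofReal_lt_top (r := t)))).exists).imp fun _ h => h.le
  obtain ⟨n, hn⟩ : ∃ n, Nat.find hex = n + 1 := by
    refine Nat.exists_eq_succ_of_ne_zero fun h0 => ?_
    have := Nat.find_spec hex
    rw [h0] at this
    simp at this
    linarith
  refine ⟨n, not_le.1 (Nat.find_min hex (by omega)), ?_⟩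
  have := Nat.find_spec hex
  rwa [hn] at this

theorem Skeleton.eventTime_lt_succ {E : Type*} {y : Skeleton E} (h : ∀ n, 0 < (y (n + 1)).1) {n : ℕ}
    (hn : y.eventTime n ≠ ∞) : y.eventTime n < y.eventTime (n + 1) := by
  rw [eventTime_succ]
  exact ENNReal.lt_add_right hn (h n).ne'

/-- The reversal of time on `[0, r]`. -/
def reverseEvents {E : Type*} [MeasurableSpace E] (r : ℝ) (ξ : Measure (ℝ × E × E)) :
    Measure (ℝ × E × E) :=
  ξ.map (fun p => (r - p.1, p.2.2, p.2.1))

theorem measurable_reverseEvents {E : Type*} [MeasurableSpace E] (r : ℝ) :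
    Measurable (reverseEvents (E := E) r) :=
  Measure.measurable_map _ (by fun_prop)

theorem reverseEvents_reverseEvents {E : Type*} [MeasurableSpace E] (r : ℝ)
    (ξ : Measure (ℝ × E × E)) : reverseEvents r (reverseEvents r ξ) = ξ := by
  unfold reverseEvents
  rw [Measure.map_map (by fun_prop) (by fun_prop)]
  convert! Measure.map_id
  ext p <;> simp

namespace PDMP

variable {E : Type*} [MeasurableSpace E]

theorem restrict_Icc_events (D : PDMP E) (y : Skeleton E) (r : ℝ) :
    (D.events y).restrict (Icc 0 r ×ˢ univ) = eventsUpTo r (D.events y) := by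
  unfold eventsUpTo
  refine Measure.restrict_congr_set ?_
  filter_upwards [D.ae_events_nonneg y] with p hp
  refine propext ?_
  change (p ∈ Icc 0 r ×ˢ (univ : Set (E × E))) ↔ (p ∈ Iic r ×ˢ (univ : Set (E × E)))
  simp [hp]

theorem events_restrict_eq_dirac (D : PDMP E) {y : Skeleton E} {S : Set (ℝ × E × E)}
    (hS : MeasurableSet S) {k : ℕ} (hk : y.eventTime (k + 1) ≠ ∞) (hkS : D.event y k ∈ S)
    (h : ∀ n, n ≠ k → y.eventTime (n + 1) ≠ ∞ → D.event y n ∉ S) :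
    (D.events y).restrict S = Measure.dirac (D.event y k) := by
  refine Measure.ext_of_lintegral _ fun g hg => ?_
  rw [← lintegral_indicator hS, D.lintegral_events y (hg.indicator hS), lintegral_dirac' _ hg,
    tsum_eq_single k]
  · simp [indicator, hk, hkS]
  · intro n hn
    by_cases ht : y.eventTime (n + 1) = ∞
    · simp [ht]
    · simp [indicator, ht, h n hn ht]

theorem events_apply_eq_zero (D : PDMP E) {y : Skeleton E} {S : Set (ℝ × E × E)}
    (hS : MeasurableSet S) (h : ∀ n, y.eventTime (n + 1) ≠ ∞ → D.event y n ∉ S) :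
    D.events y S = 0 := by
  rw [← lintegral_indicator_one hS, D.lintegral_events y (measurable_one.indicator hS),
    ENNReal.tsum_eq_zero]
  intro n
  by_cases ht : y.eventTime (n + 1) = ∞
  · simp [ht]
  · simp [indicator, ht, h n ht]

/-- For a path of `D` on `[0, r]`, given by its initial state and its events, the left limit at `r`
is in `B`. -/
def leftLimitIn (D : PDMP E) (r : ℝ) (B : Set E) : Set (E × Measure (ℝ × E × E)) :=
  {q | (q.2 (Iio r ×ˢ univ) = 0 ∧ D.flow r q.1 ∈ B) ∨ ∃ c : ℚ, q.2 (Ioo (c : ℝ) r ×ˢ univ) ≠ 0 ∧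
    q.2 ((Ioo (c : ℝ) r ×ˢ univ) ∩ {p | D.flow (r - p.1) p.2.2 ∉ B}) = 0}

theorem measurableSet_flow_notMem (D : PDMP E) (r : ℝ) {B : Set E} (hB : MeasurableSet B) :
    MeasurableSet {p : ℝ × E × E | D.flow (r - p.1) p.2.2 ∉ B} := by
  have : Measurable (fun p : ℝ × E × E => D.flow (r - p.1) p.2.2) :=
    D.measurable_flow_comp (by fun_prop) (by fun_prop)
  exact (this hB).compl

theorem measurableSet_leftLimitIn (D : PDMP E) (r : ℝ) {B : Set E} (hB : MeasurableSet B) :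
    MeasurableSet (D.leftLimitIn r B) := by
  have h0 : ∀ S : Set (ℝ × E × E), MeasurableSet S →
      Measurable (fun q : E × Measure (ℝ × E × E) => q.2 S) := fun S hS =>
    (Measure.measurable_coe hS).comp measurable_snd
  have h1 : Measurable (fun q : E × Measure (ℝ × E × E) => D.flow r q.1) :=
    D.measurable_flow_comp measurable_const measurable_fst
  have h2 : ∀ c : ℚ, MeasurableSet (Ioo (c : ℝ) r ×ˢ (univ : Set (E × E))) := fun c =>
    measurableSet_Ioo.prod MeasurableSet.univ
  have h3 : D.leftLimitIn r B = {q | q.2 (Iio r ×ˢ univ) = 0} ∩ {q | D.flow r q.1 ∈ B} ∪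
      ⋃ c : ℚ, {q | q.2 (Ioo (c : ℝ) r ×ˢ univ) = 0}ᶜ ∩ {q |
        q.2 ((Ioo (c : ℝ) r ×ˢ univ) ∩ {p | D.flow (r - p.1) p.2.2 ∉ B}) = 0} := by
    ext q; simp [leftLimitIn]
  rw [h3]
  refine MeasurableSet.union (MeasurableSet.inter ?_ (h1 hB)) ?_
  · exact h0 _ (measurableSet_Iio.prod MeasurableSet.univ) (measurableSet_singleton 0)
  · refine MeasurableSet.iUnion fun c => MeasurableSet.inter ?_ ?_
    · exact (h0 _ (h2 c) (measurableSet_singleton 0)).compl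
    · exact h0 _ ((h2 c).inter (D.measurableSet_flow_notMem r hB)) (measurableSet_singleton 0)

theorem mem_leftLimitIn_of_zero (D : PDMP E) {r : ℝ} {B : Set E} {z : E}
    {ξ : Measure (ℝ × E × E)} (h : ξ (Iio r ×ˢ univ) = 0) :
    (z, ξ) ∈ D.leftLimitIn r B ↔ D.flow r z ∈ B := by
  refine ⟨?_, fun hz => Or.inl ⟨h, hz⟩⟩
  rintro (⟨-, hz⟩ | ⟨c, hc, -⟩)
  · exact hz
  · exact absurd (measure_mono_null (prod_mono_left Ioo_subset_Iio_self) h) hc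

/-- Here `p` is the last event before `r`, isolated by `c`. A rational cut at or after `p` sees no
event, and one before `p` sees `p`, so a cut passes both tests only if the flow from `p` ends in
`B`. Rational cuts keep the condition measurable. -/
theorem mem_leftLimitIn_of_dirac (D : PDMP E) {r : ℝ} {B : Set E} (hB : MeasurableSet B) {z : E}
    {ξ : Measure (ℝ × E × E)} {p : ℝ × E × E} {c : ℝ} (hp : p.1 ∈ Ioo c r)
    (h : ξ.restrict (Ioo c r ×ˢ univ) = Measure.dirac p) :
    (z, ξ) ∈ D.leftLimitIn r B ↔ D.flow (r - p.1) p.2.2 ∈ B := by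
  have hm := D.measurableSet_flow_notMem r hB
  have hI : ∀ c : ℝ, MeasurableSet (Ioo c r ×ˢ (univ : Set (E × E))) := fun c =>
    measurableSet_Ioo.prod MeasurableSet.univ
  have hval : ∀ S, MeasurableSet S → ξ (S ∩ Ioo c r ×ˢ univ) = S.indicator 1 p := fun S hS => by
    rw [← Measure.restrict_apply hS, h, Measure.dirac_apply' _ hS]
  constructor
  · rintro (⟨h0, -⟩ | ⟨q, hq, hq0⟩)
    · have := hval univ MeasurableSet.univ
      rw [measure_mono_null (fun x hx => prod_mono_left Ioo_subset_Iio_self hx.2) h0] at this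
      simp at this
    · by_contra hn
      have hqp : (q : ℝ) < p.1 := by
        by_contra! hle
        apply hq
        have := hval _ (hI q)
        rw [indicator_of_notMem (by simp [hle])] at this
        rwa [inter_eq_self_of_subset_left] at this
        exact prod_mono_left (Ioo_subset_Ioo_left (hp.1.le.trans hle))
      have := hval _ ((hI q).inter hm)
      rw [measure_mono_null inter_subset_left hq0, indicator_of_mem] at this
      · simp at this
      · exact ⟨⟨⟨hqp, hp.2⟩, trivial⟩, hn⟩
  · intro hz
    obtain ⟨q, hq1, hq2⟩ := exists_rat_btwn hp.1
    have hsub : Ioo (q : ℝ) r ×ˢ (univ : Set (E × E)) ⊆ Ioo c r ×ˢ univ :=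
      prod_mono_left (Ioo_subset_Ioo_left hq1.le)
    refine Or.inr ⟨q, ?_, ?_⟩
    · have := hval _ (hI q)
      rw [inter_eq_self_of_subset_left hsub] at this
      rw [this, indicator_of_mem (by simpa using ⟨hq2, hp.2⟩)]
      simp
    · have := hval _ ((hI q).inter hm)
      rw [inter_eq_self_of_subset_left (inter_subset_left.trans hsub)] at this
      rw [this, indicator_of_notMem]
      exact fun hx => hx.2 hz

/-- The left limit at `r` flows out of the last event strictly before `r`, or out of the initial
state if there is none. An event exactly at `r` is ignored. -/
theorem mem_leftLimitIn_events (D : PDMP E) {r : ℝ} (hr : 0 < r) {B : Set E}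
    (hB : MeasurableSet B) {y : Skeleton E} (hy : y.Regular) :
    ((y 0).2, eventsUpTo r (D.events y)) ∈ D.leftLimitIn r B ↔ D.stateBefore y r ∈ B := by
  obtain ⟨n, hn1, hn2⟩ := Skeleton.exists_lt_le hy.2 hr
  rw [D.stateBefore_eq hn1 hn2]
  have hlt : ∀ k, y.eventTime k ≠ ∞ → ((y.eventTime k).toReal < r ↔ k ≤ n) := by
    intro k hk
    rw [← ENNReal.lt_ofReal_iff_toReal_lt hk]
    exact ⟨fun h => not_lt.1 fun hlt => absurd h (not_lt.2 (hn2.trans (y.eventTime_mono hlt))),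
      fun h => (y.eventTime_mono h).trans_lt hn1⟩
  cases n with
  | zero =>
    rw [D.mem_leftLimitIn_of_zero]
    · simp
    · rw [eventsUpTo, Measure.restrict_apply (measurableSet_Iio.prod MeasurableSet.univ)]
      refine measure_mono_null inter_subset_left (D.events_apply_eq_zero
        (measurableSet_Iio.prod MeasurableSet.univ) fun k hk hmem => ?_)
      have := (hlt (k + 1) hk).1 hmem.1
      omega
  | succ n =>
    have hfin : y.eventTime (n + 1) ≠ ∞ := hn1.ne_top
    have hfin' : y.eventTime n ≠ ∞ := ne_top_of_le_ne_top hfin (y.eventTime_mono n.le_succ)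
    have hI : Ioo (y.eventTime n).toReal r ×ˢ (univ : Set (E × E)) ⊆ Iic r ×ˢ univ :=
      prod_mono_left fun x hx => hx.2.le
    have hmI : MeasurableSet (Ioo (y.eventTime n).toReal r ×ˢ (univ : Set (E × E))) :=
      measurableSet_Ioo.prod MeasurableSet.univ
    have hp : (D.event y n).1 ∈ Ioo (y.eventTime n).toReal r :=
      ⟨(ENNReal.toReal_lt_toReal hfin' hfin).2 (Skeleton.eventTime_lt_succ hy.1 hfin'),
        (hlt (n + 1) hfin).2 le_rfl⟩
    rw [D.mem_leftLimitIn_of_dirac hB hp]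
    · rfl
    · rw [eventsUpTo, Measure.restrict_restrict hmI, inter_eq_self_of_subset_left hI]
      refine D.events_restrict_eq_dirac hmI hfin ⟨hp, trivial⟩ fun k hk hkt hmem => hk ?_
      have h1 := (hlt (k + 1) hkt).1 hmem.1.2
      have h2 : n < k + 1 := by
        by_contra! hle
        exact absurd (ENNReal.toReal_mono hfin' (y.eventTime_mono hle)) (not_le.2 hmem.1.1)
      omega

/-- The last event of the reversed path is the first event of `y`, left in the state before that
event; flowing backwards from there returns to the initial state of `y`. -/
theorem mem_leftLimitIn_reverse (D Dr : PDMP E) (hflow : ∀ t z, Dr.flow t z = D.flow (-t) z) {r : ℝ}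
    (hr : 0 ≤ r) {B : Set E} (hB : MeasurableSet B) {y : Skeleton E} (hy : y.Regular) :
    (D.stateAt y r, reverseEvents r (eventsUpTo r (D.events y))) ∈ Dr.leftLimitIn r B
      ↔ (y 0).2 ∈ B := by
  obtain ⟨n, hn⟩ := Skeleton.exists_count hy.2 r
  have hle : ∀ k, y.eventTime k ≠ ∞ → ((y.eventTime k).toReal ≤ r ↔ k ≤ n) := by
    intro k hk
    rw [← ENNReal.le_ofReal_iff_toReal_le hk hr]
    exact ⟨fun h => not_lt.1 fun hlt => absurd (hn.2.trans_le (y.eventTime_mono hlt)) (not_lt.2 h),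
      fun h => (y.eventTime_mono h).trans hn.1⟩
  have hrev : Measurable (fun p : ℝ × E × E => (r - p.1, p.2.2, p.2.1)) := by fun_prop
  cases n with
  | zero =>
    rw [Dr.mem_leftLimitIn_of_zero, D.stateAt_eq hn, hflow, ← D.flow_add]
    · simp [D.flow_zero]
    · rw [reverseEvents, Measure.map_apply hrev (measurableSet_Iio.prod MeasurableSet.univ)]
      refine measure_mono_null (subset_univ _) ?_
      rw [eventsUpTo, Measure.restrict_apply_univ]
      refine D.events_apply_eq_zero (measurableSet_Iic.prod MeasurableSet.univ) fun k hk hmem => ?_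
      have := (hle (k + 1) hk).1 hmem.1
      omega
  | succ n =>
    have hfin : y.eventTime 1 ≠ ∞ := ne_top_of_le_ne_top ENNReal.ofReal_ne_top
      ((y.eventTime_mono (by omega)).trans hn.1)
    have hpos : 0 < (y.eventTime 1).toReal := by
      rw [ENNReal.toReal_pos_iff]
      exact ⟨by simpa using Skeleton.eventTime_lt_succ hy.1 (n := 0) (by simp), hfin.lt_top⟩
    -- `c` separates the first event from the later ones, so only the first falls in `(r - c, r)`
    -- after reversal.
    obtain ⟨c, hc1, hc2⟩ : ∃ c, (y.eventTime 1).toReal < c ∧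
        ∀ k, k ≠ 0 → y.eventTime (k + 1) ≠ ∞ → c ≤ (y.eventTime (k + 1)).toReal := by
      by_cases h2 : y.eventTime 2 = ∞
      · refine ⟨(y.eventTime 1).toReal + 1, by linarith, fun k hk hkt => absurd ?_ hkt⟩
        exact top_le_iff.1 (h2 ▸ y.eventTime_mono (by omega))
      · refine ⟨(y.eventTime 2).toReal, (ENNReal.toReal_lt_toReal hfin h2).2
          (Skeleton.eventTime_lt_succ hy.1 hfin), fun k hk hkt => ?_⟩
        exact ENNReal.toReal_mono hkt (y.eventTime_mono (by omega))
    have hle1 : (y.eventTime 1).toReal ≤ r := (hle 1 hfin).2 (by omega)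
    set p : ℝ × E × E := (r - (y.eventTime 1).toReal, (y 1).2, D.flow (y 1).1.toReal (y 0).2) with hp
    have hp1 : p.1 ∈ Ioo (r - c) r := ⟨by simp [hp]; linarith, by simp [hp]; linarith⟩
    have hmI : MeasurableSet (Ioo (r - c) r ×ˢ (univ : Set (E × E))) :=
      measurableSet_Ioo.prod MeasurableSet.univ
    rw [Dr.mem_leftLimitIn_of_dirac hB hp1]
    · simp only [hp, hflow, ← D.flow_add]
      have : (y.eventTime 1) = (y 1).1 := by simp [Skeleton.eventTime]
      rw [this]
      simp [D.flow_zero]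
    · rw [reverseEvents, Measure.restrict_map hrev hmI, eventsUpTo,
        Measure.restrict_restrict (hrev hmI), D.events_restrict_eq_dirac (k := 0)
          ((hrev hmI).inter (measurableSet_Iic.prod MeasurableSet.univ)) hfin,
        Measure.map_dirac' hrev]
      · rfl
      · exact ⟨⟨hp1, trivial⟩, hle1, trivial⟩
      · intro k hk hkt hmem
        have h1 : r - c < r - (y.eventTime (k + 1)).toReal := hmem.1.1.1
        have := hc2 k hk hkt
        linarith

theorem ae_pathLaw_pos (D : PDMP E) (π : Measure E) :
    ∀ᵐ y ∂(D.pathLaw π), ∀ n, 0 < (y (n + 1)).1 := by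
  have hS : MeasurableSet {y : Skeleton E | ¬ ∀ n, 0 < (y (n + 1)).1} := by
    have : {y : Skeleton E | ¬ ∀ n, 0 < (y (n + 1)).1} = (⋂ n, {y | 0 < (y (n + 1)).1})ᶜ := by
      ext y; simp
    rw [this]
    exact (MeasurableSet.iInter fun n => measurableSet_lt measurable_const (by fun_prop)).compl
  rw [ae_iff, pathLaw, Measure.bind_apply hS D.pathKernel.measurable.aemeasurable]
  refine (lintegral_congr fun z => ?_).trans lintegral_zero
  exact ae_iff.1 (D.ae_pathKernel_pos z)

theorem NonExplosive.ae_regular {D : PDMP E} {π : Measure E} (hD : D.NonExplosive π) :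
    ∀ᵐ y ∂(D.pathLaw π), y.Regular :=
  (D.ae_pathLaw_pos π).and hD

/-- The joint law of the initial state, the state at time `r`, and the reversed events up to time
`r`. -/
theorem lintegral_reversal {D Dr : PDMP E} {π : Measure E} [IsProbabilityMeasure π]
    (hD : D.NonExplosive π) (hDr : Dr.NonExplosive π) (hrev : D.IsTimeReversal Dr π) {r : ℝ}
    (hr : 0 < r) (G : E × E × Measure (ℝ × E × E) → ℝ≥0∞) (hG : Measurable G) :
    ∫⁻ y, G (Dr.stateBefore y r, (y 0).2, eventsUpTo r (Dr.events y)) ∂(Dr.pathLaw π)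
      = ∫⁻ y, G ((y 0).2, D.stateAt y r, reverseEvents r (eventsUpTo r (D.events y)))
          ∂(D.pathLaw π) := by
  have h0 := hrev.2 r hr.le
  simp_rw [restrict_Icc_events] at h0
  have hmD : Measurable (fun y => (D.stateAt y r, reverseEvents r (eventsUpTo r (D.events y)))) :=
    (D.measurable_stateAt_left r).prodMk
      ((measurable_reverseEvents r).comp (D.measurable_eventsUpTo_events r))
  have hmDr : Measurable (fun y : Skeleton E => ((y 0).2, eventsUpTo r (Dr.events y))) :=
    Measurable.prodMk (by fun_prop) (Dr.measurable_eventsUpTo_events r)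
  have hsB : Measurable (fun y => Dr.stateBefore y r) := by
    have h := Dr.measurable_stateBefore.comp (measurable_prodMk_right (y := r))
    simpa only [Function.comp_def] using h
  have hmD' := (by fun_prop : Measurable (fun y : Skeleton E => (y 0).2)).prodMk hmD
  have hmDr' := hsB.prodMk hmDr
  suffices h : (Dr.pathLaw π).map (fun y => (Dr.stateBefore y r, (y 0).2, eventsUpTo r (Dr.events y)))
      = (D.pathLaw π).map (fun y => ((y 0).2, D.stateAt y r,
        reverseEvents r (eventsUpTo r (D.events y)))) by
    rw [← lintegral_map hG hmDr', h, lintegral_map hG hmD']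
  have : IsProbabilityMeasure ((Dr.pathLaw π).map
      (fun y => (Dr.stateBefore y r, (y 0).2, eventsUpTo r (Dr.events y)))) :=
    Measure.isProbabilityMeasure_map hmDr'.aemeasurable
  -- On a rectangle, membership of the left limit in `B` is almost surely a condition on the other
  -- two components, to which the reversal hypothesis applies.
  refine Measure.ext_prod fun {B S} hB hS => ?_
  rw [Measure.map_apply hmDr' (hB.prod hS), Measure.map_apply hmD' (hB.prod hS)]
  have hL := (Dr.measurableSet_leftLimitIn r hB).inter hS
  have h1 : Dr.pathLaw π ((fun y => (Dr.stateBefore y r, (y 0).2, eventsUpTo r (Dr.events y))) ⁻¹'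
      B ×ˢ S) = ((Dr.pathLaw π).map (fun y => ((y 0).2, eventsUpTo r (Dr.events y))))
        (Dr.leftLimitIn r B ∩ S) := by
    rw [Measure.map_apply hmDr hL]
    refine measure_congr ?_
    filter_upwards [hDr.ae_regular] with y hy
    exact propext (and_congr_left' (Dr.mem_leftLimitIn_events hr hB hy).symm)
  have h2 : D.pathLaw π ((fun y => ((y 0).2, D.stateAt y r,
      reverseEvents r (eventsUpTo r (D.events y)))) ⁻¹' B ×ˢ S)
      = ((D.pathLaw π).map (fun y => (D.stateAt y r,
        reverseEvents r (eventsUpTo r (D.events y))))) (Dr.leftLimitIn r B ∩ S) := by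
    rw [Measure.map_apply hmD hL]
    refine measure_congr ?_
    filter_upwards [hD.ae_regular] with y hy
    exact propext (and_congr_left' (D.mem_leftLimitIn_reverse Dr hrev.1 hr.le hB hy).symm)
  rw [h1, h2]
  exact congrArg (fun μ => μ (Dr.leftLimitIn r B ∩ S)) h0.symm

end PDMP

/-! ### Stationarity of the two-sided path. -/

namespace FullPath

variable {E : Type*} [MeasurableSpace E]

theorem lintegral_law (D Dr : PDMP E) (π : Measure E) {H : FullPath E → ℝ≥0∞} (hH : Measurable H) :
    ∫⁻ w, H w ∂(law D Dr π)
      = ∫⁻ z, ∫⁻ y, ∫⁻ y', H (y, y') ∂(Dr.pathKernel z) ∂(D.pathKernel z) ∂π := by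
  unfold law
  rw [Measure.lintegral_bind (Kernel.measurable _).aemeasurable hH.aemeasurable]
  exact lintegral_congr fun z => Kernel.lintegral_prod _ _ _ hH

instance (D Dr : PDMP E) (π : Measure E) [IsProbabilityMeasure π] :
    IsProbabilityMeasure (law D Dr π) := by
  refine ⟨?_⟩
  rw [← lintegral_one, lintegral_law D Dr π measurable_const]
  simp

theorem lintegral_law_swap (D Dr : PDMP E) (π : Measure E) {H : FullPath E → ℝ≥0∞}
    (hH : Measurable H) :
    ∫⁻ w, H w ∂(law D Dr π)
      = ∫⁻ z, ∫⁻ y', ∫⁻ y, H (y, y') ∂(D.pathKernel z) ∂(Dr.pathKernel z) ∂π := by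
  rw [lintegral_law D Dr π hH]
  exact lintegral_congr fun z => lintegral_lintegral_swap hH.aemeasurable

theorem lintegral_events (D Dr : PDMP E) (w : FullPath E) {g : ℝ × E × E → ℝ≥0∞}
    (hg : Measurable g) :
    ∫⁻ p, g p ∂(events D Dr w)
      = ∫⁻ p, g p ∂(D.events w.1) + ∫⁻ p, g (-p.1, p.2.2, p.2.1) ∂(Dr.events w.2) := by
  unfold events
  rw [lintegral_add_measure, lintegral_map hg (by fun_prop)]

theorem lintegral_segment_events (D Dr : PDMP E) (w : FullPath E) (a b : ℝ)
    {g : ℝ × E × E → ℝ≥0∞} (hg : Measurable g) :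
    ∫⁻ p, g p ∂(segment D Dr w a b).2.2
      = ∫⁻ p, (Icc a b ×ˢ univ).indicator (fun p => g (p.1 - a, p.2)) p ∂(events D Dr w) := by
  unfold segment
  rw [lintegral_map hg (by fun_prop), lintegral_indicator (measurableSet_Icc.prod MeasurableSet.univ)]

theorem measurable_lintegral_events (D Dr : PDMP E) {X : Type*} [MeasurableSpace X]
    {g : X × (ℝ × E × E) → ℝ≥0∞} (hg : Measurable g) :
    Measurable (fun q : X × FullPath E => ∫⁻ p, g (q.1, p) ∂(events D Dr q.2)) := by
  have h : ∀ q : X × FullPath E, ∫⁻ p, g (q.1, p) ∂(events D Dr q.2)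
      = ∫⁻ p, g (q.1, p) ∂(D.events q.2.1)
        + ∫⁻ p, g (q.1, (-p.1, p.2.2, p.2.1)) ∂(Dr.events q.2.2) := fun q =>
    lintegral_events D Dr q.2 (hg.comp measurable_prodMk_left)
  simp_rw [h]
  have hg' : Measurable (fun q : X × (ℝ × E × E) => g (q.1, (-q.2.1, q.2.2.2, q.2.2.1))) := by
    fun_prop
  have m1 : Measurable (fun q : X × FullPath E => (q.1, q.2.1)) := by fun_prop
  have m2 : Measurable (fun q : X × FullPath E => (q.1, q.2.2)) := by fun_prop
  have h1 := (D.measurable_lintegral_events hg).comp m1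
  have h2 := (Dr.measurable_lintegral_events hg').comp m2
  exact h1.add h2

/-- Joint measurability in the path and both endpoints is needed because the endpoints become random
and are integrated over. -/
theorem measurable_segment (D Dr : PDMP E) :
    Measurable (fun q : FullPath E × ℝ × ℝ => segment D Dr q.1 q.2.1 q.2.2) := by
  refine Measurable.prodMk (by fun_prop) (Measurable.prodMk ?_ ?_)
  · have m1 : Measurable (fun q : FullPath E × ℝ × ℝ => (q.1.1, q.2.1)) := by fun_prop
    have m2 : Measurable (fun q : FullPath E × ℝ × ℝ => (q.1.2, -q.2.1)) := by fun_prop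
    exact Measurable.ite (measurableSet_le measurable_const (by fun_prop))
      (D.measurable_stateAt.comp m1) (Dr.measurable_stateBefore.comp m2)
  · refine Measure.measurable_of_measurable_coe _ fun S hS => ?_
    have h : ∀ q : FullPath E × ℝ × ℝ, (segment D Dr q.1 q.2.1 q.2.2).2.2 S
        = ∫⁻ p, {x : (ℝ × ℝ) × (ℝ × E × E) | x.1.1 ≤ x.2.1 ∧ x.2.1 ≤ x.1.2 ∧
          (x.2.1 - x.1.1, x.2.2) ∈ S}.indicator 1 (q.2, p) ∂(events D Dr q.1) := by
      intro q
      rw [← lintegral_indicator_one hS,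
        lintegral_segment_events D Dr _ _ _ (measurable_one.indicator hS)]
      refine lintegral_congr fun p => ?_
      simp only [indicator, mem_prod, mem_Icc, mem_univ, and_true, mem_ofPred_eq, Pi.one_apply,
        ← ite_and]
      split_ifs <;> first | rfl | (exfalso; tauto)
    have hm : MeasurableSet {x : (ℝ × ℝ) × (ℝ × E × E) | x.1.1 ≤ x.2.1 ∧ x.2.1 ≤ x.1.2 ∧
          (x.2.1 - x.1.1, x.2.2) ∈ S} := by
      have m3 : Measurable (fun x : (ℝ × ℝ) × (ℝ × E × E) => (x.2.1 - x.1.1, x.2.2)) := by fun_prop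
      have m4 : MeasurableSet {x : (ℝ × ℝ) × (ℝ × E × E) | x.1.1 ≤ x.2.1} :=
        measurableSet_le (by fun_prop) (by fun_prop)
      have m5 : MeasurableSet {x : (ℝ × ℝ) × (ℝ × E × E) | x.2.1 ≤ x.1.2} :=
        measurableSet_le (by fun_prop) (by fun_prop)
      exact m4.inter (m5.inter (m3 hS))
    have h' := (measurable_lintegral_events D Dr (measurable_one.indicator hm)).comp measurable_swap
    simp only [segment] at h
    simp_rw [h]
    exact h'

theorem measurable_segment_comp (D Dr : PDMP E) {X : Type*} [MeasurableSpace X]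
    {f : X → FullPath E} {a b : X → ℝ} (hf : Measurable f) (ha : Measurable a)
    (hb : Measurable b) : Measurable (fun x => segment D Dr (f x) (a x) (b x)) :=
  (measurable_segment D Dr).comp (hf.prodMk (ha.prodMk hb))

/-- Splits the window at time `0`. By right continuity, the state at `-r` is a left limit of the
backward path. -/
theorem segment_eq (D Dr : PDMP E) (w : FullPath E) {r b : ℝ} (hr : 0 < r) (hb : 0 ≤ b) :
    segment D Dr w (-r) b = (r + b, Dr.stateBefore w.2 r,
      reverseEvents r (eventsUpTo r (Dr.events w.2))
        + (eventsUpTo b (D.events w.1)).map (fun p => (p.1 + r, p.2))) := by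
  refine Prod.ext (by simp [segment, add_comm]) (Prod.ext ?_ ?_)
  · simp [segment, state, hr]
  · refine Measure.ext_of_lintegral _ fun g hg => ?_
    have hm : Measurable ((Icc (-r) b ×ˢ univ).indicator
        (fun p : ℝ × E × E => g (p.1 - -r, p.2))) :=
      Measurable.indicator (by fun_prop) (measurableSet_Icc.prod MeasurableSet.univ)
    rw [lintegral_segment_events D Dr _ _ _ hg, lintegral_events D Dr _ hm,
      lintegral_add_measure, reverseEvents, lintegral_map hg (by fun_prop),
      lintegral_map hg (by fun_prop), lintegral_eventsUpTo, lintegral_eventsUpTo, add_comm]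
    congr 1
    · refine lintegral_congr_ae ?_
      filter_upwards [Dr.ae_events_nonneg w.2] with p hp
      have : -p.1 ≤ b := by linarith
      simp [indicator, this, sub_eq_add_neg, add_comm]
    · refine lintegral_congr_ae ?_
      filter_upwards [D.ae_events_nonneg w.1] with p hp
      have : -r ≤ p.1 := by linarith
      simp [indicator, this]

theorem eventsUpTo_add {r b : ℝ} (hb : 0 ≤ b) (ξ : Measure (ℝ × E × E)) :
    eventsUpTo r ξ + (eventsUpTo b (eventsAfter r ξ)).map (fun p => (p.1 + r, p.2))
      = eventsUpTo (r + b) ξ := by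
  refine Measure.ext_of_lintegral _ fun g hg => ?_
  have hm : Measurable ((Iic b ×ˢ univ).indicator (fun p : ℝ × E × E => g (p.1 + r, p.2))) :=
    Measurable.indicator (by fun_prop) (measurableSet_Iic.prod MeasurableSet.univ)
  have hm' : Measurable ((Iic r ×ˢ univ).indicator g) :=
    hg.indicator (measurableSet_Iic.prod MeasurableSet.univ)
  rw [lintegral_add_measure, lintegral_map hg (by fun_prop), lintegral_eventsUpTo,
    lintegral_eventsUpTo, lintegral_eventsUpTo, lintegral_eventsAfter _ _ hm, ← lintegral_add_left hm']
  refine lintegral_congr fun p => ?_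
  rcases le_or_gt p.1 r with h | h
  · have : p.1 ≤ r + b := by linarith
    simp [indicator, h, this, not_lt.2 h]
  · simp [indicator, h, not_le.2 h, add_comm]

/-- Stationarity: the law of the path on `[-r, b]`, translated to `[0, r + b]`, is the law of the
path of the forward process on `[0, r + b]`. -/
theorem lintegral_segment {D Dr : PDMP E} {π : Measure E} [IsProbabilityMeasure π]
    (hD : D.NonExplosive π) (hDr : Dr.NonExplosive π) (hrev : D.IsTimeReversal Dr π)
    {G : PathSegment E → ℝ≥0∞} (hG : Measurable G) {r b : ℝ} (hr : 0 < r) (hb : 0 ≤ b) :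
    ∫⁻ w, G (segment D Dr w (-r) b) ∂(law D Dr π)
      = ∫⁻ y, G (r + b, (y 0).2, eventsUpTo (r + b) (D.events y)) ∂(D.pathLaw π) := by
  set F : E × Measure (ℝ × E × E) × Measure (ℝ × E × E) → ℝ≥0∞ := fun q =>
    G (r + b, q.1, q.2.1 + (eventsUpTo b q.2.2).map (fun p => (p.1 + r, p.2))) with hF
  have hFm : Measurable F := by
    have h1 : Measurable (fun q : E × Measure (ℝ × E × E) × Measure (ℝ × E × E) =>
        eventsUpTo b q.2.2) := (measurable_eventsUpTo b).comp (by fun_prop)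
    have h2 : Measurable (fun q : E × Measure (ℝ × E × E) × Measure (ℝ × E × E) =>
        (eventsUpTo b q.2.2).map (fun p : ℝ × E × E => (p.1 + r, p.2))) :=
      (Measure.measurable_map _ (by fun_prop)).comp h1
    have h3 : Measurable (fun q : E × Measure (ℝ × E × E) × Measure (ℝ × E × E) =>
        q.2.1 + (eventsUpTo b q.2.2).map (fun p : ℝ × E × E => (p.1 + r, p.2))) :=
      (measurable_fst.comp measurable_snd).add h2
    exact hG.comp (measurable_const.prodMk (measurable_fst.prodMk h3))
  have hseg : Measurable (fun w : FullPath E => G (segment D Dr w (-r) b)) :=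
    hG.comp (measurable_segment_comp D Dr measurable_id measurable_const measurable_const)
  set K : E × E × Measure (ℝ × E × E) → ℝ≥0∞ := fun q =>
    ∫⁻ y, F (q.1, reverseEvents r q.2.2, D.events y) ∂(D.pathKernel q.2.1) with hK
  have hKm : Measurable K := by
    have h1 : Measurable (fun q : (E × E × Measure (ℝ × E × E)) × Skeleton E =>
        reverseEvents r q.1.2.2) := (measurable_reverseEvents r).comp (by fun_prop)
    have h2 : Measurable (fun q : (E × E × Measure (ℝ × E × E)) × Skeleton E =>
        D.events q.2) := D.measurable_events.comp measurable_snd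
    have h3 : Measurable (fun q : (E × E × Measure (ℝ × E × E)) × Skeleton E =>
        q.1.1) := by fun_prop
    exact Measurable.lintegral_kernel_prod_right' (κ := D.pathKernel.comap
      (fun q : E × E × Measure (ℝ × E × E) => q.2.1) (by fun_prop))
      (hFm.comp (h3.prodMk (h1.prodMk h2)))
  clear_value K
  have hsB : Measurable (fun y => Dr.stateBefore y r) := by
    have h := Dr.measurable_stateBefore.comp (measurable_prodMk_right (y := r))
    simpa only [Function.comp_def] using h
  have hsU := Dr.measurable_eventsUpTo_events r
  have hm1 : Measurable (fun p : E × Skeleton E =>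
      K (Dr.stateBefore p.2 r, p.1, eventsUpTo r (Dr.events p.2))) := by
    have h1 : Measurable (fun p : E × Skeleton E => Dr.stateBefore p.2 r) :=
      hsB.comp measurable_snd
    have h2 : Measurable (fun p : E × Skeleton E => eventsUpTo r (Dr.events p.2)) :=
      hsU.comp measurable_snd
    exact hKm.comp (h1.prodMk (measurable_fst.prodMk h2))
  have hm2 : Measurable (fun y : Skeleton E =>
      K (Dr.stateBefore y r, (y 0).2, eventsUpTo r (Dr.events y))) := by
    have h0 : Measurable (fun y : Skeleton E => (y 0).2) := by fun_prop
    exact hKm.comp (hsB.prodMk (h0.prodMk hsU))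
  -- The forward half is integrated out given `Z_0`; the backward half, a path of `Dr` started from
  -- `π`, is reversed; the Markov property at `r` restores the forward half.
  calc ∫⁻ w, G (segment D Dr w (-r) b) ∂(law D Dr π)
      = ∫⁻ z, ∫⁻ y', K (Dr.stateBefore y' r, z, eventsUpTo r (Dr.events y'))
          ∂(Dr.pathKernel z) ∂π := by
        rw [lintegral_law_swap D Dr π hseg]
        simp_rw [segment_eq D Dr _ hr hb]
        rw [hK]
    _ = ∫⁻ y, K (Dr.stateBefore y r, (y 0).2, eventsUpTo r (Dr.events y)) ∂(Dr.pathLaw π) := by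
        rw [Dr.pathLaw_eq π _ hm2]
        exact lintegral_congr fun z => (Dr.lintegral_pathKernel_init z _ hm1).symm
    _ = ∫⁻ y, K ((y 0).2, D.stateAt y r, reverseEvents r (eventsUpTo r (D.events y)))
          ∂(D.pathLaw π) := PDMP.lintegral_reversal hD hDr hrev hr K hKm
    _ = ∫⁻ y, F ((y 0).2, eventsUpTo r (D.events y), eventsAfter r (D.events y))
          ∂(D.pathLaw π) := by
        simp only [hK, reverseEvents_reverseEvents]
        exact (D.lintegral_markov π hD hr.le (fun q => F (q.1, q.2.2.1, q.2.2.2))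
          (hFm.comp (by fun_prop))).symm
    _ = _ := by
        simp only [hF, eventsUpTo_add hb]

end FullPath

/-! ### Deterministic analysis of the stopping rule. -/

/-- A family of valid intervals `[a, b]` which shrinks when the interval grows, and which changes
only at the points of a locally finite set `Ev`. -/
structure ValidFamily (V : ℝ → ℝ → Prop) (Ev : Set ℝ) : Prop where
  mono : ∀ {a b c d}, a ≤ c → c ≤ d → d ≤ b → V a b → V c d
  left : ∀ {a a' b}, a ≤ a' → a' ≤ b → (∀ t ∈ Icc a a', t ∉ Ev) → (V a b ↔ V a' b)
  right : ∀ {a b b'}, a ≤ b → b ≤ b' → (∀ t ∈ Icc b b', t ∉ Ev) → (V a b ↔ V a b')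
  gap : ∀ t, ∃ ε > 0, ∀ s, |s - t| < ε → s ≠ t → s ∉ Ev

/-- The supremum of the lengths `t` for which `[-αt, (1-α)t]` is valid. -/
def stopLength (V : ℝ → ℝ → Prop) (α : ℝ) : ℝ :=
  sSup {t | 0 ≤ t ∧ V (-(α * t)) ((1 - α) * t)}

namespace ValidFamily

variable {V : ℝ → ℝ → Prop} {Ev : Set ℝ}

/-- Reflection in time exchanges forward and backward hits, so only the forward case has to be
analysed. -/
theorem reflect (h : ValidFamily V Ev) :
    ValidFamily (fun a b => V (-b) (-a)) (Neg.neg ⁻¹' Ev) where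
  mono h1 h2 h3 := h.mono (neg_le_neg h3) (neg_le_neg h2) (neg_le_neg h1)
  left {a a' b} h1 h2 h3 := (h.right (neg_le_neg h2) (neg_le_neg h1) fun t ht hE =>
    h3 (-t) ⟨by linarith [ht.2], by linarith [ht.1]⟩ (by simpa using hE)).symm
  right {a b b'} h1 h2 h3 := (h.left (neg_le_neg h2) (neg_le_neg h1) fun t ht hE =>
    h3 (-t) ⟨by linarith [ht.2], by linarith [ht.1]⟩ (by simpa using hE)).symm
  gap t := by
    obtain ⟨ε, hε, h⟩ := h.gap (-t)
    refine ⟨ε, hε, fun s hs hne => h (-s) ?_ (by simpa using hne)⟩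
    rwa [neg_sub_neg, abs_sub_comm]

theorem gap_Icc (h : ValidFamily V Ev) {t : ℝ} (ht : t ∉ Ev) :
    ∃ δ > 0, ∀ s, t - δ < s → s < t + δ → s ∉ Ev := by
  obtain ⟨δ, hδ, h⟩ := h.gap t
  refine ⟨δ, hδ, fun s h1 h2 => ?_⟩
  by_cases hs : s = t
  · rwa [hs]
  · exact h s (abs_lt.2 ⟨by linarith, by linarith⟩) hs

/-- Since `0 < α < 1`, the intervals grow with `t`, so the valid lengths form an initial segment.
The convention `sSup = 0` for empty or unbounded sets is excluded by `0 < T`. -/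
theorem stopLength_eq_iff (h : ValidFamily V Ev) {α T : ℝ} (h0 : 0 < α) (h1 : α < 1) (hT : 0 < T) :
    stopLength V α = T ↔ (∀ t, 0 ≤ t → t < T → V (-(α * t)) ((1 - α) * t)) ∧
      ∀ t, T < t → ¬ V (-(α * t)) ((1 - α) * t) := by
  have hmono : ∀ s t, 0 ≤ s → s ≤ t → V (-(α * t)) ((1 - α) * t) → V (-(α * s)) ((1 - α) * s) := by
    intro s t hs hst
    refine h.mono (by nlinarith) (by nlinarith) (by nlinarith)
  constructor
  · intro hsup
    have hne : {t | 0 ≤ t ∧ V (-(α * t)) ((1 - α) * t)}.Nonempty := by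
      by_contra hne
      rw [not_nonempty_iff_eq_empty] at hne
      rw [stopLength, hne, Real.sSup_empty] at hsup
      exact hT.ne hsup
    have hbdd : BddAbove {t | 0 ≤ t ∧ V (-(α * t)) ((1 - α) * t)} := by
      by_contra hb
      rw [stopLength, Real.sSup_of_not_bddAbove hb] at hsup
      exact hT.ne hsup
    refine ⟨fun t ht htT => ?_, fun t ht hV => ?_⟩
    · rw [← hsup, stopLength] at htT
      obtain ⟨s, hs, hts⟩ := exists_lt_of_lt_csSup hne htT
      exact hmono t s ht hts.le hs.2
    · have := le_csSup hbdd ⟨hT.le.trans ht.le, hV⟩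
      change t ≤ stopLength V α at this
      linarith
  · rintro ⟨hlt, hgt⟩
    refine le_antisymm (csSup_le ⟨0, le_rfl, hlt 0 le_rfl hT⟩ fun t ht => ?_) ?_
    · by_contra! hcon
      exact hgt t hcon ht.2
    · refine le_of_forall_lt fun t ht => ?_
      have hm : max 0 ((t + T) / 2) ∈ {t | 0 ≤ t ∧ V (-(α * t)) ((1 - α) * t)} :=
        ⟨le_max_left _ _, hlt _ (le_max_left _ _) (max_lt hT (by linarith))⟩
      have := le_csSup ⟨T, fun s hs => by
        by_contra! hcon
        exact hgt s hcon hs.2⟩ hm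
      have h2 := le_max_right 0 ((t + T) / 2)
      change _ ≤ stopLength V α at this
      change t < stopLength V α
      linarith

/-- If the left endpoint `-u` is not in `Ev`, then the path on `[-u, e]` is the stopped path if and
only if the valid intervals `[-u, b]` are those with `b < e`, and possibly `b = e`. -/
theorem stopLength_eq_iff_forward (h : ValidFamily V Ev) {α u e : ℝ} (h0 : 0 < α) (h1 : α < 1)
    (hu : 0 < u) (he : 0 < e) (hαu : α * (u + e) = u) (huE : -u ∉ Ev) :
    stopLength V α = u + e ↔ (∀ b, -u ≤ b → b < e → V (-u) b) ∧ ∀ b, e < b → ¬ V (-u) b := by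
  have hαe : (1 - α) * (u + e) = e := by linarith
  rw [h.stopLength_eq_iff h0 h1 (by linarith)]
  obtain ⟨δ, hδ, hgap⟩ := h.gap_Icc huE
  constructor
  · rintro ⟨hlt, hgt⟩
    refine ⟨fun b hb hbe => ?_, fun b hb hV => ?_⟩
    · obtain ⟨η, hη, hηδ⟩ : ∃ η > 0, η < min δ (min (e - b) e) := exists_between
        (lt_min hδ (lt_min (by linarith) he))
      obtain ⟨hη1, hη2⟩ := lt_min_iff.1 hηδ
      obtain ⟨hη2, hη3⟩ := lt_min_iff.1 hη2
      have e1 : α * (u + e - η) = u - α * η := by rw [mul_sub, hαu]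
      have e2 : (1 - α) * (u + e - η) = e - (1 - α) * η := by rw [mul_sub, hαe]
      have hV := hlt (u + e - η) (by linarith) (by linarith)
      rw [e1, e2] at hV
      have h3 : α * η < η := by nlinarith
      have h4 : (1 - α) * η < η := by nlinarith
      have h5 : 0 < α * η := by positivity
      refine h.mono le_rfl hb (by linarith : b ≤ e - (1 - α) * η) ((h.left (by linarith) ?_ ?_).2 hV)
      · linarith
      · exact fun t ht => hgap t (by linarith [ht.1]) (by linarith [ht.2])
    · obtain ⟨η, hη, hηδ⟩ : ∃ η > 0, η < min δ (b - e) := exists_between (lt_min hδ (by linarith))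
      obtain ⟨hη1, hη2⟩ := lt_min_iff.1 hηδ
      have e1 : α * (u + e + η) = u + α * η := by rw [mul_add, hαu]
      have e2 : (1 - α) * (u + e + η) = e + (1 - α) * η := by rw [mul_add, hαe]
      have hnV := hgt (u + e + η) (by linarith)
      rw [e1, e2] at hnV
      have h3 : α * η < η := by nlinarith
      have h4 : (1 - α) * η < η := by nlinarith
      have h5 : 0 < α * η := by positivity
      have h6 : 0 < (1 - α) * η := mul_pos (by linarith) hη
      refine hnV ((h.left (by linarith) ?_ ?_).2 (h.mono le_rfl ?_ ?_ hV))
      · linarith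
      · exact fun t ht => hgap t (by linarith [ht.1]) (by linarith [ht.2])
      · linarith
      · linarith
  · rintro ⟨hlt, hgt⟩
    refine ⟨fun t ht htT => ?_, fun t ht hV => ?_⟩
    · have h2 : (1 - α) * t < e := by
        rw [← hαe]; exact mul_lt_mul_of_pos_left htT (by linarith)
      have h3 : α * t < u := by
        calc α * t < α * (u + e) := mul_lt_mul_of_pos_left htT h0
          _ = u := hαu
      have h4 : 0 ≤ (1 - α) * t := mul_nonneg (by linarith) ht
      have h5 : 0 ≤ α * t := mul_nonneg h0.le ht
      exact h.mono (by linarith) (by linarith) le_rfl (hlt ((1 - α) * t) (by linarith) h2)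
    · obtain ⟨η, hη, hηδ⟩ : ∃ η > 0, η < min δ (t - (u + e)) :=
        exists_between (lt_min hδ (by linarith))
      obtain ⟨hη1, hη2⟩ := lt_min_iff.1 hηδ
      have e1 : α * (u + e + η) = u + α * η := by rw [mul_add, hαu]
      have e2 : (1 - α) * (u + e + η) = e + (1 - α) * η := by rw [mul_add, hαe]
      have h3 : α * η < η := by nlinarith
      have h5 : 0 < α * η := by positivity
      have h6 : 0 < (1 - α) * η := mul_pos (by linarith) hη
      have h7 : α * (u + e + η) ≤ α * t := mul_le_mul_of_nonneg_left (by linarith) h0.le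
      have h8 : (1 - α) * (u + e + η) ≤ (1 - α) * t :=
        mul_le_mul_of_nonneg_left (by linarith) (by linarith)
      have hV' : V (-(u + α * η)) (e + (1 - α) * η) :=
        h.mono (by linarith) (by linarith) (by linarith) hV
      refine hgt (e + (1 - α) * η) (by linarith) ((h.left (by linarith) (by linarith) ?_).1 hV')
      exact fun t ht => hgap t (by linarith [ht.1]) (by linarith [ht.2])

theorem stopLength_reflect (V : ℝ → ℝ → Prop) (α : ℝ) :
    stopLength (fun a b => V (-b) (-a)) (1 - α) = stopLength V α := by
  unfold stopLength
  congr 1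
  ext t
  simp

/-- Around an event-free left endpoint, moving that endpoint does not affect validity. Moved inward,
the path still cannot be extended to the right; moved outward, it stays valid for every right
endpoint short of the stopping point. -/
theorem hit_forward (h : ValidFamily V Ev) {α : ℝ} (h0 : 0 < α) (h1 : α < 1)
    (hT : 0 < stopLength V α) (hE : -(α * stopLength V α) ∉ Ev) :
    (∃ a', -(α * stopLength V α) < a' ∧ a' ≤ 0 ∧
      ∀ b', (1 - α) * stopLength V α < b' → ¬ V a' b') ∧
    ¬ ∃ b', 0 ≤ b' ∧ b' < (1 - α) * stopLength V α ∧
      ∀ a', a' < -(α * stopLength V α) → ¬ V a' b' := by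
  set T := stopLength V α with hTdef
  have hu : 0 < α * T := mul_pos h0 hT
  have he : 0 < (1 - α) * T := mul_pos (by linarith) hT
  obtain ⟨hlt, hgt⟩ := (h.stopLength_eq_iff_forward h0 h1 hu he (by ring) hE).1
    (by rw [← hTdef]; ring)
  obtain ⟨δ, hδ, hgap⟩ := h.gap_Icc hE
  obtain ⟨η, hη, hηδ⟩ : ∃ η > 0, η < min δ (α * T) := exists_between (lt_min hδ hu)
  obtain ⟨hη1, hη2⟩ := lt_min_iff.1 hηδ
  refine ⟨⟨-(α * T) + η, by linarith, by linarith, fun b' hb' hV => ?_⟩, ?_⟩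
  · refine hgt b' hb' ((h.left (by linarith) (by linarith) ?_).2 hV)
    exact fun t ht => hgap t (by linarith [ht.1]) (by linarith [ht.2])
  · rintro ⟨b', hb0, hb', hall⟩
    refine hall (-(α * T) - η) (by linarith) ((h.left (by linarith) (by linarith) ?_).2
      (hlt b' (by linarith) hb'))
    exact fun t ht => hgap t (by linarith [ht.1]) (by linarith [ht.2])

theorem hit_backward (h : ValidFamily V Ev) {α : ℝ} (h0 : 0 < α) (h1 : α < 1)
    (hT : 0 < stopLength V α) (hE : (1 - α) * stopLength V α ∉ Ev) :
    (∃ b', 0 ≤ b' ∧ b' < (1 - α) * stopLength V α ∧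
      ∀ a', a' < -(α * stopLength V α) → ¬ V a' b') ∧
    ¬ ∃ a', -(α * stopLength V α) < a' ∧ a' ≤ 0 ∧
      ∀ b', (1 - α) * stopLength V α < b' → ¬ V a' b' := by
  have := h.reflect.hit_forward (α := 1 - α) (by linarith) (by linarith)
    (by rwa [stopLength_reflect]) (by simpa [stopLength_reflect] using hE)
  rw [stopLength_reflect] at this
  obtain ⟨⟨a', ha1, ha2, ha3⟩, hn⟩ := this
  refine ⟨⟨-a', by linarith, by linarith, fun b hb => ?_⟩, ?_⟩
  · simpa using ha3 (-b) (by linarith)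
  · rintro ⟨b, hb1, hb2, hb3⟩
    refine hn ⟨-b, by linarith, by linarith, fun c hc => ?_⟩
    simpa using hb3 (-c) (by linarith)

/-- If neither endpoint were an event, `hit_forward` would give a forward hit and `hit_backward`
would exclude it. -/
theorem mem_or_mem (h : ValidFamily V Ev) {α : ℝ} (h0 : 0 < α) (h1 : α < 1)
    (hT : 0 < stopLength V α) : -(α * stopLength V α) ∈ Ev ∨ (1 - α) * stopLength V α ∈ Ev := by
  by_contra! hcon
  obtain ⟨⟨a, ha1, ha2, ha3⟩, -⟩ := h.hit_forward h0 h1 hT hcon.1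
  exact (h.hit_backward h0 h1 hT hcon.2).2 ⟨a, ha1, ha2, ha3⟩

end ValidFamily

/-! ### Almost sure regularity of the full path. -/

/-- The sections of a measurable subset of a product are determined by countably many measurable
sets. -/
theorem exists_measurable_section {A B : Type*} [MeasurableSpace A] [MeasurableSpace B]
    {S : Set (A × B)} (hS : MeasurableSet S) :
    ∃ g : A → ℕ → Prop, (∀ n, Measurable fun a => g a n) ∧
      ∀ a a', (∀ n, g a n ↔ g a' n) → ∀ b, (a, b) ∈ S ↔ (a', b) ∈ S := by
  induction S, hS using MeasurableSpace.induction_on_inter generateFrom_prod.symm isPiSystem_prod with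
  | empty => exact ⟨fun _ _ => True, fun _ => measurable_const, by simp⟩
  | basic t ht =>
    obtain ⟨u, hu, v, hv, rfl⟩ := ht
    refine ⟨fun a _ => a ∈ u, fun _ => hu.mem, fun a a' h b => ?_⟩
    simp [h 0]
  | compl t _ ih =>
    obtain ⟨g, hg, h⟩ := ih
    exact ⟨g, hg, fun a a' haa b => not_congr (h a a' haa b)⟩
  | iUnion f _ _ ih =>
    choose g hg h using ih
    refine ⟨fun a n => g n.unpair.1 a n.unpair.2, fun n => hg _ _, fun a a' haa b => ?_⟩
    simp only [mem_iUnion]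
    refine exists_congr fun i => h i a a' (fun n => ?_) b
    simpa using haa (Nat.pair i n)

theorem Skeleton.finite_eventTime_le {E : Type*} {y : Skeleton E}
    (h : Tendsto y.eventTime atTop (𝓝 ∞)) (M : ℝ) :
    {n : ℕ | y.eventTime n ≠ ∞ ∧ (y.eventTime n).toReal ≤ M}.Finite := by
  obtain ⟨N, hN⟩ := (eventually_atTop.1
    (h.eventually (lt_mem_nhds (ENNReal.ofReal_lt_top (r := M)))))
  refine (finite_lt_nat N).subset fun n hn => ?_
  by_contra hcon
  have := hN n (not_lt.1 hcon)
  rw [ENNReal.ofReal_lt_iff_lt_toReal _ hn.1] at this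
  · exact absurd hn.2 (not_le.2 this)
  · exact ENNReal.toReal_nonneg.trans hn.2

theorem PDMP.events_eq_zero_iff {E : Type*} [MeasurableSpace E] (D : PDMP E) {y : Skeleton E}
    {S : Set (ℝ × E × E)} (hS : MeasurableSet S) :
    D.events y S = 0 ↔ ∀ n, y.eventTime (n + 1) ≠ ∞ → D.event y n ∉ S := by
  refine ⟨fun h n hn hmem => ?_, D.events_apply_eq_zero hS⟩
  rw [← lintegral_indicator_one hS, D.lintegral_events y (measurable_one.indicator hS),
    ENNReal.tsum_eq_zero] at h
  have := h n
  simp [indicator, hn, hmem] at this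

namespace FullPath

section

variable {E : Type*}

/-- The set of the event times of a full path. -/
def times (w : FullPath E) : Set ℝ :=
  {t | ∃ n, w.1.eventTime (n + 1) ≠ ∞ ∧ (w.1.eventTime (n + 1)).toReal = t} ∪
    {t | ∃ n, w.2.eventTime (n + 1) ≠ ∞ ∧ -(w.2.eventTime (n + 1)).toReal = t}

/-- The full path whose second part starts from the same state as the first part. -/
def reconcile (w : FullPath E) : FullPath E :=
  (w.1, Function.update w.2 0 (0, (w.1 0).2))

theorem times_reconcile (w : FullPath E) : w.reconcile.times = w.times := by
  simp [times, reconcile, Skeleton.eventTime_update]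

theorem reconcile_reconcile (w : FullPath E) : w.reconcile.reconcile = w.reconcile := by
  simp [reconcile]

theorem regular_reconcile {w : FullPath E} (h1 : w.1.Regular) (h2 : w.2.Regular) :
    w.reconcile.Regular := by
  refine ⟨h1, ⟨fun n => ?_, ?_⟩, by simp [reconcile]⟩
  · simpa [reconcile] using h2.1 n
  · have : Skeleton.eventTime (Function.update w.2 0 (0, (w.1 0).2)) = w.2.eventTime :=
      funext fun n => Skeleton.eventTime_update _ _ _
    simpa [reconcile, this] using h2.2

/-- Only finitely many events lie in `[t - 1, t + 1]`, so those other than `t` keep a positive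
distance from `t`. -/
theorem times_gap {w : FullPath E} (h1 : w.1.Regular) (h2 : w.2.Regular) (t : ℝ) :
    ∃ ε > 0, ∀ s, |s - t| < ε → s ≠ t → s ∉ w.times := by
  have hfin : (w.times ∩ Icc (t - 1) (t + 1)).Finite := by
    have f1 := (Skeleton.finite_eventTime_le h1.2 (t + 1)).image
      (fun n => (w.1.eventTime n).toReal)
    have f2 := (Skeleton.finite_eventTime_le h2.2 (1 - t)).image
      (fun n => -(w.2.eventTime n).toReal)
    refine (f1.union f2).subset ?_
    rintro s ⟨⟨n, hn, rfl⟩ | ⟨n, hn, rfl⟩, hs1, hs2⟩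
    · exact Or.inl ⟨n + 1, ⟨hn, hs2⟩, rfl⟩
    · exact Or.inr ⟨n + 1, ⟨hn, by linarith⟩, rfl⟩
  have hopen := (hfin.sdiff (t := {t})).isClosed.isOpen_compl
  obtain ⟨ε, hε, hball⟩ := Metric.isOpen_iff.1 hopen t (by simp)
  refine ⟨min ε 1, lt_min hε one_pos, fun s hs hne hmem => ?_⟩
  obtain ⟨hs1, hs2⟩ := lt_min_iff.1 hs
  refine hball (by rwa [Metric.mem_ball, Real.dist_eq]) ⟨⟨hmem, ?_⟩, hne⟩
  have := abs_lt.1 hs2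
  exact ⟨by linarith, by linarith⟩

end

variable {E : Type*} [MeasurableSpace E]

theorem events_eq_zero_iff (D Dr : PDMP E) {w : FullPath E} {A : Set ℝ} (hA : MeasurableSet A) :
    events D Dr w (A ×ˢ univ) = 0 ↔ ∀ t ∈ A, t ∉ w.times := by
  have hm : Measurable (fun p : ℝ × E × E => (-p.1, p.2.2, p.2.1)) := by fun_prop
  have hA' : MeasurableSet (A ×ˢ (univ : Set (E × E))) := hA.prod MeasurableSet.univ
  rw [events, Measure.add_apply, add_eq_zero, Measure.map_apply hm hA', D.events_eq_zero_iff hA',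
    Dr.events_eq_zero_iff (hm hA')]
  constructor
  · rintro ⟨h1, h2⟩ t ht (⟨n, hn, rfl⟩ | ⟨n, hn, rfl⟩)
    · exact h1 n hn ⟨ht, trivial⟩
    · exact h2 n hn ⟨ht, trivial⟩
  · intro h
    exact ⟨fun n hn hmem => h _ hmem.1 (Or.inl ⟨n, hn, rfl⟩),
      fun n hn hmem => h _ hmem.1 (Or.inr ⟨n, hn, rfl⟩)⟩

theorem hasEventAt_iff (D Dr : PDMP E) {w : FullPath E} {t : ℝ} :
    HasEventAt D Dr w t ↔ t ∈ w.times := by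
  rw [HasEventAt, Ne, events_eq_zero_iff D Dr (measurableSet_singleton t)]
  simp

/-- Dependence on events only is applied to two intervals of the same path. They differ by a set
without events, and an endpoint that moves is an event neither before nor after, so the events and
the endpoint conditions agree. -/
theorem validFamily_of_regular {D Dr : PDMP E} {valid : Set (PathSegment E)}
    (hcons : StoppingCriterion.Consistent D Dr valid)
    (hev : StoppingCriterion.DependsOnlyOnEvents D Dr valid) {w : FullPath E} (hw : w.Regular) :
    ValidFamily (fun a b => segment D Dr w a b ∈ valid) w.times := by
  have key : ∀ a b a' b', a ≤ b → a' ≤ b' → (a ∈ w.times ↔ a' ∈ w.times) →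
      (b ∈ w.times ↔ b' ∈ w.times) →
      (∀ t, (t ∈ Icc a b ∧ t ∉ Icc a' b') ∨ (t ∈ Icc a' b' ∧ t ∉ Icc a b) → t ∉ w.times) →
      (segment D Dr w a b ∈ valid ↔ segment D Dr w a' b' ∈ valid) := by
    intro a b a' b' hab hab' ha hb h
    refine hev w w hw hw a b a' b' 0 hab hab' ?_ ?_ ?_
    · have hid : (fun p : ℝ × E × E => (p.1 + 0, p.2)) = id := by ext p <;> simp
      rw [hid, Measure.map_id]
      refine Measure.restrict_congr_set ?_
      have hnull := (events_eq_zero_iff D Dr (w := w)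
        (A := (Icc a b \ Icc a' b') ∪ (Icc a' b' \ Icc a b))
        ((measurableSet_Icc.diff measurableSet_Icc).union
          (measurableSet_Icc.diff measurableSet_Icc))).2 (fun t ht => h t ht)
      filter_upwards [measure_eq_zero_iff_ae_notMem.1 hnull] with p hp
      refine propext ?_
      change (p ∈ Icc a b ×ˢ (univ : Set (E × E))) ↔ (p ∈ Icc a' b' ×ˢ (univ : Set (E × E)))
      simp only [mem_prod, mem_univ, and_true, mem_union, Set.mem_sdiff] at hp ⊢
      tauto
    · rw [hasEventAt_iff, hasEventAt_iff, ha]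
    · rw [hasEventAt_iff, hasEventAt_iff, hb]
  refine ⟨fun h1 h2 h3 h4 => hcons w hw _ _ _ _ h1 h2 h3 h4, ?_, ?_, times_gap hw.1 hw.2.1⟩
  · intro a a' b h1 h2 h3
    refine key a b a' b (h1.trans h2) h2 (iff_of_false (h3 a ⟨le_rfl, h1⟩) (h3 a' ⟨h1, le_rfl⟩))
      Iff.rfl fun t ht => ?_
    rcases ht with ⟨ht, hn⟩ | ⟨ht, hn⟩
    · refine h3 t ⟨ht.1, ?_⟩
      by_contra! hcon
      exact hn ⟨hcon.le, ht.2⟩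
    · exact absurd ⟨h1.trans ht.1, ht.2⟩ hn
  · intro a b b' h1 h2 h3
    refine key a b a b' h1 (h1.trans h2) Iff.rfl
      (iff_of_false (h3 b ⟨le_rfl, h2⟩) (h3 b' ⟨h2, le_rfl⟩)) fun t ht => ?_
    rcases ht with ⟨ht, hn⟩ | ⟨ht, hn⟩
    · exact absurd ⟨ht.1, ht.2.trans h2⟩ hn
    · refine h3 t ⟨?_, ht.2⟩
      by_contra! hcon
      exact hn ⟨ht.1, hcon.le⟩

theorem measurable_reconcile : Measurable (reconcile (E := E)) := by
  unfold reconcile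
  refine measurable_fst.prodMk (measurable_pi_lambda _ fun n => ?_)
  by_cases hn : n = 0
  · subst hn
    simp only [Function.update_self]
    fun_prop
  · simp only [Function.update_of_ne hn]
    fun_prop

theorem lintegral_law_reconcile (D Dr : PDMP E) (π : Measure E) {H : FullPath E → ℝ≥0∞}
    (hH : Measurable H) : ∫⁻ w, H w.reconcile ∂(law D Dr π) = ∫⁻ w, H w ∂(law D Dr π) := by
  have hm : Measurable (fun w : FullPath E => H w.reconcile) := hH.comp measurable_reconcile
  have hm' : Measurable (fun q : (E × Skeleton E) × Skeleton E =>
      H (q.1.2, Function.update q.2 0 (0, q.1.1))) := by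
    refine hH.comp (Measurable.prodMk (by fun_prop) (measurable_pi_lambda _ fun n => ?_))
    by_cases hn : n = 0
    · subst hn
      simp only [Function.update_self]
      fun_prop
    · simp only [Function.update_of_ne hn]
      fun_prop
  rw [lintegral_law D Dr π hm, lintegral_law D Dr π hH]
  refine lintegral_congr fun z => ?_
  have h1 := D.lintegral_pathKernel_init z
    (fun p => ∫⁻ y', H (p.2, Function.update y' 0 (0, p.1)) ∂(Dr.pathKernel z))
    hm'.lintegral_prod_right'
  refine h1.trans (lintegral_congr fun y => ?_)
  exact (Dr.lintegral_pathKernel_update z (fun y' => H (y, y')) (hH.comp measurable_prodMk_left)).symm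

/-- The assumptions on `valid` concern paths whose two halves start from the same state, but the
diagonal of `E` need not be measurable, so this cannot simply be imposed almost surely. Since
validity for all `a` and `b` is determined by countably many measurable events, and reconciling
preserves the law and is idempotent, it almost surely has no effect on validity. -/
theorem ae_segment_reconcile (D Dr : PDMP E) (π : Measure E) {valid : Set (PathSegment E)}
    (hmeas : MeasurableSet valid) : ∀ᵐ w ∂(law D Dr π), ∀ a b,
      segment D Dr w a b ∈ valid ↔ segment D Dr w.reconcile a b ∈ valid := by
  obtain ⟨g, hg, h⟩ := exists_measurable_section (measurable_segment D Dr hmeas)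
  have hae : ∀ᵐ w ∂(law D Dr π), ∀ n, g w n ↔ g w.reconcile n := by
    rw [ae_all_iff]
    intro n
    have hset : ∀ f : FullPath E → FullPath E, Measurable f → MeasurableSet {w | g (f w) n} :=
      fun f hf => measurableSet_setOfPred.2 ((hg n).comp hf)
    have hN : MeasurableSet {w | ¬ (g w n ↔ g w.reconcile n)} :=
      ((hset id measurable_id).iff (hset _ measurable_reconcile)).compl
    rw [ae_iff, ← lintegral_indicator_one hN,
      ← lintegral_law_reconcile D Dr π (measurable_one.indicator hN)]
    simp [reconcile_reconcile]
  filter_upwards [hae] with w hw a b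
  exact h w w.reconcile hw (a, b)

theorem ae_regular {D Dr : PDMP E} {π : Measure E} [IsProbabilityMeasure π]
    (hD : D.NonExplosive π) (hDr : Dr.NonExplosive π) :
    ∀ᵐ w ∂(law D Dr π), w.1.Regular ∧ w.2.Regular := by
  have h1 : (law D Dr π).map Prod.fst = D.pathLaw π := by
    refine Measure.ext_of_lintegral _ fun g hg => ?_
    rw [lintegral_map hg measurable_fst, lintegral_law D Dr π (H := fun w => g w.1) (hg.comp measurable_fst),
      D.pathLaw_eq π g hg]
    simp
  have h2 : (law D Dr π).map Prod.snd = Dr.pathLaw π := by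
    refine Measure.ext_of_lintegral _ fun g hg => ?_
    rw [lintegral_map hg measurable_snd, lintegral_law D Dr π (H := fun w => g w.2) (hg.comp measurable_snd),
      Dr.pathLaw_eq π g hg]
    simp
  refine (ae_of_ae_map measurable_fst.aemeasurable ?_).and
    (ae_of_ae_map measurable_snd.aemeasurable ?_)
  · rw [h1]; exact hD.ae_regular
  · rw [h2]; exact hDr.ae_regular

/-- The properties of a full path which hold almost surely: event times are locally finite and
distinct, and the validity of its segments is consistent and depends on events only. -/
def Good (D Dr : PDMP E) (valid : Set (PathSegment E)) (w : FullPath E) : Prop :=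
  w.1.Regular ∧ w.2.Regular ∧ ValidFamily (fun a b => segment D Dr w a b ∈ valid) w.times

theorem ae_good {D Dr : PDMP E} {π : Measure E} [IsProbabilityMeasure π]
    (hD : D.NonExplosive π) (hDr : Dr.NonExplosive π) {valid : Set (PathSegment E)}
    (hmeas : MeasurableSet valid) (hcons : StoppingCriterion.Consistent D Dr valid)
    (hev : StoppingCriterion.DependsOnlyOnEvents D Dr valid) :
    ∀ᵐ w ∂(law D Dr π), Good D Dr valid w := by
  filter_upwards [ae_regular hD hDr, ae_segment_reconcile D Dr π hmeas] with w hw h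
  refine ⟨hw.1, hw.2, ?_⟩
  have := validFamily_of_regular hcons hev (regular_reconcile hw.1 hw.2)
  rw [times_reconcile] at this
  simpa only [← h] using this

end FullPath

/-! ### Windows: recovering sub-paths from a path segment, and a measurable stopping length. -/

namespace PathSegment

variable {E : Type*} [MeasurableSpace E]

theorem measurable_events_univ :
    Measurable (fun x : PathSegment E => x.2.2 univ) :=
  (Measure.measurable_coe MeasurableSet.univ).comp (measurable_snd.comp measurable_snd)

open Classical in
/-- The collection of the events of a path segment, as a kernel. It is truncated to `0` if there are
infinitely many events. -/
def eventKernel : Kernel (PathSegment E) (ℝ × E × E) :=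
  Kernel.piecewise (measurable_events_univ (measurableSet_Iio (a := ∞)))
    ⟨fun x => x.2.2, measurable_snd.comp measurable_snd⟩ 0

theorem eventKernel_apply {x : PathSegment E} (hx : x.2.2 univ < ∞) : eventKernel x = x.2.2 := by
  classical
  rw [eventKernel, Kernel.piecewise_apply, if_pos (by exact hx)]
  rfl

/-- Decomposes according to the integer part of the number of events. S-finiteness gives
measurability of integrals over the events and allows Tonelli's theorem. -/
instance : IsSFiniteKernel (eventKernel (E := E)) := by
  classical
  let s : ℕ → Set (PathSegment E) := fun n => {x | (n : ℝ≥0∞) ≤ x.2.2 univ ∧ x.2.2 univ < n + 1}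
  have hs : ∀ n, MeasurableSet (s n) := fun n =>
    (measurableSet_le measurable_const measurable_events_univ).inter
      (measurableSet_lt measurable_events_univ measurable_const)
  let κ : ℕ → Kernel (PathSegment E) (ℝ × E × E) := fun n =>
    Kernel.piecewise (hs n) ⟨fun x => x.2.2, measurable_snd.comp measurable_snd⟩ 0
  have hκ : ∀ n x, κ n x = if x ∈ s n then x.2.2 else 0 := fun n x => by
    rw [Kernel.piecewise_apply]; rfl
  have hfin : ∀ n, IsFiniteKernel (κ n) := fun n => by
    refine ⟨⟨n + 1, by finiteness, fun x => ?_⟩⟩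
    rw [hκ]
    split_ifs with h
    · exact h.2.le
    · simp
  have hsum : eventKernel (E := E) = Kernel.sum κ := by
    ext x A hA
    rw [Kernel.sum_apply' _ _ hA]
    by_cases hx : x.2.2 univ < ∞
    · rw [eventKernel_apply hx]
      obtain ⟨n, hn⟩ : ∃ n : ℕ, x ∈ s n := by
        refine ⟨⌊(x.2.2 univ).toReal⌋₊, ?_, ?_⟩
        · rw [← ENNReal.ofReal_toReal hx.ne, ← ENNReal.ofReal_natCast]
          refine ENNReal.ofReal_le_ofReal ?_
          rw [ENNReal.toReal_ofReal ENNReal.toReal_nonneg]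
          exact Nat.floor_le ENNReal.toReal_nonneg
        · rw [← ENNReal.toReal_lt_toReal hx.ne (by finiteness)]
          simpa [ENNReal.toReal_add] using Nat.lt_floor_add_one (x.2.2 univ).toReal
      rw [tsum_eq_single n, hκ, if_pos hn]
      intro m hm
      rw [hκ, if_neg, Measure.coe_zero, Pi.zero_apply]
      intro hm'
      have h1 : (m : ℝ≥0∞) < n + 1 := hm'.1.trans_lt hn.2
      have h2 : (n : ℝ≥0∞) < m + 1 := hn.1.trans_lt hm'.2
      have h1' : m < n + 1 := by exact_mod_cast h1
      have h2' : n < m + 1 := by exact_mod_cast h2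
      omega
    · rw [eventKernel, Kernel.piecewise_apply, if_neg (by exact hx)]
      symm
      simp only [FunLike.coe_zero, Pi.zero_apply, Measure.coe_zero, ENNReal.tsum_eq_zero]
      intro n
      rw [hκ, if_neg, Measure.coe_zero, Pi.zero_apply]
      exact fun h => hx (h.2.trans (by finiteness))
  rw [hsum]
  have : ∀ n, IsSFiniteKernel (κ n) := fun n => inferInstance
  exact Kernel.isSFiniteKernel_sum

theorem measurable_lintegral_eventKernel {X : Type*} [MeasurableSpace X]
    {g : X × (ℝ × E × E) → ℝ≥0∞} (hg : Measurable g) {f : X → PathSegment E} (hf : Measurable f) :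
    Measurable (fun x => ∫⁻ p, g (x, p) ∂(eventKernel (f x))) :=
  Measurable.lintegral_kernel_prod_right' (κ := eventKernel.comap f hf) hg

/-- The events of a path segment in `[a, b]`, seen from `a`. -/
def eventsIn (x : PathSegment E) (a b : ℝ) : Measure (ℝ × E × E) :=
  ((eventKernel x).restrict (Icc a b ×ˢ univ)).map (fun p => (p.1 - a, p.2))

theorem lintegral_eventsIn (x : PathSegment E) (a b : ℝ) {g : ℝ × E × E → ℝ≥0∞}
    (hg : Measurable g) :
    ∫⁻ p, g p ∂(x.eventsIn a b)
      = ∫⁻ p, (Icc a b ×ˢ univ).indicator (fun p => g (p.1 - a, p.2)) p ∂(eventKernel x) := by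
  unfold eventsIn
  rw [lintegral_map hg (by fun_prop), lintegral_indicator (measurableSet_Icc.prod MeasurableSet.univ)]

theorem measurable_eventsIn {X : Type*} [MeasurableSpace X] {f : X → PathSegment E} {a b : X → ℝ}
    (hf : Measurable f) (ha : Measurable a) (hb : Measurable b) :
    Measurable (fun x => eventsIn (f x) (a x) (b x)) := by
  refine Measure.measurable_of_measurable_coe _ fun S hS => ?_
  have h : ∀ x, eventsIn (f x) (a x) (b x) S = ∫⁻ p, {q : X × (ℝ × E × E) | a q.1 ≤ q.2.1 ∧
      q.2.1 ≤ b q.1 ∧ (q.2.1 - a q.1, q.2.2) ∈ S}.indicator 1 (x, p) ∂(eventKernel (f x)) := by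
    intro x
    rw [← lintegral_indicator_one hS, lintegral_eventsIn _ _ _ (measurable_one.indicator hS)]
    refine lintegral_congr fun p => ?_
    simp only [indicator, mem_prod, mem_Icc, mem_univ, and_true, mem_ofPred_eq, Pi.one_apply,
      ← ite_and]
    split_ifs <;> first | rfl | (exfalso; tauto)
  simp_rw [h]
  refine measurable_lintegral_eventKernel (measurable_one.indicator ?_) hf
  have m3 : Measurable (fun q : X × (ℝ × E × E) => (q.2.1 - a q.1, q.2.2)) := by fun_prop
  have m4 : MeasurableSet {q : X × (ℝ × E × E) | a q.1 ≤ q.2.1} :=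
    measurableSet_le (by fun_prop) (by fun_prop)
  have m5 : MeasurableSet {q : X × (ℝ × E × E) | q.2.1 ≤ b q.1} :=
    measurableSet_le (by fun_prop) (by fun_prop)
  exact m4.inter (m5.inter (m3 hS))

end PathSegment

theorem PDMP.events_Icc_lt_top {E : Type*} [MeasurableSpace E] (D : PDMP E) {y : Skeleton E}
    (hy : Tendsto y.eventTime atTop (𝓝 ∞)) (a b : ℝ) : D.events y (Icc a b ×ˢ univ) < ∞ := by
  have hm : MeasurableSet (Icc a b ×ˢ (univ : Set (E × E))) :=
    measurableSet_Icc.prod MeasurableSet.univ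
  have hfin : {n : ℕ | y.eventTime (n + 1) ≠ ∞ ∧ (y.eventTime (n + 1)).toReal ≤ b}.Finite :=
    (Skeleton.finite_eventTime_le hy b).preimage
      (Function.Injective.injOn fun m n (h : m + 1 = n + 1) => by omega)
  rw [← lintegral_indicator_one hm, D.lintegral_events y (measurable_one.indicator hm),
    tsum_eq_sum (s := hfin.toFinset)]
  · refine ENNReal.sum_lt_top.2 fun n _ => ?_
    simp only [indicator]
    split_ifs <;> simp
  · intro n hn
    by_cases ht : y.eventTime (n + 1) = ∞
    · simp [ht]
    · have : ¬ (y.eventTime (n + 1)).toReal ≤ b := fun h => hn (hfin.mem_toFinset.2 ⟨ht, h⟩)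
      simp [indicator, PDMP.event, this]

namespace FullPath

variable {E : Type*} [MeasurableSpace E]

theorem segment_events_lt_top (D Dr : PDMP E) {w : FullPath E} (h1 : w.1.Regular)
    (h2 : w.2.Regular) (a b : ℝ) : (segment D Dr w a b).2.2 univ < ∞ := by
  have hm : Measurable (fun p : ℝ × E × E => (-p.1, p.2.2, p.2.1)) := by fun_prop
  have hI : MeasurableSet (Icc a b ×ˢ (univ : Set (E × E))) :=
    measurableSet_Icc.prod MeasurableSet.univ
  have hpre : (fun p : ℝ × E × E => (-p.1, p.2.2, p.2.1)) ⁻¹' (Icc a b ×ˢ univ)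
      = Icc (-b) (-a) ×ˢ univ := by
    ext p
    simp only [mem_preimage, mem_prod, mem_Icc, mem_univ, and_true]
    constructor <;> rintro ⟨h3, h4⟩ <;> constructor <;> linarith
  simp only [segment]
  rw [Measure.map_apply (by fun_prop) MeasurableSet.univ, preimage_univ,
    Measure.restrict_apply_univ, events, Measure.add_apply, Measure.map_apply hm hI, hpre]
  exact ENNReal.add_lt_top.2 ⟨D.events_Icc_lt_top h1.2 a b, Dr.events_Icc_lt_top h2.2 _ _⟩

theorem lintegral_eventKernel_segment (D Dr : PDMP E) {w : FullPath E} (h1 : w.1.Regular)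
    (h2 : w.2.Regular) (a b : ℝ) {g : ℝ × E × E → ℝ≥0∞} (hg : Measurable g) :
    ∫⁻ p, g p ∂(PathSegment.eventKernel (segment D Dr w a b))
      = ∫⁻ p, (Icc a b ×ˢ univ).indicator (fun p => g (p.1 - a, p.2)) p ∂(events D Dr w) := by
  rw [PathSegment.eventKernel_apply (segment_events_lt_top D Dr h1 h2 a b),
    lintegral_segment_events D Dr w a b hg]

/-- Allows validity of a sub-path to be decided from the window alone, without the full path. -/
theorem eventsIn_segment (D Dr : PDMP E) {w : FullPath E} (h1 : w.1.Regular)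
    (h2 : w.2.Regular) {a b c d : ℝ} (hac : a ≤ c) (hdb : d ≤ b) :
    PathSegment.eventsIn (segment D Dr w a b) (c - a) (d - a) = (segment D Dr w c d).2.2 := by
  refine Measure.ext_of_lintegral _ fun g hg => ?_
  have hm : Measurable ((Icc (c - a) (d - a) ×ˢ univ).indicator
      (fun p : ℝ × E × E => g (p.1 - (c - a), p.2))) :=
    Measurable.indicator (by fun_prop) (measurableSet_Icc.prod MeasurableSet.univ)
  rw [PathSegment.lintegral_eventsIn _ _ _ hg, lintegral_eventKernel_segment D Dr h1 h2 a b hm,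
    lintegral_segment_events D Dr w c d hg]
  refine lintegral_congr fun p => ?_
  by_cases hp : p.1 ∈ Icc c d
  · have hp' : a ≤ p.1 ∧ p.1 ≤ b := ⟨hac.trans hp.1, hp.2.trans hdb⟩
    simp [indicator, hp.1, hp.2, hp']
  · have : ¬ (c ≤ p.1 ∧ p.1 ≤ d) := hp
    simp [indicator, this]

/-- Stationarity, for functions of the path on the windows `[-r u, M - r u]`. -/
theorem lintegral_window {D Dr : PDMP E} {π : Measure E} [IsProbabilityMeasure π]
    (hD : D.NonExplosive π) (hDr : Dr.NonExplosive π) (hrev : D.IsTimeReversal Dr π) (M : ℝ)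
    {r : ℝ → ℝ} (hr : Measurable r) (hr0 : ∀ u ∈ Ioo 0 M, r u ∈ Ioo 0 M)
    {H : ℝ × PathSegment E → ℝ≥0∞} (hH : Measurable H) :
    ∫⁻ w, (∫⁻ u in Ioo 0 M, H (u, segment D Dr w (-r u) (M - r u))) ∂(law D Dr π)
      = ∫⁻ y, (∫⁻ u in Ioo 0 M, H (u, (M, (y 0).2, eventsUpTo M (D.events y))))
        ∂(D.pathLaw π) := by
  have hm1 : Measurable (fun q : FullPath E × ℝ =>
      H (q.2, segment D Dr q.1 (-r q.2) (M - r q.2))) :=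
    hH.comp (measurable_snd.prodMk
      (measurable_segment_comp D Dr measurable_fst (by fun_prop) (by fun_prop)))
  have hm2 : Measurable (fun q : Skeleton E × ℝ =>
      H (q.2, (M, (q.1 0).2, eventsUpTo M (D.events q.1)))) := by
    have h1 : Measurable (fun q : Skeleton E × ℝ => (q.1 0).2) := by fun_prop
    have h2 : Measurable (fun q : Skeleton E × ℝ => eventsUpTo M (D.events q.1)) :=
      (D.measurable_eventsUpTo_events M).comp measurable_fst
    exact hH.comp (measurable_snd.prodMk (measurable_const.prodMk (h1.prodMk h2)))
  refine (lintegral_lintegral_swap hm1.aemeasurable).trans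
    (Eq.trans ?_ (lintegral_lintegral_swap hm2.aemeasurable).symm)
  refine setLIntegral_congr_fun measurableSet_Ioo fun u hu => ?_
  have := lintegral_segment hD hDr hrev (G := fun x => H (u, x)) (hH.comp measurable_prodMk_left)
    (hr0 u hu).1 (b := M - r u) (by linarith [(hr0 u hu).2])
  simp only [add_sub_cancel] at this
  exact this

/-- A measurable version of the length of the stopped path. -/
def stopLengthM (D Dr : PDMP E) (valid : Set (PathSegment E)) (q : FullPath E × ℝ) : ℝ :=
  (⨆ t : ℚ, {q : FullPath E × ℝ | (0 : ℝ) ≤ t ∧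
    segment D Dr q.1 (-(q.2 * t)) ((1 - q.2) * t) ∈ valid}.indicator
      (fun _ => ENNReal.ofReal t) q).toReal

theorem measurable_stopLengthM (D Dr : PDMP E) {valid : Set (PathSegment E)}
    (hmeas : MeasurableSet valid) : Measurable (stopLengthM D Dr valid) := by
  refine (Measurable.iSup fun t => Measurable.indicator measurable_const ?_).ennreal_toReal
  refine (MeasurableSet.const _).inter ?_
  have : Measurable (fun q : FullPath E × ℝ =>
      segment D Dr q.1 (-(q.2 * t)) ((1 - q.2) * t)) :=
    measurable_segment_comp D Dr measurable_fst (by fun_prop) (by fun_prop)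
  exact this hmeas

/-- Valid lengths form an initial segment, so rational ones have the same supremum. In the unbounded
case the supremum in `ℝ≥0∞` is `∞`, whose `toReal` is `0`, in accordance with the convention for
`sSup`. -/
theorem stopLengthM_eq {D Dr : PDMP E} {valid : Set (PathSegment E)} {w : FullPath E}
    (hw : Good D Dr valid w) {α : ℝ} (h0 : 0 < α) (h1 : α < 1) :
    stopLengthM D Dr valid (w, α) = NoUTurn.length D Dr valid w α := by
  set S := NoUTurn.validLengths D Dr valid w α with hS
  have hmono : ∀ s t, 0 ≤ s → s ≤ t → t ∈ S → s ∈ S := fun s t hs hst ht =>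
    ⟨hs, hw.2.2.mono (by nlinarith) (by nlinarith) (by nlinarith) ht.2⟩
  set A : ℝ≥0∞ := ⨆ t : ℚ, {q : FullPath E × ℝ | (0 : ℝ) ≤ t ∧
    segment D Dr q.1 (-(q.2 * t)) ((1 - q.2) * t) ∈ valid}.indicator
      (fun _ => ENNReal.ofReal t) (w, α) with hA
  have hle : ∀ t : ℚ, (t : ℝ) ∈ S → ENNReal.ofReal t ≤ A := fun t ht => by
    refine le_trans ?_ (le_iSup _ t)
    rw [indicator_of_mem (by exact ht)]
  change A.toReal = sSup S
  by_cases hb : BddAbove S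
  · have hA' : A ≤ ENNReal.ofReal (sSup S) := by
      refine iSup_le fun t => ?_
      by_cases ht : (t : ℝ) ∈ S
      · rw [indicator_of_mem (by exact ht)]
        exact ENNReal.ofReal_le_ofReal (le_csSup hb ht)
      · rw [indicator_of_notMem (by exact ht)]
        exact bot_le
    have hS0 : 0 ≤ sSup S := Real.sSup_nonneg fun t ht => ht.1
    refine le_antisymm (ENNReal.toReal_le_of_le_ofReal hS0 hA') ?_
    refine Real.sSup_le (fun t ht => ?_) ENNReal.toReal_nonneg
    refine le_of_forall_lt_imp_le_of_dense fun s hs => ?_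
    rcases le_or_gt s 0 with hs0 | hs0
    · exact hs0.trans ENNReal.toReal_nonneg
    · obtain ⟨q, hq1, hq2⟩ := exists_rat_btwn hs
      have := hle q (hmono q t (hs0.trans hq1).le hq2.le ht)
      rw [ENNReal.ofReal_le_iff_le_toReal (ne_top_of_le_ne_top ENNReal.ofReal_ne_top hA')] at this
      linarith
  · rw [Real.sSup_of_not_bddAbove hb]
    have : A = ∞ := by
      refine ENNReal.eq_top_of_forall_nnreal_le fun r => ?_
      obtain ⟨t, ht, hrt⟩ := not_bddAbove_iff.1 hb r
      obtain ⟨q, hq1, hq2⟩ := exists_rat_btwn hrt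
      refine le_trans ?_ (hle q (hmono q t (r.2.trans hq1.le) hq2.le ht))
      rw [← ENNReal.ofReal_coe_nnreal]
      exact ENNReal.ofReal_le_ofReal hq1.le
    simp [this]

end FullPath

/-! ### Change of variables from `α` to the position of the free endpoint. -/

/-- The valid intervals `[-u, b]` are those with `b < e`, and possibly `b = e`. -/
def HitsAt (V : ℝ → ℝ → Prop) (u e : ℝ) : Prop :=
  ∀ᶠ n : ℕ in atTop, V (-u) (e - 1 / (n + 1)) ∧ ¬ V (-u) (e + 1 / (n + 1))

namespace ValidFamily

variable {V : ℝ → ℝ → Prop} {Ev : Set ℝ}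

/-- By monotonicity, testing along `1 / (n + 1)` is enough. The sequential form makes the condition
measurable and involves only points arbitrarily close to `e`. -/
theorem hitsAt_iff (h : ValidFamily V Ev) {u e : ℝ} (hu : 0 < u) (he : 0 < e) :
    HitsAt V u e ↔ (∀ b, -u ≤ b → b < e → V (-u) b) ∧ ∀ b, e < b → ¬ V (-u) b := by
  have hlim : ∀ δ : ℝ, 0 < δ → ∀ᶠ n : ℕ in atTop, (1 : ℝ) / (n + 1) < δ := fun δ hδ =>
    tendsto_one_div_add_atTop_nhds_zero_nat.eventually (gt_mem_nhds hδ)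
  constructor
  · intro hh
    refine ⟨fun b hb hbe => ?_, fun b hb hV => ?_⟩
    · obtain ⟨n, hn, hn'⟩ := (hh.and (hlim (e - b) (by linarith))).exists
      exact h.mono le_rfl hb (by linarith) hn.1
    · obtain ⟨n, hn, hn'⟩ := (hh.and (hlim (b - e) (by linarith))).exists
      have : (0 : ℝ) < 1 / (n + 1) := by positivity
      exact hn.2 (h.mono le_rfl (by linarith) (by linarith) hV)
  · rintro ⟨h1, h2⟩
    filter_upwards [hlim e he] with n hn
    have : (0 : ℝ) < 1 / (n + 1) := by positivity
    exact ⟨h1 _ (by linarith) (by linarith), h2 _ (by linarith)⟩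

/-- The change of variables from `α` to the distance `u = αT` of the left endpoint to the starting
point, when the right endpoint is `e`. -/
theorem lintegral_stopLength_forward (h : ValidFamily V Ev) (hEv : Ev.Countable) {e : ℝ}
    (he : 0 < e) (F : ℝ → ℝ≥0∞) :
    ∫⁻ α in Ioo 0 1, {α | (1 - α) * stopLength V α = e}.indicator
        (fun α => F (α * stopLength V α)) α
      = ∫⁻ u in Ioi 0, ENNReal.ofReal (e / (u + e) ^ 2) * {u | HitsAt V u e}.indicator F u := by
  have himage : (fun u : ℝ => u / (u + e)) '' Ioi 0 = Ioo 0 1 := by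
    ext α
    simp only [mem_image, mem_Ioi, mem_Ioo]
    constructor
    · rintro ⟨u, hu, rfl⟩
      exact ⟨by positivity, by rw [div_lt_one (by positivity)]; linarith⟩
    · rintro ⟨h0, h1⟩
      have : 0 < 1 - α := by linarith
      refine ⟨α * e / (1 - α), by positivity, ?_⟩
      field_simp
      ring
  have hderiv : ∀ u ∈ Ioi (0 : ℝ),
      HasDerivWithinAt (fun u : ℝ => u / (u + e)) (e / (u + e) ^ 2) (Ioi 0) u := by
    intro u hu
    have hne : u + e ≠ 0 := by have : 0 < u := hu; positivity
    have := ((hasDerivAt_id u).div ((hasDerivAt_id u).add_const e) hne).hasDerivWithinAt (s := Ioi 0)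
    have heq : (1 * (id u + e) - id u * 1) / (id u + e) ^ 2 = e / (u + e) ^ 2 := by simp
    rw [heq] at this
    exact this
  have hinj : InjOn (fun u : ℝ => u / (u + e)) (Ioi 0) := by
    intro u hu v hv huv
    have hu' : 0 < u := hu
    have hv' : 0 < v := hv
    replace huv : u / (u + e) = v / (v + e) := huv
    rw [div_eq_div_iff (by positivity) (by positivity)] at huv
    have : u * e = v * e := by linarith
    exact mul_right_cancel₀ he.ne' this
  rw [← himage, lintegral_image_eq_lintegral_abs_deriv_mul measurableSet_Ioi hderiv hinj]
  -- The characterisation of the stopped path needs an event-free left endpoint, which fails only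
  -- for countably many `u`.
  have hae : ∀ᵐ u ∂(volume : Measure ℝ), -u ∉ Ev := by
    have : (Neg.neg ⁻¹' Ev).Countable := hEv.preimage neg_injective
    exact measure_eq_zero_iff_ae_notMem.1 (this.measure_zero volume)
  refine setLIntegral_congr_fun_ae measurableSet_Ioi ?_
  filter_upwards [hae] with u hu hu0
  have hu0' : 0 < u := hu0
  have hα0 : 0 < u / (u + e) := by positivity
  have hα1 : u / (u + e) < 1 := by rw [div_lt_one (by positivity)]; linarith
  have hαu : u / (u + e) * (u + e) = u := by field_simp
  rw [abs_of_pos (by positivity)]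
  congr 1
  have hiff : (1 - u / (u + e)) * stopLength V (u / (u + e)) = e ↔ HitsAt V u e := by
    rw [h.hitsAt_iff hu0' he, ← h.stopLength_eq_iff_forward hα0 hα1 hu0' he hαu hu]
    constructor
    · intro heq
      have h1 : (1 - u / (u + e)) * (u + e) = e := by field_simp; ring
      exact mul_left_cancel₀ (by linarith : 1 - u / (u + e) ≠ 0) (heq.trans h1.symm)
    · intro heq
      rw [heq]
      field_simp
      ring
  by_cases hh : HitsAt V u e
  · rw [indicator_of_mem (by exact hiff.2 hh), indicator_of_mem (by exact hh)]
    rw [h.hitsAt_iff hu0' he, ← h.stopLength_eq_iff_forward hα0 hα1 hu0' he hαu hu] at hh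
    rw [hh, hαu]
  · rw [indicator_of_notMem (by exact fun h' => hh (hiff.1 h')), indicator_of_notMem (by exact hh)]

/-- The forward formula for the reflected family, with `α` replaced by `1 - α`; `v` is the distance
from the start to the right endpoint. -/
theorem lintegral_stopLength_backward (h : ValidFamily V Ev) (hEv : Ev.Countable) {s : ℝ}
    (hs : 0 < s) (F : ℝ → ℝ≥0∞) :
    ∫⁻ α in Ioo 0 1, {α | α * stopLength V α = s}.indicator
        (fun α => F ((1 - α) * stopLength V α)) α
      = ∫⁻ v in Ioi 0, ENNReal.ofReal (s / (v + s) ^ 2) *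
          {v | HitsAt (fun a b => V (-b) (-a)) v s}.indicator F v := by
  rw [← h.reflect.lintegral_stopLength_forward (hEv.preimage neg_injective) hs F]
  have hmp : MeasurePreserving (fun α : ℝ => 1 - α) := by
    simpa using Measure.measurePreserving_sub_left volume (1 : ℝ)
  have hpre : (fun α : ℝ => 1 - α) ⁻¹' Ioo 0 1 = Ioo 0 1 := by
    ext α
    simp only [mem_preimage, mem_Ioo]
    constructor <;> rintro ⟨h1, h2⟩ <;> constructor <;> linarith
  rw [← hmp.setLIntegral_comp_preimage_emb (MeasurableEquiv.subLeft (1 : ℝ)).measurableEmbedding,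
    hpre]
  refine lintegral_congr fun α => ?_
  have := stopLength_reflect V (1 - α)
  rw [sub_sub_cancel] at this
  simp only [indicator, mem_ofPred_eq, this, sub_sub_cancel]

end ValidFamily

theorem FullPath.countable_times {E : Type*} (w : FullPath E) : w.times.Countable := by
  refine Countable.union ?_ ?_
  · exact (countable_range fun n => (w.1.eventTime (n + 1)).toReal).mono
      (by rintro t ⟨n, -, rfl⟩; exact ⟨n, rfl⟩)
  · exact (countable_range fun n => -(w.2.eventTime (n + 1)).toReal).mono
      (by rintro t ⟨n, -, rfl⟩; exact ⟨n, rfl⟩)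

theorem lintegral_Ioo_reflect (T : ℝ) (f : ℝ → ℝ≥0∞) :
    ∫⁻ u in Ioo 0 T, f (T - u) = ∫⁻ u in Ioo 0 T, f u := by
  have hmp : MeasurePreserving (fun u : ℝ => T - u) := by
    simpa using Measure.measurePreserving_sub_left volume T
  have hpre : (fun u : ℝ => T - u) ⁻¹' Ioo 0 T = Ioo 0 T := by
    ext u
    simp only [mem_preimage, mem_Ioo]
    constructor <;> rintro ⟨h1, h2⟩ <;> constructor <;> linarith
  rw [← hmp.setLIntegral_comp_preimage_emb (MeasurableEquiv.subLeft T).measurableEmbedding f, hpre]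

/-! ### The two conditional laws of the offset. -/

namespace NoUTurn

theorem lintegral_forwardLaw (T : ℝ) {f : ℝ → ℝ≥0∞} (hf : Measurable f) :
    ∫⁻ l, f l ∂(forwardLaw T)
      = ∫⁻ l in Ioo 0 T, ENNReal.ofReal (2 * (T - l) / T ^ 2) * f l := by
  rw [forwardLaw, lintegral_withDensity_eq_lintegral_mul _ (by fun_prop) hf,
    ← restrict_Ioo_eq_restrict_Icc]
  rfl

theorem lintegral_backwardLaw (T : ℝ) {f : ℝ → ℝ≥0∞} (hf : Measurable f) :
    ∫⁻ l, f l ∂(backwardLaw T)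
      = ∫⁻ l in Ioo 0 T, ENNReal.ofReal (2 * l / T ^ 2) * f l := by
  rw [backwardLaw, lintegral_withDensity_eq_lintegral_mul _ (by fun_prop) hf,
    ← restrict_Ioo_eq_restrict_Icc]
  rfl

theorem isProbabilityMeasure_backwardLaw {T : ℝ} (hT : 0 < T) :
    IsProbabilityMeasure (backwardLaw T) := by
  refine ⟨?_⟩
  rw [backwardLaw, withDensity_apply _ MeasurableSet.univ, Measure.restrict_univ,
    ← ofReal_integral_eq_lintegral_ofReal, integral_Icc_eq_integral_Ioc,
    ← intervalIntegral.integral_of_le hT.le]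
  · rw [intervalIntegral.integral_div, intervalIntegral.integral_const_mul, integral_id]
    rw [ENNReal.ofReal_eq_one]
    field_simp
    simp
  · exact (Continuous.integrableOn_Icc (by fun_prop))
  · refine (ae_restrict_iff' measurableSet_Icc).2 (ae_of_all _ fun l hl => ?_)
    have := hl.1
    simp only [Pi.zero_apply]
    positivity

theorem isProbabilityMeasure_forwardLaw {T : ℝ} (hT : 0 < T) :
    IsProbabilityMeasure (forwardLaw T) := by
  refine ⟨?_⟩
  have := isProbabilityMeasure_backwardLaw hT
  have h1 : ∫⁻ l, 1 ∂(backwardLaw T) = 1 := by simp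
  rw [lintegral_backwardLaw T measurable_const] at h1
  rw [← lintegral_one, lintegral_forwardLaw T measurable_const]
  exact (lintegral_Ioo_reflect T (fun l => ENNReal.ofReal (2 * l / T ^ 2) * 1)).trans h1

/-- The Jacobian weight is the forward density up to the factor `1/2`, its mass on `(0, T)`. -/
theorem lintegral_forwardLaw_half (T : ℝ) {f : ℝ → ℝ≥0∞} (hf : Measurable f) :
    ∫⁻ u in Ioo 0 T, ENNReal.ofReal ((T - u) / T ^ 2) * f u
      = 2⁻¹ * ∫⁻ l, f l ∂(forwardLaw T) := by
  rw [lintegral_forwardLaw T hf, ← lintegral_const_mul _ (by fun_prop)]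
  refine lintegral_congr fun u => ?_
  rw [mul_div_assoc, ENNReal.ofReal_mul zero_le_two, ← mul_assoc, ← mul_assoc]
  congr 1
  rw [ENNReal.ofReal_ofNat, ENNReal.inv_mul_cancel (by simp) (by simp), one_mul]

/-- The weight is the same as in the forward case, but the offset is `T - u`; reflection of `(0, T)`
turns the density into one proportional to `l`. -/
theorem lintegral_backwardLaw_half (T : ℝ) {f : ℝ → ℝ≥0∞} (hf : Measurable f) :
    ∫⁻ u in Ioo 0 T, ENNReal.ofReal ((T - u) / T ^ 2) * f (T - u)
      = 2⁻¹ * ∫⁻ l, f l ∂(backwardLaw T) := by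
  rw [lintegral_backwardLaw T hf, ← lintegral_const_mul _ (by fun_prop),
    lintegral_Ioo_reflect T (fun l => ENNReal.ofReal (l / T ^ 2) * f l)]
  refine lintegral_congr fun u => ?_
  rw [mul_div_assoc, ENNReal.ofReal_mul zero_le_two, ← mul_assoc, ← mul_assoc]
  congr 1
  rw [ENNReal.ofReal_ofNat, ENNReal.inv_mul_cancel (by simp) (by simp), one_mul]

theorem measurable_forwardLaw : Measurable forwardLaw := by
  refine Measure.measurable_of_measurable_coe _ fun S hS => ?_
  have h : ∀ T, forwardLaw T S = ∫⁻ l, {q : ℝ × ℝ | 0 ≤ q.2 ∧ q.2 ≤ q.1 ∧ q.2 ∈ S}.indicator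
      (fun q => ENNReal.ofReal (2 * (q.1 - q.2) / q.1 ^ 2)) (T, l) := fun T => by
    rw [forwardLaw, withDensity_apply _ hS, Measure.restrict_restrict hS,
      ← lintegral_indicator (hS.inter measurableSet_Icc)]
    refine lintegral_congr fun l => ?_
    have : l ∈ S ∩ Icc 0 T ↔ 0 ≤ l ∧ l ≤ T ∧ l ∈ S := by rw [mem_inter_iff, mem_Icc]; tauto
    by_cases h : 0 ≤ l ∧ l ≤ T ∧ l ∈ S
    · rw [indicator_of_mem (this.2 h), indicator_of_mem (by exact h)]
    · rw [indicator_of_notMem (fun h' => h (this.1 h')), indicator_of_notMem (by exact h)]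
  simp_rw [h]
  refine Measurable.lintegral_prod_right' (Measurable.indicator (by fun_prop) ?_)
  exact (measurableSet_le measurable_const measurable_snd).inter
    ((measurableSet_le measurable_snd measurable_fst).inter (measurable_snd hS))

theorem measurable_backwardLaw : Measurable backwardLaw := by
  refine Measure.measurable_of_measurable_coe _ fun S hS => ?_
  have h : ∀ T, backwardLaw T S = ∫⁻ l, {q : ℝ × ℝ | 0 ≤ q.2 ∧ q.2 ≤ q.1 ∧ q.2 ∈ S}.indicator
      (fun q => ENNReal.ofReal (2 * q.2 / q.1 ^ 2)) (T, l) := fun T => by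
    rw [backwardLaw, withDensity_apply _ hS, Measure.restrict_restrict hS,
      ← lintegral_indicator (hS.inter measurableSet_Icc)]
    refine lintegral_congr fun l => ?_
    have : l ∈ S ∩ Icc 0 T ↔ 0 ≤ l ∧ l ≤ T ∧ l ∈ S := by rw [mem_inter_iff, mem_Icc]; tauto
    by_cases h : 0 ≤ l ∧ l ≤ T ∧ l ∈ S
    · rw [indicator_of_mem (this.2 h), indicator_of_mem (by exact h)]
    · rw [indicator_of_notMem (fun h' => h (this.1 h')), indicator_of_notMem (by exact h)]
  simp_rw [h]
  refine Measurable.lintegral_prod_right' (Measurable.indicator (by fun_prop) ?_)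
  exact (measurableSet_le measurable_const measurable_snd).inter
    ((measurableSet_le measurable_snd measurable_fst).inter (measurable_snd hS))

end NoUTurn

/-! ### Resampling the offset inside a window. -/

/-- Data describing how a stopped path is cut out of a window of length `M`: given a window `x` and
an event `p` of it, the stopped path `cut (x, p)`, of length `len p`, ends (or starts) at the event,
`hit` tells that the criterion is hit at this event, and if the distance from the start to the
other endpoint is `u`, then the offset is `off u (len p)`. -/
structure WindowCut (E : Type*) [MeasurableSpace E] where
  len : ℝ × E × E → ℝ
  cut : PathSegment E × (ℝ × E × E) → PathSegment E
  hit : Set (PathSegment E × (ℝ × E × E))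
  off : ℝ → ℝ → ℝ
  measurable_len : Measurable len
  measurable_cut : Measurable cut
  measurableSet_hit : MeasurableSet hit
  measurable_off : Measurable (Function.uncurry off)
  cut_fst : ∀ x p, (cut (x, p)).1 = len p

namespace WindowCut

variable {E : Type*} [MeasurableSpace E]

/-- The contribution to an expectation of the stopped path and the offset, of a window and an event
of the window. -/
def weight (C : WindowCut E) (M : ℝ) (f : PathSegment E × ℝ → ℝ≥0∞)
    (q : (ℝ × PathSegment E) × (ℝ × E × E)) : ℝ≥0∞ :=
  {q : (ℝ × PathSegment E) × (ℝ × E × E) |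
      q.1.1 < C.len q.2 ∧ C.len q.2 ≤ M ∧ (q.1.2, q.2) ∈ C.hit}.indicator
    (fun q => ENNReal.ofReal ((C.len q.2 - q.1.1) / C.len q.2 ^ 2)
      * f (C.cut (q.1.2, q.2), C.off q.1.1 (C.len q.2))) q

theorem measurable_weight (C : WindowCut E) (M : ℝ) {f : PathSegment E × ℝ → ℝ≥0∞}
    (hf : Measurable f) : Measurable (C.weight M f) := by
  have h1 : Measurable (fun q : (ℝ × PathSegment E) × (ℝ × E × E) => C.len q.2) :=
    C.measurable_len.comp measurable_snd
  have h2 : Measurable (fun q : (ℝ × PathSegment E) × (ℝ × E × E) => (q.1.2, q.2)) := by fun_prop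
  have h3 : Measurable (fun q : (ℝ × PathSegment E) × (ℝ × E × E) => q.1.1) := by fun_prop
  have h4 : Measurable (fun q : (ℝ × PathSegment E) × (ℝ × E × E) =>
      C.off q.1.1 (C.len q.2)) := C.measurable_off.comp (h3.prodMk h1)
  refine Measurable.indicator (Measurable.mul ?_ ?_) ?_
  · exact ENNReal.measurable_ofReal.comp ((h1.sub h3).div (h1.pow_const 2))
  · exact hf.comp ((C.measurable_cut.comp h2).prodMk h4)
  · exact (measurableSet_lt h3 h1).inter
      ((measurableSet_le h1 measurable_const).inter (h2 C.measurableSet_hit))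

/-- Integrating over the position of the window. -/
theorem lintegral_weight (C : WindowCut E) {M M' : ℝ} (hM : M ≤ M')
    {f : PathSegment E × ℝ → ℝ≥0∞} (hf : Measurable f) (x : PathSegment E) :
    ∫⁻ u in Ioo 0 M', (∫⁻ p, C.weight M f ((u, x), p) ∂(PathSegment.eventKernel x))
      = ∫⁻ p, {p | C.len p ≤ M ∧ (x, p) ∈ C.hit}.indicator
          (fun p => ∫⁻ u in Ioo 0 (C.len p),
            ENNReal.ofReal ((C.len p - u) / C.len p ^ 2) * f (C.cut (x, p), C.off u (C.len p))) p
          ∂(PathSegment.eventKernel x) := by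
  have hm : Measurable (fun q : ℝ × (ℝ × E × E) => C.weight M f ((q.1, x), q.2)) := by
    have : Measurable (fun q : ℝ × (ℝ × E × E) => ((q.1, x), q.2)) := by fun_prop
    exact (C.measurable_weight M hf).comp this
  rw [lintegral_lintegral_swap hm.aemeasurable]
  refine lintegral_congr fun p => ?_
  by_cases hp : C.len p ≤ M ∧ (x, p) ∈ C.hit
  · rw [indicator_of_mem (by exact hp)]
    -- The condition `len ≤ M ≤ M'` ensures that every position `u < len` of the start occurs among
    -- the window positions.
    have hsub : Ioo 0 (C.len p) = Ioo 0 M' ∩ Iio (C.len p) := by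
      ext u
      simp only [mem_Ioo, mem_inter_iff, mem_Iio]
      exact ⟨fun h => ⟨⟨h.1, h.2.trans_le (hp.1.trans hM)⟩, h.2⟩, fun h => ⟨h.1.1, h.2⟩⟩
    rw [hsub, inter_comm, ← Measure.restrict_restrict measurableSet_Iio,
      ← lintegral_indicator measurableSet_Iio]
    refine lintegral_congr fun u => ?_
    simp only [weight, indicator, mem_ofPred_eq, mem_Iio, hp, and_true]
  · rw [indicator_of_notMem (by exact hp)]
    refine (lintegral_congr fun u => ?_).trans lintegral_zero
    rw [weight, indicator_of_notMem]
    exact fun h => hp h.2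

/-- The offset may be resampled from its conditional law. -/
theorem lintegral_weight_resample (C : WindowCut E) {M M' : ℝ} (hM : M ≤ M') {ρ : ℝ → Measure ℝ}
    (hρ1 : ∀ T, 0 < T → IsProbabilityMeasure (ρ T))
    (hρ : ∀ T (f : ℝ → ℝ≥0∞), Measurable f →
      ∫⁻ u in Ioo 0 T, ENNReal.ofReal ((T - u) / T ^ 2) * f (C.off u T)
        = 2⁻¹ * ∫⁻ l, f l ∂(ρ T))
    {f : PathSegment E × ℝ → ℝ≥0∞} (hf : Measurable f)
    (hf' : Measurable (fun q : PathSegment E × ℝ => ∫⁻ l, f (q.1, l) ∂(ρ q.1.1)))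
    (x : PathSegment E) :
    ∫⁻ u in Ioo 0 M', (∫⁻ p, C.weight M f ((u, x), p) ∂(PathSegment.eventKernel x))
      = ∫⁻ u in Ioo 0 M', (∫⁻ p, C.weight M (fun q => ∫⁻ l, f (q.1, l) ∂(ρ q.1.1)) ((u, x), p)
          ∂(PathSegment.eventKernel x)) := by
  rw [C.lintegral_weight hM hf, C.lintegral_weight hM hf']
  refine lintegral_congr fun p => ?_
  congr 1
  funext p
  rcases le_or_gt (C.len p) 0 with h0 | h0
  · rw [Ioo_eq_empty (not_lt.2 h0)]
    simp
  · have := hρ1 _ h0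
    -- The cut path does not depend on `u`, so the integral in `u` sees only the offset. Both sides
    -- equal half of the `ρ`-average, since `ρ` is a probability measure.
    rw [hρ _ (fun l => f (C.cut (x, p), l)) (hf.comp measurable_prodMk_left)]
    simp only [C.cut_fst]
    rw [hρ _ (fun _ => ∫⁻ l, f (C.cut (x, p), l) ∂(ρ (C.len p))) measurable_const]
    simp

end WindowCut

theorem measurableSet_eventually_nat {X : Type*} [MeasurableSpace X] {p : ℕ → X → Prop}
    (hp : ∀ n, MeasurableSet {x | p n x}) : MeasurableSet {x | ∀ᶠ n in atTop, p n x} := by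
  have : {x | ∀ᶠ n in atTop, p n x} = ⋃ N, ⋂ n, ⋂ (_ : N ≤ n), {x | p n x} := by
    ext x
    simp [eventually_atTop]
  rw [this]
  exact MeasurableSet.iUnion fun N => MeasurableSet.iInter fun n => MeasurableSet.iInter fun _ =>
    hp n

theorem setLIntegral_eq_of_forall_notMem {X : Type*} [MeasurableSpace X] {μ : Measure X}
    {s t : Set X} (hs : MeasurableSet s) (ht : MeasurableSet t) (hst : s ⊆ t) {f : X → ℝ≥0∞}
    (h : ∀ x ∈ t, x ∉ s → f x = 0) : ∫⁻ x in t, f x ∂μ = ∫⁻ x in s, f x ∂μ := by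
  rw [← lintegral_indicator hs, ← lintegral_indicator ht]
  refine lintegral_congr fun x => ?_
  by_cases hx : x ∈ s
  · rw [indicator_of_mem hx, indicator_of_mem (hst hx)]
  · rw [indicator_of_notMem hx]
    exact indicator_apply_eq_zero.2 fun hxt => h x hxt hx

/-! ### Forward hits: the stopped path is the initial part of a window. -/

namespace PathSegment

variable {E : Type*} [MeasurableSpace E]

/-- The initial part, of length `t`, of a path segment. -/
def initial (x : PathSegment E) (t : ℝ) : PathSegment E :=
  (t, x.2.1, x.eventsIn 0 t)

theorem measurable_initial {X : Type*} [MeasurableSpace X] {f : X → PathSegment E} {t : X → ℝ}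
    (hf : Measurable f) (ht : Measurable t) : Measurable (fun q => (f q).initial (t q)) := by
  have h1 : Measurable (fun q => (f q).2.1) := by fun_prop
  exact ht.prodMk (h1.prodMk (measurable_eventsIn hf measurable_const ht))

end PathSegment

theorem FullPath.initial_segment {E : Type*} [MeasurableSpace E] (D Dr : PDMP E) {w : FullPath E}
    (h1 : w.1.Regular) (h2 : w.2.Regular) {a b t : ℝ} (h : a + t ≤ b) :
    (segment D Dr w a b).initial t = segment D Dr w a (a + t) := by
  have h3 := eventsIn_segment D Dr h1 h2 (le_refl a) h
  rw [sub_self, add_sub_cancel_left] at h3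
  rw [PathSegment.initial, h3]
  simp only [segment, add_sub_cancel_left]

/-- The stopped path ends at the given event of the window. -/
def forwardCut {E : Type*} [MeasurableSpace E] {valid : Set (PathSegment E)}
    (hmeas : MeasurableSet valid) : WindowCut E where
  len p := p.1
  cut q := q.1.initial q.2.1
  hit := {q | ∀ᶠ n : ℕ in atTop, q.1.initial (q.2.1 - 1 / (n + 1)) ∈ valid ∧
    q.1.initial (q.2.1 + 1 / (n + 1)) ∉ valid}
  off u _ := u
  measurable_len := measurable_fst
  measurable_cut := PathSegment.measurable_initial measurable_fst (by fun_prop)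
  measurableSet_hit := by
    refine measurableSet_eventually_nat fun n => MeasurableSet.inter ?_ (MeasurableSet.compl ?_)
    · exact PathSegment.measurable_initial
        (t := fun q : PathSegment E × (ℝ × E × E) => q.2.1 - 1 / (n + 1))
        measurable_fst (by fun_prop) hmeas
    · exact PathSegment.measurable_initial
        (t := fun q : PathSegment E × (ℝ × E × E) => q.2.1 + 1 / (n + 1))
        measurable_fst (by fun_prop) hmeas
  measurable_off := measurable_fst
  cut_fst _ _ := rfl

namespace Skeleton

variable {E : Type*}

/-- The finite event times of a skeleton. -/
def eventTimes (y : Skeleton E) : Set ℝ :=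
  {t | ∃ n, y.eventTime (n + 1) ≠ ∞ ∧ (y.eventTime (n + 1)).toReal = t}

theorem Regular.eventTime_pos {y : Skeleton E} (hy : y.Regular) {n : ℕ}
    (hn : y.eventTime (n + 1) ≠ ∞) : 0 < (y.eventTime (n + 1)).toReal := by
  refine ENNReal.toReal_pos (ne_of_gt ?_) hn
  rw [y.eventTime_succ]
  exact (hy.1 n).trans_le le_add_self

theorem Regular.eventTime_injective {y : Skeleton E} (hy : y.Regular) {m n : ℕ}
    (hm : y.eventTime (m + 1) ≠ ∞) (hn : y.eventTime (n + 1) ≠ ∞)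
    (h : (y.eventTime (m + 1)).toReal = (y.eventTime (n + 1)).toReal) : m = n := by
  have key : ∀ m n, m < n → y.eventTime (n + 1) ≠ ∞ →
      (y.eventTime (m + 1)).toReal < (y.eventTime (n + 1)).toReal := by
    intro m n hmn hn
    refine (ENNReal.toReal_lt_toReal (ne_top_of_le_ne_top hn (y.eventTime_mono (by omega))) hn).2 ?_
    calc y.eventTime (m + 1) ≤ y.eventTime n := y.eventTime_mono (by omega)
      _ < y.eventTime (n + 1) := by
        rw [y.eventTime_succ]
        refine ENNReal.lt_add_right (ne_top_of_le_ne_top hn (y.eventTime_mono (by omega)))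
          (hy.1 n).ne'
  rcases lt_trichotomy m n with h1 | h1 | h1
  · exact absurd h (key m n h1 hn).ne
  · exact h1
  · exact absurd h.symm (key n m h1 hm).ne

/-- A function supported by the event times, as a sum over the events. -/
theorem Regular.indicator_eventTimes {y : Skeleton E} (hy : y.Regular) (r : ℝ) (c : ℝ≥0∞) :
    y.eventTimes.indicator (fun _ => c) r
      = ∑' n, {n | y.eventTime (n + 1) ≠ ∞ ∧ r = (y.eventTime (n + 1)).toReal}.indicator
          (fun _ => c) n := by
  by_cases hr : r ∈ y.eventTimes
  · obtain ⟨n, hn, rfl⟩ := hr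
    rw [tsum_eq_single n, indicator_of_mem (by exact ⟨n, hn, rfl⟩), indicator_of_mem (by exact ⟨hn, rfl⟩)]
    intro m hm
    rw [indicator_of_notMem]
    exact fun h => hm (hy.eventTime_injective h.1 hn h.2.symm)
  · rw [indicator_of_notMem hr]
    symm
    rw [ENNReal.tsum_eq_zero]
    intro n
    rw [indicator_of_notMem]
    exact fun h => hr ⟨n, h.1, h.2.symm⟩

end Skeleton

namespace FullPath

variable {E : Type*} [MeasurableSpace E] {D Dr : PDMP E} {valid : Set (PathSegment E)}

/-- In the window starting at `-u`, an event at time `e` has position `u + e`, so the weight `(len -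
u) / len²` is the Jacobian `e / (u + e)²`. -/
theorem weight_forwardCut (hmeas : MeasurableSet valid) {w : FullPath E} (h1 : w.1.Regular)
    (h2 : w.2.Regular) {M u e : ℝ} (hu : 0 < u) (he : 0 < e)
    {f : PathSegment E × ℝ → ℝ≥0∞} (hf0 : ∀ x l, M < x.1 → f (x, l) = 0) (z : E × E) :
    (Icc (-u) (M + 1 - u) ×ˢ univ).indicator (fun p : ℝ × E × E =>
      (forwardCut hmeas).weight M f ((u, segment D Dr w (-u) (M + 1 - u)), (p.1 - -u, p.2))) (e, z)
      = ENNReal.ofReal (e / (u + e) ^ 2) *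
        {u | HitsAt (fun a b => segment D Dr w a b ∈ valid) u e}.indicator
          (fun u => f (segment D Dr w (-u) e, u)) u := by
  by_cases hM : u + e ≤ M
  · have hmem : ((e, z) : ℝ × E × E) ∈ Icc (-u) (M + 1 - u) ×ˢ (univ : Set (E × E)) :=
      ⟨⟨by simp only; linarith, by simp only; linarith⟩, trivial⟩
    rw [indicator_of_mem hmem]
    -- As `u + e ≤ M`, the window of length `M + 1` extends at least `1` beyond `e`: room for the
    -- validity tests at `e + 1 / (n + 1)`.
    have hinit : ∀ t, t ≤ e + 1 → (segment D Dr w (-u) (M + 1 - u)).initial (t - -u)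
        = segment D Dr w (-u) t := fun t ht => by
      rw [initial_segment D Dr h1 h2 (by linarith)]
      congr 1
      ring
    have hiff : (((segment D Dr w (-u) (M + 1 - u)), ((e - -u, z) : ℝ × E × E)) ∈
        (forwardCut hmeas).hit) ↔ HitsAt (fun a b => segment D Dr w a b ∈ valid) u e := by
      refine eventually_congr (Eventually.of_forall fun n => ?_)
      have hn0 : (0 : ℝ) < 1 / (n + 1) := by positivity
      have hn1 : (1 : ℝ) / (n + 1) ≤ 1 := by
        rw [div_le_one (by positivity)]; linarith [(Nat.cast_nonneg n : (0 : ℝ) ≤ n)]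
      have e1 : e - -u - 1 / (n + 1 : ℝ) = (e - 1 / (n + 1)) - -u := by ring
      have e2 : e - -u + 1 / (n + 1 : ℝ) = (e + 1 / (n + 1)) - -u := by ring
      simp only [e1, e2]
      rw [hinit _ (by linarith), hinit _ (by linarith)]
    by_cases hh : HitsAt (fun a b => segment D Dr w a b ∈ valid) u e
    · rw [indicator_of_mem (by exact hh), WindowCut.weight, indicator_of_mem
        (by exact ⟨by simp only [forwardCut]; linarith, by simp only [forwardCut]; linarith,
          hiff.2 hh⟩)]
      simp only [forwardCut]
      rw [hinit _ (by linarith)]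
      congr 3 <;> ring
    · rw [indicator_of_notMem (by exact hh), WindowCut.weight, indicator_of_notMem
        (by exact fun h => hh (hiff.1 h.2.2)), mul_zero]
  · have hz : f (segment D Dr w (-u) e, u) = 0 := hf0 _ _ (by simp only [segment]; linarith)
    have : {u | HitsAt (fun a b => segment D Dr w a b ∈ valid) u e}.indicator
          (fun u => f (segment D Dr w (-u) e, u)) u = 0 := by
      simp [indicator, hz]
    rw [this, mul_zero]
    refine indicator_apply_eq_zero.2 fun _ => ?_
    rw [WindowCut.weight, indicator_of_notMem]
    rintro ⟨-, h, -⟩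
    simp only [forwardCut] at h
    exact hM (by linarith)

/-- An event at or before the start has position at most `u`, and the condition `u < len` rejects
it. -/
theorem weight_forwardCut_neg (hmeas : MeasurableSet valid) (x : PathSegment E) {M u e : ℝ}
    (he : e ≤ 0) (f : PathSegment E × ℝ → ℝ≥0∞) (z : E × E) :
    (forwardCut hmeas).weight M f ((u, x), (e - -u, z)) = 0 := by
  rw [WindowCut.weight, indicator_of_notMem]
  rintro ⟨h, -, -⟩
  simp only [forwardCut] at h
  linarith

theorem lintegral_weight_forwardCut (hmeas : MeasurableSet valid) {w : FullPath E}
    (h1 : w.1.Regular) (h2 : w.2.Regular) {M u : ℝ} (hu : 0 < u)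
    {f : PathSegment E × ℝ → ℝ≥0∞} (hf : Measurable f) (hf0 : ∀ x l, M < x.1 → f (x, l) = 0) :
    ∫⁻ p, (forwardCut hmeas).weight M f ((u, segment D Dr w (-u) (M + 1 - u)), p)
        ∂(PathSegment.eventKernel (segment D Dr w (-u) (M + 1 - u)))
      = ∑' n, {n | w.1.eventTime (n + 1) ≠ ∞}.indicator (fun n =>
          ENNReal.ofReal ((w.1.eventTime (n + 1)).toReal
            / (u + (w.1.eventTime (n + 1)).toReal) ^ 2) *
          {u | HitsAt (fun a b => segment D Dr w a b ∈ valid) u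
            (w.1.eventTime (n + 1)).toReal}.indicator
          (fun u => f (segment D Dr w (-u) (w.1.eventTime (n + 1)).toReal, u)) u) n := by
  have hg : Measurable (fun p => (forwardCut hmeas).weight M f
      ((u, segment D Dr w (-u) (M + 1 - u)), p)) :=
    ((forwardCut hmeas).measurable_weight M hf).comp measurable_prodMk_left
  have hg' : Measurable (fun p : ℝ × E × E => (forwardCut hmeas).weight M f
      ((u, segment D Dr w (-u) (M + 1 - u)), (p.1 - -u, p.2))) := by
    have : Measurable (fun p : ℝ × E × E => (p.1 - -u, p.2)) := by fun_prop
    exact hg.comp this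
  have hgi := hg'.indicator (measurableSet_Icc.prod MeasurableSet.univ :
    MeasurableSet (Icc (-u) (M + 1 - u) ×ˢ (univ : Set (E × E))))
  have hgr : Measurable (fun p : ℝ × E × E => (Icc (-u) (M + 1 - u) ×ˢ univ).indicator
      (fun p : ℝ × E × E => (forwardCut hmeas).weight M f
      ((u, segment D Dr w (-u) (M + 1 - u)), (p.1 - -u, p.2))) (-p.1, p.2.2, p.2.1)) := by
    have : Measurable (fun p : ℝ × E × E => (-p.1, p.2.2, p.2.1)) := by fun_prop
    exact hgi.comp this
  rw [lintegral_eventKernel_segment D Dr h1 h2 _ _ hg, lintegral_events D Dr w hgi,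
    D.lintegral_events w.1 hgi,
    Dr.lintegral_events w.2 hgr]
  have hzero : ∑' n, {y : Skeleton E | y.eventTime (n + 1) ≠ ∞}.indicator (fun y =>
      (Icc (-u) (M + 1 - u) ×ˢ univ).indicator (fun p : ℝ × E × E => (forwardCut hmeas).weight M f
      ((u, segment D Dr w (-u) (M + 1 - u)), (p.1 - -u, p.2))) (-(Dr.event y n).1,
        (Dr.event y n).2.2, (Dr.event y n).2.1)) w.2 = 0 := by
    rw [ENNReal.tsum_eq_zero]
    intro n
    refine indicator_apply_eq_zero.2 fun _ => indicator_apply_eq_zero.2 fun _ => ?_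
    refine weight_forwardCut_neg hmeas _ ?_ f _
    simp [PDMP.event]
  rw [hzero, add_zero]
  refine tsum_congr fun n => ?_
  by_cases hn : w.1.eventTime (n + 1) = ∞
  · rw [indicator_of_notMem (by simpa using hn), indicator_of_notMem (by simpa using hn)]
  · have m1 : n ∈ {n | w.1.eventTime (n + 1) ≠ ∞} := hn
    have m2 : w.1 ∈ {y : Skeleton E | y.eventTime (n + 1) ≠ ∞} := hn
    rw [indicator_of_mem m1, indicator_of_mem m2]
    exact weight_forwardCut hmeas h1 h2 hu (h1.eventTime_pos hn) hf0 _

/-- The contribution of the paths stopped at an event after time `0`. -/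
theorem lintegral_forward (hmeas : MeasurableSet valid) {w : FullPath E}
    (hw : Good D Dr valid w) {M : ℝ} {f : PathSegment E × ℝ → ℝ≥0∞} (hf : Measurable f)
    (hf0 : ∀ x l, M < x.1 → f (x, l) = 0) :
    ∫⁻ α in Ioo 0 1, w.1.eventTimes.indicator
        (fun _ => f (NoUTurn.path D Dr valid w α, NoUTurn.offset D Dr valid w α))
        (NoUTurn.right D Dr valid w α)
      = ∫⁻ u in Ioo 0 (M + 1),
          (∫⁻ p, (forwardCut hmeas).weight M f ((u, segment D Dr w (-u) (M + 1 - u)), p)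
            ∂(PathSegment.eventKernel (segment D Dr w (-u) (M + 1 - u)))) := by
  set V : ℝ → ℝ → Prop := fun a b => segment D Dr w a b ∈ valid with hV
  set e : ℕ → ℝ := fun n => (w.1.eventTime (n + 1)).toReal with he
  set F : ℕ → ℝ → ℝ≥0∞ := fun n u => f (segment D Dr w (-u) (e n), u) with hF
  have hFm : ∀ n, Measurable (F n) := fun n => by
    have : Measurable (fun u => segment D Dr w (-u) (e n)) :=
      measurable_segment_comp D Dr measurable_const measurable_neg measurable_const
    exact hf.comp (this.prodMk measurable_id)
  have hHm : ∀ n, MeasurableSet {u | HitsAt V u (e n)} := fun n => by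
    refine measurableSet_eventually_nat fun k => MeasurableSet.inter ?_ (MeasurableSet.compl ?_)
    · exact measurable_segment_comp D Dr measurable_const measurable_neg measurable_const hmeas
    · exact measurable_segment_comp D Dr measurable_const measurable_neg measurable_const hmeas
  have hlen : ∀ α, NoUTurn.length D Dr valid w α = stopLength V α := fun α => rfl
  calc _ = ∫⁻ α in Ioo 0 1, ∑' n, {n | w.1.eventTime (n + 1) ≠ ∞}.indicator (fun n =>
        {α | (1 - α) * stopLength V α = e n}.indicator (fun α => F n (α * stopLength V α)) α) n := by
        refine lintegral_congr fun α => ?_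
        rw [hw.1.indicator_eventTimes]
        refine tsum_congr fun n => ?_
        by_cases hn : w.1.eventTime (n + 1) ≠ ∞ ∧
          NoUTurn.right D Dr valid w α = (w.1.eventTime (n + 1)).toReal
        · rw [indicator_of_mem (by exact hn), indicator_of_mem (by exact hn.1),
            indicator_of_mem (by exact hn.2)]
          simp only [hF, he, ← hn.2]
          rfl
        · rw [indicator_of_notMem (by exact hn)]
          symm
          refine indicator_apply_eq_zero.2 fun h1 => indicator_apply_eq_zero.2 fun h2 => ?_
          exact absurd ⟨h1, h2⟩ hn
    _ = ∑' n, ∫⁻ α in Ioo 0 1, {n | w.1.eventTime (n + 1) ≠ ∞}.indicator (fun n =>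
        {α | (1 - α) * stopLength V α = e n}.indicator (fun α => F n (α * stopLength V α)) α) n := by
        refine lintegral_tsum fun n => ?_
        by_cases hn : w.1.eventTime (n + 1) = ∞
        · have : ¬ (n ∈ {n | w.1.eventTime (n + 1) ≠ ∞}) := fun h => h hn
          simp only [indicator_of_notMem this]
          exact aemeasurable_const
        · have : n ∈ {n | w.1.eventTime (n + 1) ≠ ∞} := hn
          simp only [indicator_of_mem this]
          -- The stopping length is known to be measurable only through its rational version, which
          -- agrees with it for `α` in `(0, 1)`.
          have hLm : Measurable (fun α => stopLengthM D Dr valid (w, α)) :=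
            (measurable_stopLengthM D Dr hmeas).comp measurable_prodMk_left
          have hm1 : Measurable (fun α => F n (α * stopLengthM D Dr valid (w, α))) :=
            (hFm n).comp (measurable_id.mul hLm)
          have hm2 : MeasurableSet {α | (1 - α) * stopLengthM D Dr valid (w, α) = e n} :=
            measurableSet_eq_fun ((measurable_const.sub measurable_id).mul hLm) measurable_const
          refine (hm1.indicator hm2).aemeasurable.congr ?_
          refine (ae_restrict_iff' measurableSet_Ioo).2 (ae_of_all _ fun α hα => ?_)
          simp only [indicator, mem_ofPred_eq, stopLengthM_eq hw hα.1 hα.2, hlen]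
    _ = ∑' n, ∫⁻ u in Ioo 0 (M + 1), {n | w.1.eventTime (n + 1) ≠ ∞}.indicator (fun n =>
          ENNReal.ofReal (e n / (u + e n) ^ 2) * {u | HitsAt V u (e n)}.indicator (F n) u) n := by
        refine tsum_congr fun n => ?_
        by_cases hn : w.1.eventTime (n + 1) = ∞
        · have : ¬ (n ∈ {n | w.1.eventTime (n + 1) ≠ ∞}) := fun h => h hn
          simp only [indicator_of_notMem this, lintegral_zero]
        · have : n ∈ {n | w.1.eventTime (n + 1) ≠ ∞} := hn
          simp only [indicator_of_mem this]
          have hen : 0 < e n := hw.1.eventTime_pos hn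
          rw [hw.2.2.lintegral_stopLength_forward w.countable_times hen (F n)]
          -- For `u ≥ M + 1` the path on `[-u, e]` is longer than `M`, and `f` vanishes.
          refine setLIntegral_eq_of_forall_notMem measurableSet_Ioo measurableSet_Ioi
            Ioo_subset_Ioi_self fun u hu0 hu => ?_
          have hu1 : M + 1 ≤ u := by
            by_contra! hcon
            exact hu ⟨hu0, hcon⟩
          have : F n u = 0 := hf0 _ _ (by simp only [segment]; linarith)
          simp [indicator, this]
    _ = ∫⁻ u in Ioo 0 (M + 1), ∑' n, {n | w.1.eventTime (n + 1) ≠ ∞}.indicator (fun n =>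
          ENNReal.ofReal (e n / (u + e n) ^ 2) * {u | HitsAt V u (e n)}.indicator (F n) u) n := by
        refine (lintegral_tsum fun n => Measurable.aemeasurable ?_).symm
        by_cases hn : w.1.eventTime (n + 1) = ∞
        · have : ¬ (n ∈ {n | w.1.eventTime (n + 1) ≠ ∞}) := fun h => h hn
          simp only [indicator_of_notMem this]
          exact measurable_const
        · have : n ∈ {n | w.1.eventTime (n + 1) ≠ ∞} := hn
          simp only [indicator_of_mem this]
          exact Measurable.mul (by fun_prop) ((hFm n).indicator (hHm n))
    _ = _ := by
        refine setLIntegral_congr_fun measurableSet_Ioo fun u hu => ?_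
        exact (lintegral_weight_forwardCut hmeas hw.1 hw.2.1 hu.1 hf hf0).symm

end FullPath

/-! ### Backward hits: the stopped path is the final part of a window. -/

namespace PathSegment

variable {E : Type*} [MeasurableSpace E]

/-- The path segment which starts from the state `z` at time `t`, and has the events of the path
segment `x` in `[t, T]`. -/
def final (T : ℝ) (x : PathSegment E) (t : ℝ) (z : E) : PathSegment E :=
  (T - t, z, x.eventsIn t T)

theorem measurable_final (T : ℝ) {X : Type*} [MeasurableSpace X] {f : X → PathSegment E} {t : X → ℝ}
    {g : X → E} (hf : Measurable f) (ht : Measurable t) (hg : Measurable g) :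
    Measurable (fun q => final T (f q) (t q) (g q)) :=
  (measurable_const.sub ht).prodMk (hg.prodMk (measurable_eventsIn hf ht measurable_const))

end PathSegment

/-- The stopped path starts at the given event of the window, and ends with the window, at time
`T`. -/
def backwardCut {E : Type*} [MeasurableSpace E] (D : PDMP E) {valid : Set (PathSegment E)}
    (hmeas : MeasurableSet valid) (T : ℝ) : WindowCut E where
  len p := T - p.1
  cut q := PathSegment.final T q.1 q.2.1 q.2.2.2
  hit := {q | ∀ᶠ n : ℕ in atTop,
    PathSegment.final T q.1 (q.2.1 + 1 / (n + 1)) (D.flow (1 / (n + 1)) q.2.2.2) ∈ valid ∧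
    PathSegment.final T q.1 (q.2.1 - 1 / (n + 1)) (D.flow (-(1 / (n + 1))) q.2.2.1) ∉ valid}
  off u t := t - u
  measurable_len := measurable_const.sub measurable_fst
  measurable_cut := PathSegment.measurable_final T measurable_fst (by fun_prop) (by fun_prop)
  measurableSet_hit := by
    refine measurableSet_eventually_nat fun n => MeasurableSet.inter ?_ (MeasurableSet.compl ?_)
    · exact PathSegment.measurable_final T
        (t := fun q : PathSegment E × (ℝ × E × E) => q.2.1 + 1 / (n + 1))
        measurable_fst (by fun_prop)
        (D.measurable_flow_comp measurable_const (g := fun q => q.2.2.2) (by fun_prop)) hmeas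
    · exact PathSegment.measurable_final T
        (t := fun q : PathSegment E × (ℝ × E × E) => q.2.1 - 1 / (n + 1))
        measurable_fst (by fun_prop)
        (D.measurable_flow_comp measurable_const (g := fun q => q.2.2.1) (by fun_prop)) hmeas
  measurable_off := measurable_snd.sub measurable_fst
  cut_fst _ _ := rfl

namespace FullPath

variable {E : Type*} [MeasurableSpace E] {D Dr : PDMP E} {valid : Set (PathSegment E)}

/-- In forward time the state after an event of the backward path is its pre-jump state; it flows
freely until the next event in forward time. A final part of a window needs its own initial state,
and the event supplies it. -/
theorem state_neg_event_sub (hflow : ∀ t z, Dr.flow t z = D.flow (-t) z) {w : FullPath E}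
    {n : ℕ} (hn : w.2.eventTime (n + 1) ≠ ∞) {δ : ℝ} (h0 : 0 ≤ δ)
    (hδ : δ < (w.2 (n + 1)).1.toReal) :
    state D Dr w (-((w.2.eventTime (n + 1)).toReal - δ)) = D.flow δ (Dr.event w.2 n).2.1 := by
  have hsucc := w.2.eventTime_succ n
  have hne : w.2.eventTime n ≠ ∞ ∧ (w.2 (n + 1)).1 ≠ ∞ := by
    rw [hsucc] at hn
    exact ENNReal.add_ne_top.1 hn
  have hreal : (w.2.eventTime (n + 1)).toReal
      = (w.2.eventTime n).toReal + (w.2 (n + 1)).1.toReal := by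
    rw [hsucc, ENNReal.toReal_add hne.1 hne.2]
  have hnn : 0 ≤ (w.2.eventTime n).toReal := ENNReal.toReal_nonneg
  rw [state, if_neg (by linarith), neg_neg, Dr.stateBefore_eq (n := n), hflow]
  · simp only [PDMP.event]
    rw [hflow, ← D.flow_add]
    congr 1
    linarith
  · rw [ENNReal.lt_ofReal_iff_toReal_lt hne.1]
    linarith
  · rw [ENNReal.ofReal_le_iff_le_toReal hn]
    linarith

/-- Just before the event in forward time, the state comes from the post-jump state of the backward
path. The next gap may be infinite, hence the comparison in `ℝ≥0∞`. -/
theorem state_neg_event_add (hflow : ∀ t z, Dr.flow t z = D.flow (-t) z) {w : FullPath E}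
    {n : ℕ} (hn : w.2.eventTime (n + 1) ≠ ∞) {δ : ℝ} (h0 : 0 < δ)
    (hδ : ENNReal.ofReal δ < (w.2 (n + 2)).1) :
    state D Dr w (-((w.2.eventTime (n + 1)).toReal + δ)) = D.flow (-δ) (w.2 (n + 1)).2 := by
  have hnn : 0 ≤ (w.2.eventTime (n + 1)).toReal := ENNReal.toReal_nonneg
  rw [state, if_neg (by linarith), neg_neg, Dr.stateBefore_eq (n := n + 1), hflow]
  · congr 1
    ring
  · rw [ENNReal.lt_ofReal_iff_toReal_lt hn]
    linarith
  · rw [w.2.eventTime_succ (n + 1), ENNReal.ofReal_add hnn h0.le, ENNReal.ofReal_toReal hn]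
    gcongr

theorem final_segment (D Dr : PDMP E) {w : FullPath E} (h1 : w.1.Regular) (h2 : w.2.Regular)
    {T v t : ℝ} (ht : 0 ≤ t) {z : E}
    (hz : state D Dr w (t - (T - v)) = z) :
    PathSegment.final T (segment D Dr w (-(T - v)) v) t z = segment D Dr w (t - (T - v)) v := by
  have h3 := eventsIn_segment D Dr h1 h2 (a := -(T - v)) (b := v) (c := t - (T - v)) (d := v)
    (by linarith) le_rfl
  have e1 : t - (T - v) - -(T - v) = t := by ring
  have e2 : v - -(T - v) = T := by ring
  have e3 : v - (t - (T - v)) = T - t := by ring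
  rw [e1, e2] at h3
  rw [PathSegment.final, h3, ← hz]
  simp only [segment, e3]

/-- The mirror image of `weight_forwardCut`: the window ends at `v`, the event at `-s` is at
distance `v + s` from its end, and the offset is `(v + s) - v = s`. -/
theorem weight_backwardCut (hflow : ∀ t z, Dr.flow t z = D.flow (-t) z)
    (hmeas : MeasurableSet valid) {w : FullPath E} (h1 : w.1.Regular)
    (h2 : w.2.Regular) {M v : ℝ} (hv : 0 < v) {n : ℕ} (hn : w.2.eventTime (n + 1) ≠ ∞)
    {f : PathSegment E × ℝ → ℝ≥0∞} (hf0 : ∀ x l, M < x.1 → f (x, l) = 0) :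
    (Icc (-(M + 1 - v)) v ×ˢ univ).indicator (fun p : ℝ × E × E =>
      (backwardCut D hmeas (M + 1)).weight M f
        ((v, segment D Dr w (-(M + 1 - v)) v), (p.1 - -(M + 1 - v), p.2)))
          (-(Dr.event w.2 n).1, (Dr.event w.2 n).2.2, (Dr.event w.2 n).2.1)
      = ENNReal.ofReal ((w.2.eventTime (n + 1)).toReal / (v + (w.2.eventTime (n + 1)).toReal) ^ 2) *
        {v | HitsAt (fun a b => segment D Dr w (-b) (-a) ∈ valid) v
          (w.2.eventTime (n + 1)).toReal}.indicator
          (fun v => f (segment D Dr w (-(w.2.eventTime (n + 1)).toReal) v,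
            (w.2.eventTime (n + 1)).toReal)) v := by
  have hs : 0 < (w.2.eventTime (n + 1)).toReal := h2.eventTime_pos hn
  have hS : 0 < (w.2 (n + 1)).1.toReal := by
    refine ENNReal.toReal_pos (h2.1 n).ne' fun h => hn ?_
    rw [w.2.eventTime_succ, h, add_top]
  have hsub := fun δ => state_neg_event_sub (δ := δ) hflow hn
  have hadd := fun δ => state_neg_event_add (δ := δ) hflow hn
  change (Icc (-(M + 1 - v)) v ×ˢ univ).indicator (fun p : ℝ × E × E =>
      (backwardCut D hmeas (M + 1)).weight M f
        ((v, segment D Dr w (-(M + 1 - v)) v), (p.1 - -(M + 1 - v), p.2)))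
          (-(w.2.eventTime (n + 1)).toReal, (w.2 (n + 1)).2, (Dr.event w.2 n).2.1) = _
  set s := (w.2.eventTime (n + 1)).toReal with hsdef
  set z := (Dr.event w.2 n).2.1 with hz
  by_cases hM : v + s ≤ M
  · have hmem : ((-s, (w.2 (n + 1)).2, z) : ℝ × E × E)
        ∈ Icc (-(M + 1 - v)) v ×ˢ (univ : Set (E × E)) :=
      ⟨⟨by simp only; linarith, by simp only; linarith⟩, trivial⟩
    rw [indicator_of_mem hmem]
    have hfin : ∀ δ z', -1 ≤ δ → state D Dr w (-(s - δ)) = z' →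
        PathSegment.final (M + 1) (segment D Dr w (-(M + 1 - v)) v) (-s - -(M + 1 - v) + δ) z'
          = segment D Dr w (-(s - δ)) v := by
      intro δ z' hδ hstate
      have e1 : -s - -(M + 1 - v) + δ - (M + 1 - v) = -(s - δ) := by ring
      rw [final_segment D Dr h1 h2 (by linarith) (by rw [e1, hstate]), e1]
    have hiff : ((segment D Dr w (-(M + 1 - v)) v,
        ((-s - -(M + 1 - v), (w.2 (n + 1)).2, z) : ℝ × E × E)) ∈
        (backwardCut D hmeas (M + 1)).hit) ↔
          HitsAt (fun a b => segment D Dr w (-b) (-a) ∈ valid) v s := by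
      -- The flow formulas for the states hold only within the gaps on either side of the event, so
      -- the hit conditions are matched for large `k` only.
      have hlim : ∀ᶠ k : ℕ in atTop, (1 : ℝ) / (k + 1) < min s (w.2 (n + 1)).1.toReal :=
        tendsto_one_div_add_atTop_nhds_zero_nat.eventually (gt_mem_nhds (lt_min hs hS))
      have hlim' : ∀ᶠ k : ℕ in atTop, ENNReal.ofReal ((1 : ℝ) / (k + 1)) < (w.2 (n + 2)).1 := by
        have := (ENNReal.continuous_ofReal.tendsto 0).comp
          tendsto_one_div_add_atTop_nhds_zero_nat
        rw [ENNReal.ofReal_zero] at this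
        exact this.eventually (gt_mem_nhds (h2.1 (n + 1)))
      refine eventually_congr ?_
      filter_upwards [hlim, hlim'] with k hk hk'
      obtain ⟨hk1, hk2⟩ := lt_min_iff.1 hk
      have hn0 : (0 : ℝ) < 1 / (k + 1) := by positivity
      have hn1 : (1 : ℝ) / (k + 1) ≤ 1 := by
        rw [div_le_one (by positivity)]; linarith [(Nat.cast_nonneg k : (0 : ℝ) ≤ k)]
      have f1 := hfin _ _ (by linarith) (hsub _ hn0.le hk2)
      have f2 := hfin (-(1 / (k + 1))) (D.flow (-(1 / (k + 1))) (w.2 (n + 1)).2) (by linarith)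
        (by rw [sub_neg_eq_add]; exact hadd _ hn0 hk')
      rw [← sub_eq_add_neg, sub_neg_eq_add s] at f2
      simp only [f1, f2, neg_neg]
    by_cases hh : HitsAt (fun a b => segment D Dr w (-b) (-a) ∈ valid) v s
    · rw [indicator_of_mem (by exact hh), WindowCut.weight, indicator_of_mem
        (by exact ⟨by simp only [backwardCut]; linarith, by simp only [backwardCut]; linarith,
          hiff.2 hh⟩)]
      have f0 := hfin 0 z (by linarith) (by
        rw [hsub 0 le_rfl hS, D.flow_zero])
      rw [add_zero, sub_zero] at f0
      have e1 : M + 1 - (-s - -(M + 1 - v)) = v + s := by ring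
      have e2 : v + s - v = s := by ring
      simp only [backwardCut, f0, e1, e2]
    · rw [indicator_of_notMem (by exact hh), WindowCut.weight, indicator_of_notMem
        (by exact fun h => hh (hiff.1 h.2.2)), mul_zero]
  · have hz : f (segment D Dr w (-s) v, s) = 0 := hf0 _ _ (by simp only [segment]; linarith)
    have : {v | HitsAt (fun a b => segment D Dr w (-b) (-a) ∈ valid) v s}.indicator
          (fun v => f (segment D Dr w (-s) v, s)) v = 0 := by
      simp [indicator, hz]
    rw [this, mul_zero]
    refine indicator_apply_eq_zero.2 fun _ => ?_
    rw [WindowCut.weight, indicator_of_notMem]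
    rintro ⟨-, h, -⟩
    simp only [backwardCut] at h
    exact hM (by linarith)

theorem lintegral_weight_backwardCut (hflow : ∀ t z, Dr.flow t z = D.flow (-t) z)
    (hmeas : MeasurableSet valid) {w : FullPath E}
    (h1 : w.1.Regular) (h2 : w.2.Regular) {M v : ℝ} (hv : 0 < v)
    {f : PathSegment E × ℝ → ℝ≥0∞} (hf : Measurable f) (hf0 : ∀ x l, M < x.1 → f (x, l) = 0) :
    ∫⁻ p, (backwardCut D hmeas (M + 1)).weight M f ((v, segment D Dr w (-(M + 1 - v)) v), p)
        ∂(PathSegment.eventKernel (segment D Dr w (-(M + 1 - v)) v))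
      = ∑' n, {n | w.2.eventTime (n + 1) ≠ ∞}.indicator (fun n =>
          ENNReal.ofReal ((w.2.eventTime (n + 1)).toReal
            / (v + (w.2.eventTime (n + 1)).toReal) ^ 2) *
          {v | HitsAt (fun a b => segment D Dr w (-b) (-a) ∈ valid) v
            (w.2.eventTime (n + 1)).toReal}.indicator
          (fun v => f (segment D Dr w (-(w.2.eventTime (n + 1)).toReal) v,
            (w.2.eventTime (n + 1)).toReal)) v) n := by
  have hg : Measurable (fun p => (backwardCut D hmeas (M + 1)).weight M f
      ((v, segment D Dr w (-(M + 1 - v)) v), p)) :=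
    ((backwardCut D hmeas (M + 1)).measurable_weight M hf).comp measurable_prodMk_left
  have hg' : Measurable (fun p : ℝ × E × E => (backwardCut D hmeas (M + 1)).weight M f
      ((v, segment D Dr w (-(M + 1 - v)) v), (p.1 - -(M + 1 - v), p.2))) := by
    have : Measurable (fun p : ℝ × E × E => (p.1 - -(M + 1 - v), p.2)) := by fun_prop
    exact hg.comp this
  have hgi := hg'.indicator (measurableSet_Icc.prod MeasurableSet.univ :
    MeasurableSet (Icc (-(M + 1 - v)) v ×ˢ (univ : Set (E × E))))
  have hgr : Measurable (fun p : ℝ × E × E => (Icc (-(M + 1 - v)) v ×ˢ univ).indicator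
      (fun p : ℝ × E × E => (backwardCut D hmeas (M + 1)).weight M f
      ((v, segment D Dr w (-(M + 1 - v)) v), (p.1 - -(M + 1 - v), p.2)))
        (-p.1, p.2.2, p.2.1)) := by
    have : Measurable (fun p : ℝ × E × E => (-p.1, p.2.2, p.2.1)) := by fun_prop
    exact hgi.comp this
  rw [lintegral_eventKernel_segment D Dr h1 h2 _ _ hg, lintegral_events D Dr w hgi,
    D.lintegral_events w.1 hgi, Dr.lintegral_events w.2 hgr]
  have hzero : ∑' n, {y : Skeleton E | y.eventTime (n + 1) ≠ ∞}.indicator (fun y =>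
      (Icc (-(M + 1 - v)) v ×ˢ univ).indicator (fun p : ℝ × E × E =>
        (backwardCut D hmeas (M + 1)).weight M f
          ((v, segment D Dr w (-(M + 1 - v)) v), (p.1 - -(M + 1 - v), p.2)))
            (D.event y n)) w.1 = 0 := by
    rw [ENNReal.tsum_eq_zero]
    intro n
    refine indicator_apply_eq_zero.2 fun _ => indicator_apply_eq_zero.2 fun _ => ?_
    rw [WindowCut.weight, indicator_of_notMem]
    rintro ⟨h, -, -⟩
    have h0 : 0 ≤ (D.event w.1 n).1 := ENNReal.toReal_nonneg
    simp only [backwardCut] at h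
    linarith
  rw [hzero, zero_add]
  refine tsum_congr fun n => ?_
  by_cases hn : w.2.eventTime (n + 1) = ∞
  · rw [indicator_of_notMem (by simpa using hn), indicator_of_notMem (by simpa using hn)]
  · have m1 : n ∈ {n | w.2.eventTime (n + 1) ≠ ∞} := hn
    have m2 : w.2 ∈ {y : Skeleton E | y.eventTime (n + 1) ≠ ∞} := hn
    rw [indicator_of_mem m1, indicator_of_mem m2]
    exact weight_backwardCut hflow hmeas h1 h2 hv hn hf0

/-- The contribution of the paths stopped at an event before time `0`. -/
theorem lintegral_backward (hflow : ∀ t z, Dr.flow t z = D.flow (-t) z)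
    (hmeas : MeasurableSet valid) {w : FullPath E}
    (hw : Good D Dr valid w) {M : ℝ} {f : PathSegment E × ℝ → ℝ≥0∞} (hf : Measurable f)
    (hf0 : ∀ x l, M < x.1 → f (x, l) = 0) :
    ∫⁻ α in Ioo 0 1, w.2.eventTimes.indicator
        (fun _ => f (NoUTurn.path D Dr valid w α, NoUTurn.offset D Dr valid w α))
        (NoUTurn.offset D Dr valid w α)
      = ∫⁻ v in Ioo 0 (M + 1),
          (∫⁻ p, (backwardCut D hmeas (M + 1)).weight M f
              ((v, segment D Dr w (-(M + 1 - v)) v), p)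
            ∂(PathSegment.eventKernel (segment D Dr w (-(M + 1 - v)) v))) := by
  set V : ℝ → ℝ → Prop := fun a b => segment D Dr w a b ∈ valid with hV
  set e : ℕ → ℝ := fun n => (w.2.eventTime (n + 1)).toReal with he
  set F : ℕ → ℝ → ℝ≥0∞ := fun n v => f (segment D Dr w (-(e n)) v, e n) with hF
  have hFm : ∀ n, Measurable (F n) := fun n => by
    have : Measurable (fun v => segment D Dr w (-(e n)) v) :=
      measurable_segment_comp D Dr measurable_const measurable_const measurable_id
    exact hf.comp (this.prodMk measurable_const)
  have hHm : ∀ n, MeasurableSet {v | HitsAt (fun a b => V (-b) (-a)) v (e n)} := fun n => by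
    refine measurableSet_eventually_nat fun k => MeasurableSet.inter ?_ (MeasurableSet.compl ?_)
    · exact measurable_segment_comp D Dr measurable_const measurable_const
        (measurable_neg.comp measurable_neg) hmeas
    · exact measurable_segment_comp D Dr measurable_const measurable_const
        (measurable_neg.comp measurable_neg) hmeas
  have hlen : ∀ α, NoUTurn.length D Dr valid w α = stopLength V α := fun α => rfl
  calc _ = ∫⁻ α in Ioo 0 1, ∑' n, {n | w.2.eventTime (n + 1) ≠ ∞}.indicator (fun n =>
        {α | α * stopLength V α = e n}.indicator
          (fun α => F n ((1 - α) * stopLength V α)) α) n := by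
        refine lintegral_congr fun α => ?_
        rw [hw.2.1.indicator_eventTimes]
        refine tsum_congr fun n => ?_
        by_cases hn : w.2.eventTime (n + 1) ≠ ∞ ∧
          NoUTurn.offset D Dr valid w α = (w.2.eventTime (n + 1)).toReal
        · rw [indicator_of_mem (by exact hn), indicator_of_mem (by exact hn.1),
            indicator_of_mem (by exact hn.2)]
          simp only [hF, he, ← hn.2]
          rfl
        · rw [indicator_of_notMem (by exact hn)]
          symm
          refine indicator_apply_eq_zero.2 fun h1 => indicator_apply_eq_zero.2 fun h2 => ?_
          exact absurd ⟨h1, h2⟩ hn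
    _ = ∑' n, ∫⁻ α in Ioo 0 1, {n | w.2.eventTime (n + 1) ≠ ∞}.indicator (fun n =>
        {α | α * stopLength V α = e n}.indicator
          (fun α => F n ((1 - α) * stopLength V α)) α) n := by
        refine lintegral_tsum fun n => ?_
        by_cases hn : w.2.eventTime (n + 1) = ∞
        · have : ¬ (n ∈ {n | w.2.eventTime (n + 1) ≠ ∞}) := fun h => h hn
          simp only [indicator_of_notMem this]
          exact aemeasurable_const
        · have : n ∈ {n | w.2.eventTime (n + 1) ≠ ∞} := hn
          simp only [indicator_of_mem this]
          have hLm : Measurable (fun α => stopLengthM D Dr valid (w, α)) :=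
            (measurable_stopLengthM D Dr hmeas).comp measurable_prodMk_left
          have hm1 : Measurable (fun α => F n ((1 - α) * stopLengthM D Dr valid (w, α))) :=
            (hFm n).comp ((measurable_const.sub measurable_id).mul hLm)
          have hm2 : MeasurableSet {α | α * stopLengthM D Dr valid (w, α) = e n} :=
            measurableSet_eq_fun (measurable_id.mul hLm) measurable_const
          refine (hm1.indicator hm2).aemeasurable.congr ?_
          refine (ae_restrict_iff' measurableSet_Ioo).2 (ae_of_all _ fun α hα => ?_)
          simp only [indicator, mem_ofPred_eq, stopLengthM_eq hw hα.1 hα.2, hlen]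
    _ = ∑' n, ∫⁻ v in Ioo 0 (M + 1), {n | w.2.eventTime (n + 1) ≠ ∞}.indicator (fun n =>
          ENNReal.ofReal (e n / (v + e n) ^ 2) *
            {v | HitsAt (fun a b => V (-b) (-a)) v (e n)}.indicator (F n) v) n := by
        refine tsum_congr fun n => ?_
        by_cases hn : w.2.eventTime (n + 1) = ∞
        · have : ¬ (n ∈ {n | w.2.eventTime (n + 1) ≠ ∞}) := fun h => h hn
          simp only [indicator_of_notMem this, lintegral_zero]
        · have : n ∈ {n | w.2.eventTime (n + 1) ≠ ∞} := hn
          simp only [indicator_of_mem this]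
          have hen : 0 < e n := hw.2.1.eventTime_pos hn
          rw [hw.2.2.lintegral_stopLength_backward w.countable_times hen (F n)]
          -- For `v ≥ M + 1` the path on `[-s, v]` is longer than `M`, and `f` vanishes.
          refine setLIntegral_eq_of_forall_notMem measurableSet_Ioo measurableSet_Ioi
            Ioo_subset_Ioi_self fun v hv0 hv => ?_
          have hv1 : M + 1 ≤ v := by
            by_contra! hcon
            exact hv ⟨hv0, hcon⟩
          have : F n v = 0 := hf0 _ _ (by simp only [segment]; linarith)
          simp [indicator, this]
    _ = ∫⁻ v in Ioo 0 (M + 1), ∑' n, {n | w.2.eventTime (n + 1) ≠ ∞}.indicator (fun n =>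
          ENNReal.ofReal (e n / (v + e n) ^ 2) *
            {v | HitsAt (fun a b => V (-b) (-a)) v (e n)}.indicator (F n) v) n := by
        refine (lintegral_tsum fun n => Measurable.aemeasurable ?_).symm
        by_cases hn : w.2.eventTime (n + 1) = ∞
        · have : ¬ (n ∈ {n | w.2.eventTime (n + 1) ≠ ∞}) := fun h => h hn
          simp only [indicator_of_notMem this]
          exact measurable_const
        · have : n ∈ {n | w.2.eventTime (n + 1) ≠ ∞} := hn
          simp only [indicator_of_mem this]
          exact Measurable.mul (by fun_prop) ((hFm n).indicator (hHm n))
    _ = _ := by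
        refine setLIntegral_congr_fun measurableSet_Ioo fun v hv => ?_
        exact (lintegral_weight_backwardCut hflow hmeas hw.1 hw.2.1 hv.1 hf hf0).symm

end FullPath

/-! ### Resampling the offset in expectation. -/

namespace NoUTurn

theorem forwardLaw_univ_le (T : ℝ) : forwardLaw T univ ≤ 1 := by
  rcases lt_or_ge 0 T with hT | hT
  · have := isProbabilityMeasure_forwardLaw hT
    exact prob_le_one
  · rw [← lintegral_one, lintegral_forwardLaw T measurable_const, Ioo_eq_empty (not_lt.2 hT)]
    simp

theorem backwardLaw_univ_le (T : ℝ) : backwardLaw T univ ≤ 1 := by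
  rcases lt_or_ge 0 T with hT | hT
  · have := isProbabilityMeasure_backwardLaw hT
    exact prob_le_one
  · rw [← lintegral_one, lintegral_backwardLaw T measurable_const, Ioo_eq_empty (not_lt.2 hT)]
    simp

variable {E : Type*} [MeasurableSpace E]

/-- The law `forwardLaw T`, as a function of a path of length `T`. -/
def forwardKernel : Kernel (PathSegment E) ℝ :=
  ⟨fun x => forwardLaw x.1, measurable_forwardLaw.comp measurable_fst⟩

/-- The law `backwardLaw T`, as a function of a path of length `T`. -/
def backwardKernel : Kernel (PathSegment E) ℝ :=
  ⟨fun x => backwardLaw x.1, measurable_backwardLaw.comp measurable_fst⟩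

instance : IsFiniteKernel (forwardKernel (E := E)) :=
  ⟨⟨1, ENNReal.one_lt_top, fun x => forwardLaw_univ_le x.1⟩⟩

instance : IsFiniteKernel (backwardKernel (E := E)) :=
  ⟨⟨1, ENNReal.one_lt_top, fun x => backwardLaw_univ_le x.1⟩⟩

end NoUTurn

theorem measurable_lintegral_fst {X Y : Type*} [MeasurableSpace X] [MeasurableSpace Y]
    (κ : Kernel X Y) [IsSFiniteKernel κ] {f : X × Y → ℝ≥0∞} (hf : Measurable f) :
    Measurable (fun q : X × Y => ∫⁻ l, f (q.1, l) ∂(κ q.1)) :=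
  (Measurable.lintegral_kernel_prod_right' (κ := κ) hf).comp measurable_fst

namespace FullPath

variable {E : Type*} [MeasurableSpace E] {D Dr : PDMP E} {valid : Set (PathSegment E)}
  {π : Measure E} [IsProbabilityMeasure π]

/-- Stationarity replaces the moving window by one that does not depend on `u`; there the resampling
identity holds path by path, and stationarity is then undone. -/
theorem lintegral_resample (hD : D.NonExplosive π) (hDr : Dr.NonExplosive π)
    (hrev : D.IsTimeReversal Dr π) (C : WindowCut E) {M : ℝ}
    {r : ℝ → ℝ} (hr : Measurable r) (hr0 : ∀ u ∈ Ioo 0 (M + 1), r u ∈ Ioo 0 (M + 1))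
    {ρ : ℝ → Measure ℝ} (hρ1 : ∀ T, 0 < T → IsProbabilityMeasure (ρ T))
    (hρ : ∀ T (f : ℝ → ℝ≥0∞), Measurable f →
      ∫⁻ u in Ioo 0 T, ENNReal.ofReal ((T - u) / T ^ 2) * f (C.off u T)
        = 2⁻¹ * ∫⁻ l, f l ∂(ρ T))
    {f : PathSegment E × ℝ → ℝ≥0∞} (hf : Measurable f)
    (hf' : Measurable (fun q : PathSegment E × ℝ => ∫⁻ l, f (q.1, l) ∂(ρ q.1.1))) :
    ∫⁻ w, (∫⁻ u in Ioo 0 (M + 1), (∫⁻ p, C.weight M f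
        ((u, segment D Dr w (-r u) (M + 1 - r u)), p)
          ∂(PathSegment.eventKernel (segment D Dr w (-r u) (M + 1 - r u))))) ∂(law D Dr π)
      = ∫⁻ w, (∫⁻ u in Ioo 0 (M + 1), (∫⁻ p, C.weight M (fun q => ∫⁻ l, f (q.1, l) ∂(ρ q.1.1))
        ((u, segment D Dr w (-r u) (M + 1 - r u)), p)
          ∂(PathSegment.eventKernel (segment D Dr w (-r u) (M + 1 - r u))))) ∂(law D Dr π) := by
  have hH : ∀ {f : PathSegment E × ℝ → ℝ≥0∞}, Measurable f →
      Measurable (fun q : ℝ × PathSegment E =>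
        ∫⁻ p, C.weight M f (q, p) ∂(PathSegment.eventKernel q.2)) := fun {f} hf =>
    PathSegment.measurable_lintegral_eventKernel (C.measurable_weight M hf) measurable_snd
  have h1 := lintegral_window hD hDr hrev (M + 1) hr hr0 (hH hf)
  have h2 := lintegral_window hD hDr hrev (M + 1) hr hr0 (hH hf')
  refine h1.trans (Eq.trans ?_ h2.symm)
  exact lintegral_congr fun y => C.lintegral_weight_resample (by linarith) hρ1 hρ hf hf' _

theorem lintegral_forward_resample (hD : D.NonExplosive π) (hDr : Dr.NonExplosive π)
    (hrev : D.IsTimeReversal Dr π) (hmeas : MeasurableSet valid)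
    (hgood : ∀ᵐ w ∂(law D Dr π), Good D Dr valid w) {M : ℝ}
    {f : PathSegment E × ℝ → ℝ≥0∞} (hf : Measurable f) (hf0 : ∀ x l, M < x.1 → f (x, l) = 0) :
    ∫⁻ w, (∫⁻ α in Ioo 0 1, w.1.eventTimes.indicator
        (fun _ => f (NoUTurn.path D Dr valid w α, NoUTurn.offset D Dr valid w α))
        (NoUTurn.right D Dr valid w α)) ∂(law D Dr π)
      = ∫⁻ w, (∫⁻ α in Ioo 0 1, w.1.eventTimes.indicator
        (fun _ => ∫⁻ l, f (NoUTurn.path D Dr valid w α, l)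
          ∂(NoUTurn.forwardKernel (NoUTurn.path D Dr valid w α)))
        (NoUTurn.right D Dr valid w α)) ∂(law D Dr π) := by
  have hf' := measurable_lintegral_fst NoUTurn.forwardKernel hf
  have hf0' : ∀ (x : PathSegment E) (l : ℝ), M < x.1 →
      ∫⁻ l, f ((x, l).1, l) ∂(NoUTurn.forwardKernel (x, l).1) = 0 := fun x l hx => by
    simp [hf0 x _ hx]
  refine (lintegral_congr_ae (hgood.mono fun w hw => lintegral_forward hmeas hw hf hf0)).trans
    (Eq.trans ?_ (lintegral_congr_ae
      (hgood.mono fun w hw => lintegral_forward hmeas hw hf' hf0')).symm)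
  exact lintegral_resample hD hDr hrev (forwardCut hmeas) (r := fun u => u) measurable_id
    (fun u hu => hu) (fun T hT => NoUTurn.isProbabilityMeasure_forwardLaw hT)
    (fun T g hg => NoUTurn.lintegral_forwardLaw_half T hg) hf hf'

theorem lintegral_backward_resample (hD : D.NonExplosive π) (hDr : Dr.NonExplosive π)
    (hrev : D.IsTimeReversal Dr π) (hmeas : MeasurableSet valid)
    (hgood : ∀ᵐ w ∂(law D Dr π), Good D Dr valid w) {M : ℝ}
    {f : PathSegment E × ℝ → ℝ≥0∞} (hf : Measurable f) (hf0 : ∀ x l, M < x.1 → f (x, l) = 0) :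
    ∫⁻ w, (∫⁻ α in Ioo 0 1, w.2.eventTimes.indicator
        (fun _ => f (NoUTurn.path D Dr valid w α, NoUTurn.offset D Dr valid w α))
        (NoUTurn.offset D Dr valid w α)) ∂(law D Dr π)
      = ∫⁻ w, (∫⁻ α in Ioo 0 1, w.2.eventTimes.indicator
        (fun _ => ∫⁻ l, f (NoUTurn.path D Dr valid w α, l)
          ∂(NoUTurn.backwardKernel (NoUTurn.path D Dr valid w α)))
        (NoUTurn.offset D Dr valid w α)) ∂(law D Dr π) := by
  have hf' := measurable_lintegral_fst NoUTurn.backwardKernel hf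
  have hf0' : ∀ (x : PathSegment E) (l : ℝ), M < x.1 →
      ∫⁻ l, f ((x, l).1, l) ∂(NoUTurn.backwardKernel (x, l).1) = 0 := fun x l hx => by
    simp [hf0 x _ hx]
  refine (lintegral_congr_ae
    (hgood.mono fun w hw => lintegral_backward hrev.1 hmeas hw hf hf0)).trans
    (Eq.trans ?_ (lintegral_congr_ae
      (hgood.mono fun w hw => lintegral_backward hrev.1 hmeas hw hf' hf0')).symm)
  -- Here the integration variable is the distance from the start to the right end of the window, so
  -- the window begins at minus `r u = M + 1 - u`.
  have := lintegral_resample hD hDr hrev (backwardCut D hmeas (M + 1)) (M := M)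
    (r := fun u => M + 1 - u) (by fun_prop)
    (fun u hu => ⟨by linarith [hu.2], by linarith [hu.1]⟩)
    (fun T hT => NoUTurn.isProbabilityMeasure_backwardLaw hT)
    (fun T g hg => NoUTurn.lintegral_backwardLaw_half T hg) hf hf'
  simp only [sub_sub_cancel] at this
  exact this

end FullPath

/-! ### The direction of the hit, read off the stopped path. -/

namespace FullPath

variable {E : Type*}

theorem mem_times_of_pos {w : FullPath E} {t : ℝ} (ht : 0 < t) :
    t ∈ w.times ↔ t ∈ w.1.eventTimes := by
  refine ⟨?_, fun h => Or.inl h⟩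
  rintro (h | ⟨n, -, rfl⟩)
  · exact h
  · have : 0 ≤ (w.2.eventTime (n + 1)).toReal := ENNReal.toReal_nonneg
    linarith

theorem neg_mem_times_of_pos {w : FullPath E} {t : ℝ} (ht : 0 < t) :
    -t ∈ w.times ↔ t ∈ w.2.eventTimes := by
  refine ⟨?_, fun ⟨n, hn, h⟩ => Or.inr ⟨n, hn, by rw [h]⟩⟩
  rintro (⟨n, -, h⟩ | ⟨n, hn, h⟩)
  · have : 0 ≤ (w.1.eventTime (n + 1)).toReal := ENNReal.toReal_nonneg
    linarith
  · exact ⟨n, hn, neg_injective h⟩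

end FullPath

theorem Skeleton.Regular.pos_of_mem_eventTimes {E : Type*} {y : Skeleton E} (hy : y.Regular)
    {t : ℝ} (ht : t ∈ y.eventTimes) : 0 < t := by
  obtain ⟨n, hn, rfl⟩ := ht
  exact hy.eventTime_pos hn

namespace NoUTurn

variable {E : Type*} [MeasurableSpace E] {D Dr : PDMP E} {valid : Set (PathSegment E)}

/-- The almost sure properties of the pair `(w, α)`: in particular, the two endpoints of the stopped
path are not both events. -/
structure Regular (D Dr : PDMP E) (valid : Set (PathSegment E)) (w : FullPath E) (α : ℝ) :
    Prop where
  good : FullPath.Good D Dr valid w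
  pos : 0 < α
  lt_one : α < 1
  not_both : ¬ (offset D Dr valid w α ∈ w.2.eventTimes ∧ right D Dr valid w α ∈ w.1.eventTimes)

namespace Regular

variable {w : FullPath E} {α : ℝ}

theorem length_nonneg (D Dr : PDMP E) (valid : Set (PathSegment E)) (w : FullPath E) (α : ℝ) :
    0 ≤ length D Dr valid w α :=
  Real.sSup_nonneg fun _ ht => ht.1

theorem pos_of_right_mem (h : Regular D Dr valid w α)
    (hr : right D Dr valid w α ∈ w.1.eventTimes) : 0 < length D Dr valid w α :=
  pos_of_mul_pos_right (h.good.1.pos_of_mem_eventTimes hr) (by linarith [h.lt_one])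

theorem pos_of_offset_mem (h : Regular D Dr valid w α)
    (hr : offset D Dr valid w α ∈ w.2.eventTimes) : 0 < length D Dr valid w α :=
  pos_of_mul_pos_right (h.good.2.1.pos_of_mem_eventTimes hr) h.pos.le

theorem mem_or_mem (h : Regular D Dr valid w α) (hT : 0 < length D Dr valid w α) :
    offset D Dr valid w α ∈ w.2.eventTimes ∨ right D Dr valid w α ∈ w.1.eventTimes := by
  have h1 : 0 < offset D Dr valid w α := mul_pos h.pos hT
  have h2 : 0 < right D Dr valid w α := mul_pos (by linarith [h.lt_one]) hT
  rw [← FullPath.neg_mem_times_of_pos h1, ← FullPath.mem_times_of_pos h2]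
  exact h.good.2.2.mem_or_mem h.pos h.lt_one hT

theorem hit_forward (h : Regular D Dr valid w α)
    (hr : right D Dr valid w α ∈ w.1.eventTimes) :
    HitForward D Dr valid w α ∧ ¬ HitBackward D Dr valid w α := by
  have hT := h.pos_of_right_mem hr
  have h1 : 0 < offset D Dr valid w α := mul_pos h.pos hT
  refine h.good.2.2.hit_forward h.pos h.lt_one hT fun hmem => h.not_both ⟨?_, hr⟩
  exact (FullPath.neg_mem_times_of_pos h1).1 hmem

theorem hit_backward (h : Regular D Dr valid w α)
    (hr : offset D Dr valid w α ∈ w.2.eventTimes) :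
    HitBackward D Dr valid w α ∧ ¬ HitForward D Dr valid w α := by
  have hT := h.pos_of_offset_mem hr
  have h2 : 0 < right D Dr valid w α := mul_pos (by linarith [h.lt_one]) hT
  refine h.good.2.2.hit_backward h.pos h.lt_one hT fun hmem => h.not_both ⟨hr, ?_⟩
  exact (FullPath.mem_times_of_pos h2).1 hmem

theorem path_fst (D Dr : PDMP E) (valid : Set (PathSegment E)) (w : FullPath E) (α : ℝ) :
    (path D Dr valid w α).1 = length D Dr valid w α := by
  simp only [path, FullPath.segment, left, right]
  ring

end Regular

/-- The paths with an event at their right endpoint (if they have finitely many events). -/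
def endsAtEvent (E : Type*) [MeasurableSpace E] : Set (PathSegment E) :=
  {x | ∀ q : ℚ, (q : ℝ) < x.1 → x.2.2 (Ioi (q : ℝ) ×ˢ univ) ≠ 0}

theorem measurableSet_endsAtEvent : MeasurableSet (endsAtEvent E) := by
  have : endsAtEvent E = ⋂ q : ℚ, ({x : PathSegment E | (q : ℝ) < x.1}ᶜ ∪
      {x : PathSegment E | x.2.2 (Ioi (q : ℝ) ×ˢ univ) = 0}ᶜ) := by
    ext x
    simp only [endsAtEvent, mem_iInter, mem_union, mem_compl_iff, mem_ofPred_eq]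
    exact forall_congr' fun q => imp_iff_not_or
  rw [this]
  refine MeasurableSet.iInter fun q => MeasurableSet.union (MeasurableSet.compl ?_)
    (MeasurableSet.compl ?_)
  · exact measurableSet_lt measurable_const measurable_fst
  · have hm : Measurable (fun x : PathSegment E => x.2.2 (Ioi (q : ℝ) ×ˢ univ)) :=
      (Measure.measurable_coe (measurableSet_Ioi.prod MeasurableSet.univ)).comp
        (measurable_snd.comp measurable_snd)
    exact hm (measurableSet_singleton 0)

/-- If events occur arbitrarily late in the segment, local finiteness forces one of them to be at
the right endpoint. -/
theorem segment_mem_endsAtEvent_iff {w : FullPath E} (h1 : w.1.Regular) (h2 : w.2.Regular)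
    {a b : ℝ} (hab : a < b) :
    FullPath.segment D Dr w a b ∈ endsAtEvent E ↔ b ∈ w.times := by
  have key : ∀ q : ℝ, (FullPath.segment D Dr w a b).2.2 (Ioi q ×ˢ univ) ≠ 0 ↔
      ∃ t ∈ w.times, q + a < t ∧ a ≤ t ∧ t ≤ b := by
    intro q
    have hm : MeasurableSet (Ioi q ×ˢ (univ : Set (E × E))) := measurableSet_Ioi.prod .univ
    have hset : (fun p : ℝ × E × E => (p.1 - a, p.2)) ⁻¹' (Ioi q ×ˢ univ) ∩ Icc a b ×ˢ univ
        = (Ioi (q + a) ∩ Icc a b) ×ˢ univ := by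
      ext p
      simp only [mem_inter_iff, mem_preimage, mem_prod, mem_Ioi, mem_Icc, mem_univ, and_true,
        lt_sub_iff_add_lt]
    have hf : Measurable (fun p : ℝ × E × E => (p.1 - a, p.2)) := by fun_prop
    simp only [FullPath.segment]
    rw [Measure.map_apply hf hm, Measure.restrict_apply (hf hm), hset, Ne,
      FullPath.events_eq_zero_iff D Dr (measurableSet_Ioi.inter measurableSet_Icc)]
    simp only [mem_inter_iff, mem_Ioi, mem_Icc, not_forall, not_not]
    constructor
    · rintro ⟨t, ⟨h3, h4, h5⟩, h6⟩
      exact ⟨t, h6, h3, h4, h5⟩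
    · rintro ⟨t, h6, h3, h4, h5⟩
      exact ⟨t, ⟨h3, h4, h5⟩, h6⟩
  constructor
  · intro h
    by_contra hb
    obtain ⟨ε, hε, hgap⟩ := FullPath.times_gap h1 h2 b
    obtain ⟨q, hq1, hq2⟩ := exists_rat_btwn (show b - a - ε < b - a by linarith)
    obtain ⟨t, ht, h3, h4, h5⟩ := (key q).1 (h q hq2)
    by_cases htb : t = b
    · exact hb (htb ▸ ht)
    · exact hgap t (abs_lt.2 ⟨by linarith, by linarith⟩) htb ht
  · intro hb q hq
    have hq' : (q : ℝ) < b - a := hq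
    exact (key q).2 ⟨b, hb, by linarith, hab.le, le_rfl⟩

theorem Regular.path_mem_endsAtEvent_iff {w : FullPath E} {α : ℝ} (h : Regular D Dr valid w α)
    (hT : 0 < length D Dr valid w α) :
    path D Dr valid w α ∈ endsAtEvent E ↔ right D Dr valid w α ∈ w.1.eventTimes := by
  have h1 : 0 < offset D Dr valid w α := mul_pos h.pos hT
  have h2 : 0 < right D Dr valid w α := mul_pos (by linarith [h.lt_one]) hT
  rw [← FullPath.mem_times_of_pos h2]
  refine segment_mem_endsAtEvent_iff h.good.1 h.good.2.1 (lt_trans ?_ h2)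
  exact neg_neg_of_pos h1

/-- For events at `e` and `-s`, both endpoints are events only if `α = s / (s + e)`. Given the path,
this excludes countably many values of the independent uniform variable `α`. -/
theorem ae_regular {π : Measure E} [IsProbabilityMeasure π]
    (hgood : ∀ᵐ w ∂(FullPath.law D Dr π), FullPath.Good D Dr valid w) :
    ∀ᵐ q ∂((FullPath.law D Dr π).prod (volume.restrict (Ioo (0 : ℝ) 1))),
      Regular D Dr valid q.1 q.2 := by
  have h1 := Measure.quasiMeasurePreserving_fst (μ := FullPath.law D Dr π)
    (ν := volume.restrict (Ioo (0 : ℝ) 1)) |>.ae hgood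
  have h2 := Measure.quasiMeasurePreserving_snd (μ := FullPath.law D Dr π)
    (ν := volume.restrict (Ioo (0 : ℝ) 1)) |>.ae (ae_restrict_mem measurableSet_Ioo)
  have h3 : ∀ᵐ q ∂((FullPath.law D Dr π).prod (volume.restrict (Ioo (0 : ℝ) 1))),
      ∀ m n : ℕ, ¬ (0 < (q.2 : ℝ) ∧ 0 < (q.1.2.eventTime (m + 1)).toReal ∧
        0 < (q.1.1.eventTime (n + 1)).toReal ∧ q.2 * (q.1.1.eventTime (n + 1)).toReal
          = (1 - q.2) * (q.1.2.eventTime (m + 1)).toReal) := by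
    refine ae_all_iff.2 fun m => ae_all_iff.2 fun n => ?_
    have hm1 : Measurable (fun q : FullPath E × ℝ => (q.1.2.eventTime (m + 1)).toReal) :=
      ((Skeleton.measurable_eventTime (m + 1)).comp (measurable_snd.comp measurable_fst)).ennreal_toReal
    have hm2 : Measurable (fun q : FullPath E × ℝ => (q.1.1.eventTime (n + 1)).toReal) :=
      ((Skeleton.measurable_eventTime (n + 1)).comp (measurable_fst.comp measurable_fst)).ennreal_toReal
    rw [Measure.ae_prod_iff_ae_ae]
    · refine ae_of_all _ fun w => ae_restrict_of_ae ?_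
      have hnull : volume {((w.2.eventTime (m + 1)).toReal /
          ((w.2.eventTime (m + 1)).toReal + (w.1.eventTime (n + 1)).toReal) : ℝ)} = 0 := by simp
      filter_upwards [measure_eq_zero_iff_ae_notMem.1 hnull] with α hα
      rintro ⟨-, hs, he, heq⟩
      refine hα ?_
      rw [mem_singleton_iff, eq_div_iff (add_pos hs he).ne']
      linarith
    · refine MeasurableSet.compl ?_
      exact (measurableSet_lt measurable_const measurable_snd).inter
        ((measurableSet_lt measurable_const hm1).inter ((measurableSet_lt measurable_const hm2).inter
          (measurableSet_eq_fun (measurable_snd.mul hm2)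
            ((measurable_const.sub measurable_snd).mul hm1))))
  filter_upwards [h1, h2, h3] with q hq1 hq2 hq3
  refine ⟨hq1, hq2.1, hq2.2, ?_⟩
  rintro ⟨⟨m, hm, hm'⟩, ⟨n, hn, hn'⟩⟩
  refine hq3 m n ⟨hq2.1, hq1.2.1.eventTime_pos hm, hq1.1.eventTime_pos hn, ?_⟩
  rw [hm', hn', right, offset]
  ring

end NoUTurn

theorem Skeleton.measurableSet_mem_eventTimes {E X : Type*} [MeasurableSpace E] [MeasurableSpace X]
    {y : X → Skeleton E} {t : X → ℝ} (hy : Measurable y) (ht : Measurable t) :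
    MeasurableSet {x | t x ∈ (y x).eventTimes} := by
  have : {x | t x ∈ (y x).eventTimes} = ⋃ n, ({x | (y x).eventTime (n + 1) = ∞}ᶜ ∩
      {x | ((y x).eventTime (n + 1)).toReal = t x}) := by
    ext x
    simp [eventTimes]
  rw [this]
  have hm : ∀ n, Measurable (fun x => (y x).eventTime n) := fun n =>
    (Skeleton.measurable_eventTime n).comp hy
  exact MeasurableSet.iUnion fun n => (MeasurableSet.compl
    (hm (n + 1) (measurableSet_singleton ∞))).inter
      (measurableSet_eq_fun (hm (n + 1)).ennreal_toReal ht)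

/-! ### Disintegration of the joint law of the stopped path and the offset. -/

namespace NoUTurn

variable {E : Type*} [MeasurableSpace E]

open Classical in
/-- The conditional law of the offset, given the stopped path. -/
def offsetKernel (E : Type*) [MeasurableSpace E] : Kernel (PathSegment E) ℝ :=
  Kernel.piecewise (s := {x : PathSegment E | x.1 ≤ 0})
    (measurableSet_le measurable_fst measurable_const) (Kernel.const _ (Measure.dirac 0))
    (Kernel.piecewise measurableSet_endsAtEvent forwardKernel backwardKernel)

theorem offsetKernel_of_nonpos {x : PathSegment E} (hx : x.1 ≤ 0) :
    offsetKernel E x = Measure.dirac 0 := by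
  classical
  rw [offsetKernel, Kernel.piecewise_apply, if_pos (by exact hx), Kernel.const_apply]

theorem offsetKernel_forward {x : PathSegment E} (hx : 0 < x.1) (hx' : x ∈ endsAtEvent E) :
    offsetKernel E x = forwardLaw x.1 := by
  classical
  rw [offsetKernel, Kernel.piecewise_apply, if_neg (by exact not_le.2 hx), Kernel.piecewise_apply,
    if_pos (by exact hx')]
  rfl

theorem offsetKernel_backward {x : PathSegment E} (hx : 0 < x.1) (hx' : x ∉ endsAtEvent E) :
    offsetKernel E x = backwardLaw x.1 := by
  classical
  rw [offsetKernel, Kernel.piecewise_apply, if_neg (by exact not_le.2 hx), Kernel.piecewise_apply,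
    if_neg (by exact hx')]
  rfl

instance : IsMarkovKernel (offsetKernel E) := by
  refine ⟨fun x => ?_⟩
  rcases le_or_gt x.1 0 with hx | hx
  · rw [offsetKernel_of_nonpos hx]
    infer_instance
  · by_cases hx' : x ∈ endsAtEvent E
    · rw [offsetKernel_forward hx hx']
      exact isProbabilityMeasure_forwardLaw hx
    · rw [offsetKernel_backward hx hx']
      exact isProbabilityMeasure_backwardLaw hx

variable (D Dr : PDMP E) (valid : Set (PathSegment E))

/-- A measurable version of the right endpoint of the stopped path. -/
def rightM (q : FullPath E × ℝ) : ℝ := (1 - q.2) * FullPath.stopLengthM D Dr valid q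

/-- A measurable version of the offset. -/
def offsetM (q : FullPath E × ℝ) : ℝ := q.2 * FullPath.stopLengthM D Dr valid q

/-- A measurable version of the stopped path. -/
def pathM (q : FullPath E × ℝ) : PathSegment E :=
  FullPath.segment D Dr q.1 (-(offsetM D Dr valid q)) (rightM D Dr valid q)

variable {D Dr valid}

theorem measurable_rightM (hmeas : MeasurableSet valid) : Measurable (rightM D Dr valid) :=
  (measurable_const.sub measurable_snd).mul (FullPath.measurable_stopLengthM D Dr hmeas)

theorem measurable_offsetM (hmeas : MeasurableSet valid) : Measurable (offsetM D Dr valid) :=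
  measurable_snd.mul (FullPath.measurable_stopLengthM D Dr hmeas)

theorem measurable_pathM (hmeas : MeasurableSet valid) : Measurable (pathM D Dr valid) :=
  FullPath.measurable_segment_comp D Dr measurable_fst (measurable_offsetM hmeas).neg
    (measurable_rightM hmeas)

theorem rightM_eq {w : FullPath E} (hw : FullPath.Good D Dr valid w) {α : ℝ} (h0 : 0 < α)
    (h1 : α < 1) : rightM D Dr valid (w, α) = right D Dr valid w α := by
  simp only [rightM, right, FullPath.stopLengthM_eq hw h0 h1]

theorem offsetM_eq {w : FullPath E} (hw : FullPath.Good D Dr valid w) {α : ℝ} (h0 : 0 < α)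
    (h1 : α < 1) : offsetM D Dr valid (w, α) = offset D Dr valid w α := by
  simp only [offsetM, offset, FullPath.stopLengthM_eq hw h0 h1]

theorem pathM_eq {w : FullPath E} (hw : FullPath.Good D Dr valid w) {α : ℝ} (h0 : 0 < α)
    (h1 : α < 1) : pathM D Dr valid (w, α) = path D Dr valid w α := by
  simp only [pathM, path, offsetM_eq hw h0 h1, rightM_eq hw h0 h1, left, offset]

variable {π : Measure E}

theorem lintegral_indicator_forward (hmeas : MeasurableSet valid)
    (hgood : ∀ᵐ w ∂(FullPath.law D Dr π), FullPath.Good D Dr valid w)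
    {g : PathSegment E × ℝ → ℝ≥0∞} (hg : Measurable g) :
    ∫⁻ q, {q : FullPath E × ℝ | rightM D Dr valid q ∈ q.1.1.eventTimes}.indicator
        (fun q => g (pathM D Dr valid q, offsetM D Dr valid q)) q
        ∂((FullPath.law D Dr π).prod (volume.restrict (Ioo (0 : ℝ) 1)))
      = ∫⁻ w, (∫⁻ α in Ioo 0 1, w.1.eventTimes.indicator
        (fun _ => g (path D Dr valid w α, offset D Dr valid w α))
        (right D Dr valid w α)) ∂(FullPath.law D Dr π) := by
  have hm : Measurable ({q : FullPath E × ℝ | rightM D Dr valid q ∈ q.1.1.eventTimes}.indicator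
      (fun q => g (pathM D Dr valid q, offsetM D Dr valid q))) :=
    (hg.comp ((measurable_pathM hmeas).prodMk (measurable_offsetM hmeas))).indicator
      (Skeleton.measurableSet_mem_eventTimes (measurable_fst.comp measurable_fst)
        (measurable_rightM hmeas))
  rw [lintegral_prod _ hm.aemeasurable]
  refine lintegral_congr_ae (hgood.mono fun w hw => ?_)
  refine setLIntegral_congr_fun measurableSet_Ioo fun α hα => ?_
  have hr : rightM D Dr valid (w, α) ∈ w.1.eventTimes ↔ right D Dr valid w α ∈ w.1.eventTimes := by
    rw [rightM_eq hw hα.1 hα.2]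
  by_cases h : right D Dr valid w α ∈ w.1.eventTimes
  · rw [indicator_of_mem h, indicator_of_mem (by exact hr.2 h), offsetM_eq hw hα.1 hα.2,
      pathM_eq hw hα.1 hα.2]
  · rw [indicator_of_notMem h, indicator_of_notMem (by exact fun h' => h (hr.1 h'))]

theorem lintegral_indicator_backward (hmeas : MeasurableSet valid)
    (hgood : ∀ᵐ w ∂(FullPath.law D Dr π), FullPath.Good D Dr valid w)
    {g : PathSegment E × ℝ → ℝ≥0∞} (hg : Measurable g) :
    ∫⁻ q, {q : FullPath E × ℝ | offsetM D Dr valid q ∈ q.1.2.eventTimes}.indicator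
        (fun q => g (pathM D Dr valid q, offsetM D Dr valid q)) q
        ∂((FullPath.law D Dr π).prod (volume.restrict (Ioo (0 : ℝ) 1)))
      = ∫⁻ w, (∫⁻ α in Ioo 0 1, w.2.eventTimes.indicator
        (fun _ => g (path D Dr valid w α, offset D Dr valid w α))
        (offset D Dr valid w α)) ∂(FullPath.law D Dr π) := by
  have hm : Measurable ({q : FullPath E × ℝ | offsetM D Dr valid q ∈ q.1.2.eventTimes}.indicator
      (fun q => g (pathM D Dr valid q, offsetM D Dr valid q))) :=
    (hg.comp ((measurable_pathM hmeas).prodMk (measurable_offsetM hmeas))).indicator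
      (Skeleton.measurableSet_mem_eventTimes (measurable_snd.comp measurable_fst)
        (measurable_offsetM hmeas))
  rw [lintegral_prod _ hm.aemeasurable]
  refine lintegral_congr_ae (hgood.mono fun w hw => ?_)
  refine setLIntegral_congr_fun measurableSet_Ioo fun α hα => ?_
  have ho : offsetM D Dr valid (w, α) ∈ w.2.eventTimes ↔
      offset D Dr valid w α ∈ w.2.eventTimes := by
    rw [offsetM_eq hw hα.1 hα.2]
  by_cases h : offset D Dr valid w α ∈ w.2.eventTimes
  · rw [indicator_of_mem h, indicator_of_mem (by exact ho.2 h), offsetM_eq hw hα.1 hα.2,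
      pathM_eq hw hα.1 hα.2]
  · rw [indicator_of_notMem h, indicator_of_notMem (by exact fun h' => h (ho.1 h'))]

/-- The decomposition according to the direction in which the criterion is hit. -/
theorem lintegral_eq_add [IsProbabilityMeasure π] (hmeas : MeasurableSet valid)
    (hgood : ∀ᵐ w ∂(FullPath.law D Dr π), FullPath.Good D Dr valid w)
    {h : FullPath E × ℝ → ℝ≥0∞} (hh : Measurable h) :
    ∫⁻ q, h q ∂((FullPath.law D Dr π).prod (volume.restrict (Ioo (0 : ℝ) 1)))
      = ∫⁻ q, {q | (pathM D Dr valid q).1 ≤ 0}.indicator h q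
          ∂((FullPath.law D Dr π).prod (volume.restrict (Ioo (0 : ℝ) 1)))
        + ∫⁻ q, {q : FullPath E × ℝ | rightM D Dr valid q ∈ q.1.1.eventTimes}.indicator h q
          ∂((FullPath.law D Dr π).prod (volume.restrict (Ioo (0 : ℝ) 1)))
        + ∫⁻ q, {q : FullPath E × ℝ | offsetM D Dr valid q ∈ q.1.2.eventTimes}.indicator h q
          ∂((FullPath.law D Dr π).prod (volume.restrict (Ioo (0 : ℝ) 1))) := by
  have m1 : MeasurableSet {q | (pathM D Dr valid q).1 ≤ 0} :=
    measurableSet_le (measurable_fst.comp (measurable_pathM hmeas)) measurable_const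
  have m2 : MeasurableSet {q : FullPath E × ℝ | rightM D Dr valid q ∈ q.1.1.eventTimes} :=
    Skeleton.measurableSet_mem_eventTimes (measurable_fst.comp measurable_fst)
      (measurable_rightM hmeas)
  rw [← lintegral_add_left (hh.indicator m1),
    ← lintegral_add_left (by exact (hh.indicator m1).add (hh.indicator m2))]
  refine lintegral_congr_ae ((ae_regular hgood).mono fun q hq => ?_)
  obtain ⟨w, α⟩ := q
  have e1 := rightM_eq hq.good hq.pos hq.lt_one
  have e2 := offsetM_eq hq.good hq.pos hq.lt_one
  have e3 : (pathM D Dr valid (w, α)).1 = length D Dr valid w α := by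
    rw [pathM_eq hq.good hq.pos hq.lt_one, Regular.path_fst]
  change h (w, α) = {q | (pathM D Dr valid q).1 ≤ 0}.indicator h (w, α)
    + {q : FullPath E × ℝ | rightM D Dr valid q ∈ q.1.1.eventTimes}.indicator h (w, α)
    + {q : FullPath E × ℝ | offsetM D Dr valid q ∈ q.1.2.eventTimes}.indicator h (w, α)
  have i1 : (w, α) ∈ {q : FullPath E × ℝ | rightM D Dr valid q ∈ q.1.1.eventTimes} ↔
      right D Dr valid w α ∈ w.1.eventTimes := by
    change rightM D Dr valid (w, α) ∈ w.1.eventTimes ↔ _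
    rw [e1]
  have i2 : (w, α) ∈ {q : FullPath E × ℝ | offsetM D Dr valid q ∈ q.1.2.eventTimes} ↔
      offset D Dr valid w α ∈ w.2.eventTimes := by
    change offsetM D Dr valid (w, α) ∈ w.2.eventTimes ↔ _
    rw [e2]
  have i3 : (w, α) ∈ {q | (pathM D Dr valid q).1 ≤ 0} ↔ length D Dr valid w α ≤ 0 := by
    change (pathM D Dr valid (w, α)).1 ≤ 0 ↔ _
    rw [e3]
  by_cases hr : right D Dr valid w α ∈ w.1.eventTimes
  · have ho : offset D Dr valid w α ∉ w.2.eventTimes := fun ho => hq.not_both ⟨ho, hr⟩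
    rw [indicator_of_notMem fun h' => (i3.1 h').not_gt (hq.pos_of_right_mem hr),
      indicator_of_mem (i1.2 hr), indicator_of_notMem fun h' => ho (i2.1 h'), zero_add, add_zero]
  · by_cases ho : offset D Dr valid w α ∈ w.2.eventTimes
    · rw [indicator_of_notMem fun h' => (i3.1 h').not_gt (hq.pos_of_offset_mem ho),
        indicator_of_notMem fun h' => hr (i1.1 h'), indicator_of_mem (i2.2 ho), zero_add, zero_add]
    · have : length D Dr valid w α ≤ 0 := by
        by_contra! hcon
        exact (hq.mem_or_mem hcon).elim ho hr
      rw [indicator_of_mem (i3.2 this), indicator_of_notMem fun h' => hr (i1.1 h'),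
        indicator_of_notMem fun h' => ho (i2.1 h'), add_zero, add_zero]

/-- Both sides are split into zero length, forward hits and backward hits. The first part is
trivial, and the other two are the resampling identities, since `endsAtEvent` selects the matching
law. -/
theorem map_eq_compProd [IsProbabilityMeasure π] (hD : D.NonExplosive π) (hDr : Dr.NonExplosive π)
    (hrev : D.IsTimeReversal Dr π) (hmeas : MeasurableSet valid)
    (hgood : ∀ᵐ w ∂(FullPath.law D Dr π), FullPath.Good D Dr valid w) :
    ((FullPath.law D Dr π).prod (volume.restrict (Ioo (0 : ℝ) 1))).map
        (fun q => (pathM D Dr valid q, offsetM D Dr valid q))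
      = ((FullPath.law D Dr π).prod (volume.restrict (Ioo (0 : ℝ) 1))).map (pathM D Dr valid)
        ⊗ₘ offsetKernel E := by
  have mp := measurable_pathM (D := D) (Dr := Dr) hmeas
  have mo := measurable_offsetM (D := D) (Dr := Dr) hmeas
  have hmS : ∀ n : ℕ, MeasurableSet {x : PathSegment E × ℝ | x.1.1 ≤ n} := fun n =>
    measurableSet_le (by fun_prop) measurable_const
  -- Comparing on paths of length at most `n` allows test functions that vanish on longer paths, so
  -- that bounded windows suffice.
  refine (Measure.ext_iff_of_iUnion_eq_univ (s := fun n : ℕ => {x : PathSegment E × ℝ | x.1.1 ≤ n})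
    (eq_univ_of_forall fun x => mem_iUnion.2 (exists_nat_ge x.1.1))).2 fun n =>
      Measure.ext_of_lintegral _ fun g hg => ?_
  rw [← lintegral_indicator (hmS n), ← lintegral_indicator (hmS n)]
  have hf := hg.indicator (hmS n)
  have hf0 : ∀ (x : PathSegment E) (l : ℝ), (n : ℝ) < x.1 →
      {x : PathSegment E × ℝ | x.1.1 ≤ n}.indicator g (x, l) = 0 := fun x l hx =>
    indicator_of_notMem (by exact not_le.2 hx) _
  generalize {x : PathSegment E × ℝ | x.1.1 ≤ n}.indicator g = f at hf hf0 ⊢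
  have hfk' : Measurable (fun x : PathSegment E => ∫⁻ l, f (x, l) ∂(offsetKernel E x)) :=
    Measurable.lintegral_kernel_prod_right' hf
  rw [lintegral_map hf (mp.prodMk mo), Measure.lintegral_compProd hf, lintegral_map hfk' mp]
  refine (lintegral_eq_add hmeas hgood (hf.comp (mp.prodMk mo))).trans
    (Eq.trans ?_ (lintegral_eq_add hmeas hgood (hfk'.comp mp)).symm)
  congr 1
  · congr 1
    · refine lintegral_congr_ae ((ae_regular hgood).mono fun q hq => ?_)
      obtain ⟨w, α⟩ := q
      have e2 := offsetM_eq hq.good hq.pos hq.lt_one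
      have e3 : (pathM D Dr valid (w, α)).1 = length D Dr valid w α := by
        rw [pathM_eq hq.good hq.pos hq.lt_one, Regular.path_fst]
      by_cases h0 : (pathM D Dr valid (w, α)).1 ≤ 0
      · rw [indicator_of_mem (by exact h0), indicator_of_mem (by exact h0)]
        -- This case includes paths that never stop, whose length is `0` by the convention for
        -- `sSup`; the offset is then `0`, in agreement with the Dirac mass.
        have h1 : length D Dr valid w α = 0 :=
          le_antisymm (e3 ▸ h0) (Regular.length_nonneg D Dr valid w α)
        have h2 : offset D Dr valid w α = 0 := by rw [offset, h1, mul_zero]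
        have hfx : Measurable (fun l => f (pathM D Dr valid (w, α), l)) :=
          hf.comp measurable_prodMk_left
        simp only [Function.comp_apply]
        rw [offsetKernel_of_nonpos h0, lintegral_dirac' _ hfx]
        simp only [e2, h2]
      · rw [indicator_of_notMem (by exact h0), indicator_of_notMem (by exact h0)]
    · have h1 := lintegral_indicator_forward hmeas hgood hf
      have h2 := lintegral_indicator_forward hmeas hgood (measurable_lintegral_fst forwardKernel hf)
      have h3 := FullPath.lintegral_forward_resample hD hDr hrev hmeas hgood hf hf0
      refine h1.trans (h3.trans (h2.symm.trans ?_))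
      refine lintegral_congr_ae ((ae_regular hgood).mono fun q hq => ?_)
      obtain ⟨w, α⟩ := q
      by_cases hr : rightM D Dr valid (w, α) ∈ w.1.eventTimes
      · rw [indicator_of_mem (by exact hr), indicator_of_mem (by exact hr)]
        rw [rightM_eq hq.good hq.pos hq.lt_one] at hr
        have hT := hq.pos_of_right_mem hr
        simp only [Function.comp_apply, pathM_eq hq.good hq.pos hq.lt_one]
        rw [offsetKernel_forward (by rwa [Regular.path_fst]) ((hq.path_mem_endsAtEvent_iff hT).2 hr)]
        rfl
      · rw [indicator_of_notMem (by exact hr), indicator_of_notMem (by exact hr)]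
  · have h1 := lintegral_indicator_backward hmeas hgood hf
    have h2 := lintegral_indicator_backward hmeas hgood (measurable_lintegral_fst backwardKernel hf)
    have h3 := FullPath.lintegral_backward_resample hD hDr hrev hmeas hgood hf hf0
    refine h1.trans (h3.trans (h2.symm.trans ?_))
    refine lintegral_congr_ae ((ae_regular hgood).mono fun q hq => ?_)
    obtain ⟨w, α⟩ := q
    by_cases ho : offsetM D Dr valid (w, α) ∈ w.2.eventTimes
    · rw [indicator_of_mem (by exact ho), indicator_of_mem (by exact ho)]
      rw [offsetM_eq hq.good hq.pos hq.lt_one] at ho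
      have hT := hq.pos_of_offset_mem ho
      simp only [Function.comp_apply, pathM_eq hq.good hq.pos hq.lt_one]
      rw [offsetKernel_backward (by rwa [Regular.path_fst])
        fun hr => hq.not_both ⟨ho, (hq.path_mem_endsAtEvent_iff hT).1 hr⟩]
      rfl
    · rw [indicator_of_notMem (by exact ho), indicator_of_notMem (by exact ho)]

end NoUTurn

theorem mainTheorem3 {E : Type*} [MeasurableSpace E]
    (D Dr : PDMP E) (π : Measure E) [IsProbabilityMeasure π]
    (hinv : D.Invariant π) (hD : D.NonExplosive π) (hDr : Dr.NonExplosive π)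
    (hrev : D.IsTimeReversal Dr π)
    (valid : Set (PathSegment E)) (hmeas : MeasurableSet valid)
    (hcons : StoppingCriterion.Consistent D Dr valid)
    (hev : StoppingCriterion.DependsOnlyOnEvents D Dr valid)
    {Ω : Type*} [MeasurableSpace Ω] (P : Measure Ω) [IsProbabilityMeasure P]
    (Z : Ω → FullPath E) (α : Ω → ℝ)
    (hZ : HasLaw Z (FullPath.law D Dr π) P)
    (hα : HasLaw α (volume.restrict (Ioo (0 : ℝ) 1)) P)
    (hind : IndepFun Z α P) :
    let T : Ω → ℝ := fun ω => NoUTurn.length D Dr valid (Z ω) (α ω)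
    let X : Ω → PathSegment E := fun ω => NoUTurn.path D Dr valid (Z ω) (α ω)
    let l : Ω → ℝ := fun ω => NoUTurn.offset D Dr valid (Z ω) (α ω)
    AEMeasurable X P ∧ AEMeasurable l P ∧
    ∀ᵐ ω ∂P, NoUTurn.Constructs D Dr valid (Z ω) (α ω) →
      Xor (NoUTurn.HitForward D Dr valid (Z ω) (α ω))
        (NoUTurn.HitBackward D Dr valid (Z ω) (α ω)) ∧
      (NoUTurn.HitForward D Dr valid (Z ω) (α ω) →
        condDistrib l X P (X ω) = NoUTurn.forwardLaw (T ω)) ∧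
      (NoUTurn.HitBackward D Dr valid (Z ω) (α ω) →
        condDistrib l X P (X ω) = NoUTurn.backwardLaw (T ω)) := by
  intro T X l
  have hgood := FullPath.ae_good hD hDr hmeas hcons hev
  have hZα : AEMeasurable (fun ω => (Z ω, α ω)) P := hZ.aemeasurable.prodMk hα.aemeasurable
  have hlaw : P.map (fun ω => (Z ω, α ω))
      = (FullPath.law D Dr π).prod (volume.restrict (Ioo (0 : ℝ) 1)) := by
    rw [(indepFun_iff_map_prod_eq_prod_map_map hZ.aemeasurable hα.aemeasurable).1 hind, hZ.map_eq,
      hα.map_eq]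
  have hreg : ∀ᵐ ω ∂P, NoUTurn.Regular D Dr valid (Z ω) (α ω) := by
    have := NoUTurn.ae_regular hgood
    rw [← hlaw] at this
    exact ae_of_ae_map hZα this
  have mp := NoUTurn.measurable_pathM (D := D) (Dr := Dr) hmeas
  have mo := NoUTurn.measurable_offsetM (D := D) (Dr := Dr) hmeas
  have hX : (fun ω => NoUTurn.pathM D Dr valid (Z ω, α ω)) =ᵐ[P] X :=
    hreg.mono fun ω h => NoUTurn.pathM_eq h.good h.pos h.lt_one
  have hl : (fun ω => NoUTurn.offsetM D Dr valid (Z ω, α ω)) =ᵐ[P] l :=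
    hreg.mono fun ω h => NoUTurn.offsetM_eq h.good h.pos h.lt_one
  have hXm : AEMeasurable X P := (mp.comp_aemeasurable hZα).congr hX
  have hlm : AEMeasurable l P := (mo.comp_aemeasurable hZα).congr hl
  refine ⟨hXm, hlm, ?_⟩
  have hjoint : P.map (fun ω => (X ω, l ω)) = P.map X ⊗ₘ NoUTurn.offsetKernel E := by
    have h1 : P.map (fun ω => (X ω, l ω)) = (P.map (fun ω => (Z ω, α ω))).map
        (fun q => (NoUTurn.pathM D Dr valid q, NoUTurn.offsetM D Dr valid q)) := by
      rw [AEMeasurable.map_map_of_aemeasurable (mp.prodMk mo).aemeasurable hZα]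
      refine Measure.map_congr ?_
      filter_upwards [hX, hl] with ω h1 h2
      simp only [Function.comp_apply, h1, h2]
    have h2 : P.map X = (P.map (fun ω => (Z ω, α ω))).map (NoUTurn.pathM D Dr valid) := by
      rw [AEMeasurable.map_map_of_aemeasurable mp.aemeasurable hZα]
      exact Measure.map_congr hX.symm
    rw [h1, h2, hlaw]
    exact NoUTurn.map_eq_compProd hD hDr hrev hmeas hgood
  -- The disintegration identifies the conditional law for almost every value of `X`, hence almost
  -- surely along `ω`.
  have hcond := ae_of_ae_map hXm (condDistrib_ae_eq_of_measure_eq_compProd X hlm hjoint)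
  filter_upwards [hreg, hcond] with ω h hc hcons
  have hT : 0 < NoUTurn.length D Dr valid (Z ω) (α ω) := hcons.2
  have hT' : 0 < (X ω).1 := by rwa [NoUTurn.Regular.path_fst]
  have hXT : (X ω).1 = T ω := NoUTurn.Regular.path_fst D Dr valid (Z ω) (α ω)
  have hiff := h.path_mem_endsAtEvent_iff hT
  rcases h.mem_or_mem hT with ho | hr
  · obtain ⟨h1, h2⟩ := h.hit_backward ho
    refine ⟨Or.inr ⟨h1, h2⟩, fun h3 => absurd h3 h2, fun _ => ?_⟩
    rw [hc, NoUTurn.offsetKernel_backward hT' fun hm => h.not_both ⟨ho, hiff.1 hm⟩, hXT]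
  · obtain ⟨h1, h2⟩ := h.hit_forward hr
    refine ⟨Or.inl ⟨h1, h2⟩, fun _ => ?_, fun h3 => absurd h3 h2⟩
    rw [hc, NoUTurn.offsetKernel_forward hT' (hiff.2 hr), hXT]
end
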